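/- Let $-D<0$ be a fundamental discriminant with Kronecker symbol $\chi_D(\cdot)=\left(\frac{-D}{\cdot}\right)$, and let $\chi_{d_1},\chi_{d_2}$ be real primitive Dirichlet characters modulo $d_1,d_2$ such that $(d_1,d_2)=1$, $d_1d_2=D$ and $\chi_{d_1}\chi_{d_2}=\chi_D$. For $\operatorname{Re}s>1$ put $$L(s)=L(s,\chi_{d_1})L(s,\chi_{d_2})=\sum_{n\ge1}\frac{r(n)}{n^s},\qquad L(s)^{-1/2}=\sum_{\nu\ge1}\frac{\alpha(\nu)}{\nu^s}\quad(\alpha(1)=1).$$ For $X\ge3$ let $\beta(\nu)=\alpha(\nu)\mathcal L(\nu)$, where $\mathcal L(\nu)=1$ for $\nu<\sqrt X$, $\mathcal L(\nu)=2\,\frac{\log (X/\nu)}{\log X}$ for $\sqrt X\le\nu\le X$, and $\mathcal L(\nu)=0$ otherwise. For $m\ge1$ and $\operatorname{Re}s>0$ let $$K(m,s)=\prod_{p\mid m}\Bigl(\sum_{k\ge0}\frac{r(p^k)^2}{p^{ks}}\Bigr)^{-1}\prod_{p^a\,\|\,m}\Bigl(\sum_{k\ge0}\frac{r(p^{a+k})\,r(p^k)}{p^{ks}}\Bigr),$$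 and let $$S_X(z)=\sum_{\nu_1,\nu_2,\nu_3,\nu_4\le X}\frac{\beta(\nu_1)\beta(\nu_2)\beta(\nu_3)\beta(\nu_4)}{\nu_2\nu_4}\Bigl(\frac{q}{\nu_1\nu_3}\Bigr)^{1-z}K\Bigl(\frac{\nu_1\nu_4}{q},1-z\Bigr)K\Bigl(\frac{\nu_2\nu_3}{q},1-z\Bigr),\qquad q=\gcd(\nu_1\nu_4,\nu_2\nu_3).$$ Then there is an absolute constant $C\ge1$ with the following property. For every such choice of $D,\chi_{d_1},\chi_{d_2}$ there is a constant $A>0$ such that $$|S_X(z)|\le A\,\frac{X^{2|z|}}{(\log X)^2}$$ for all real $X\ge3$ and all complex $z$ with $|z|\le C^{-1}$ and $\operatorname{Re}z\ge-\frac1{\log X}$. -/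

import Mathlib

noncomputable section

namespace SelbergSum

open scoped LSeries.notation

/-- `d` is a fundamental discriminant (the discriminant of a quadratic number field). -/
def IsFundamentalDiscriminant (d : ℤ) : Prop :=
  (d ≠ 1 ∧ d % 4 = 1 ∧ Squarefree d) ∨
    (4 ∣ d ∧ (d / 4 % 4 = 2 ∨ d / 4 % 4 = 3) ∧ Squarefree (d / 4))

/-- The Kronecker symbol `(a / n)` for a positive integer `n`: it is completely multiplicative
in `n`, it is the Jacobi symbol for odd `n`, and `(a / 2)` is `0` for even `a`, `1` for
`a ≡ ±1 (mod 8)` and `-1` for `a ≡ ±3 (mod 8)`. -/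
def kroneckerSymbol (a : ℤ) (n : ℕ) : ℤ :=
  ZMod.χ₈ (a : ZMod 8) ^ n.factorization 2 * jacobiSym a (n / 2 ^ n.factorization 2)

/-- The coefficients of the Dirichlet series of `ζ(s)^{-1/2} = ∏_p (1 - p^{-s})^{1/2}`: the
multiplicative function whose value at `p^k` is the coefficient `(-1)^k * binom(1/2, k)` of `x^k`
in the Taylor series of `(1 - x)^{1/2}`. -/
def zetaInvSqrtCoeff (n : ℕ) : ℂ :=
  n.factorization.prod fun _ k => (-1) ^ k * Ring.choose (1 / 2 : ℂ) k

theorem zetaInvSqrtCoeff_prime_pow {p : ℕ} (hp : p.Prime) (k : ℕ) :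
    zetaInvSqrtCoeff (p ^ k) = (-1) ^ k * Ring.choose (1 / 2 : ℂ) k := by
  rw [zetaInvSqrtCoeff, hp.factorization_pow]
  exact Finsupp.prod_single_index (by simp)

theorem norm_zetaInvSqrtCoeff_le (n : ℕ) : ‖zetaInvSqrtCoeff n‖ ≤ 1 := by
  have hb : ∀ k : ℕ, ‖Ring.choose (1 / 2 : ℂ) k‖ ≤ 1 := by
    intro k
    induction k with
    | zero => simp
    | succ k ih =>
      have h := Ring.choose_add_smul_choose (1 / 2 - k : ℂ) 1 k
      have h' : ((k : ℂ) + 1) * Ring.choose (1 / 2 : ℂ) (k + 1) =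
          Ring.choose (1 / 2 : ℂ) k * (1 / 2 - k) := by
        simpa [add_comm 1 k, mul_comm] using h
      have h2 : ‖(1 / 2 - k : ℂ)‖ ≤ (k : ℝ) + 1 := by
        calc ‖(1 / 2 - k : ℂ)‖ ≤ ‖(1 / 2 : ℂ)‖ + ‖(k : ℂ)‖ := norm_sub_le _ _
          _ ≤ (k : ℝ) + 1 := by norm_num; linarith
      have h3 : ((k : ℝ) + 1) * ‖Ring.choose (1 / 2 : ℂ) (k + 1)‖ =
          ‖Ring.choose (1 / 2 : ℂ) k‖ * ‖(1 / 2 - k : ℂ)‖ := by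
        rw [← norm_mul, ← h', norm_mul]
        congr 1
        exact_mod_cast (Complex.norm_natCast (k + 1)).symm
      have h4 : ‖Ring.choose (1 / 2 : ℂ) k‖ * ‖(1 / 2 - k : ℂ)‖ ≤ 1 * ((k : ℝ) + 1) :=
        mul_le_mul ih h2 (norm_nonneg _) zero_le_one
      have h5 : (0 : ℝ) < (k : ℝ) + 1 := by positivity
      nlinarith
  rw [zetaInvSqrtCoeff, Finsupp.prod, norm_prod]
  refine Finset.prod_le_one (fun _ _ => norm_nonneg _) fun p _ => ?_
  simpa using hb _

open ArithmeticFunction in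
/-- The Dirichlet square of the coefficients of `ζ^{-1/2}` is the Möbius function. -/
theorem zetaInvSqrtCoeff_conv :
    zetaInvSqrtCoeff ⍟ zetaInvSqrtCoeff = fun n => (moebius n : ℂ) := by
  have hm : (toArithmeticFunction zetaInvSqrtCoeff).IsMultiplicative := by
    refine IsMultiplicative.iff_ne_zero.mpr ⟨by simp [toArithmeticFunction, zetaInvSqrtCoeff], ?_⟩
    intro m n hm hn hmn
    simp only [toArithmeticFunction, coe_mk, hm, hn, mul_eq_zero, or_self, if_false]
    simp only [zetaInvSqrtCoeff]
    rw [Nat.factorization_mul hm hn]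
    exact Finsupp.prod_add_index_of_disjoint (Nat.Coprime.disjoint_primeFactors hmn) _
  have key : toArithmeticFunction zetaInvSqrtCoeff * toArithmeticFunction zetaInvSqrtCoeff
      = ((moebius : ArithmeticFunction ℤ) : ArithmeticFunction ℂ) := by
    rw [IsMultiplicative.eq_iff_eq_on_prime_powers _ (hm.mul hm) _
      isMultiplicative_moebius.intCast]
    intro p k hp
    have h1 : (toArithmeticFunction zetaInvSqrtCoeff * toArithmeticFunction zetaInvSqrtCoeff)
        (p ^ k) = (-1) ^ k * Ring.choose (1 : ℂ) k := by
      have hv : Ring.choose (1 : ℂ) k = ∑ ij ∈ Finset.HasAntidiagonal.antidiagonal k,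
          Ring.choose (1 / 2 : ℂ) ij.1 * Ring.choose (1 / 2 : ℂ) ij.2 := by
        rw [← Ring.add_choose_eq k (Commute.all _ _)]
        norm_num
      rw [mul_apply, Nat.sum_divisorsAntidiagonal
        (f := fun a b => toArithmeticFunction zetaInvSqrtCoeff a *
          toArithmeticFunction zetaInvSqrtCoeff b), Nat.sum_divisors_prime_pow hp,
        hv, Finset.Nat.sum_antidiagonal_eq_sum_range_succ_mk, Finset.mul_sum]
      refine Finset.sum_congr rfl fun i hi => ?_
      have hik : i ≤ k := Nat.lt_succ_iff.mp (Finset.mem_range.mp hi)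
      rw [Nat.pow_div hik hp.pos]
      simp only [toArithmeticFunction, coe_mk, pow_eq_zero_iff', hp.ne_zero, false_and, if_false,
        zetaInvSqrtCoeff_prime_pow hp]
      rw [show (-1 : ℂ) ^ k = (-1) ^ i * (-1) ^ (k - i) by
        rw [← pow_add, Nat.add_sub_cancel' hik]]
      ring
    rw [h1, intCoe_apply]
    rcases Nat.eq_zero_or_pos k with rfl | hk
    · simp
    · rw [moebius_apply_prime_pow hp hk.ne']
      have : Ring.choose (1 : ℂ) k = (Nat.choose 1 k : ℂ) := by
        simpa using Ring.choose_natCast (R := ℂ) 1 k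
      rw [this]
      rcases eq_or_ne k 1 with rfl | hk1
      · simp
      · rw [Nat.choose_eq_zero_of_lt (by omega)]
        simp [hk1]
  funext n
  simp only [LSeries.convolution, key, intCoe_apply]

theorem twist_summable {d : ℕ} (χ : DirichletCharacter ℂ d) {s : ℂ} (hs : 1 < s.re) :
    LSeriesSummable (↗χ * zetaInvSqrtCoeff) s :=
  DirichletCharacter.LSeriesSummable_mul χ
    (LSeriesSummable_of_bounded_of_one_lt_re (m := 1)
      (fun n _ => norm_zetaInvSqrtCoeff_le n) hs)

theorem twist_sq {d : ℕ} (χ : DirichletCharacter ℂ d) {s : ℂ} (hs : 1 < s.re) :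
    LSeries (↗χ * zetaInvSqrtCoeff) s ^ 2 * LSeries ↗χ s = 1 := by
  rw [pow_two, ← LSeries_convolution' (twist_summable χ hs) (twist_summable χ hs),
    DirichletCharacter.mul_convolution_distrib, zetaInvSqrtCoeff_conv, mul_comm]
  exact DirichletCharacter.LSeries.mul_mu_eq_one χ hs

variable {d₁ d₂ : ℕ} (χ₁ : DirichletCharacter ℂ d₁) (χ₂ : DirichletCharacter ℂ d₂)

/-- The coefficients `r(n) = ∑_{ab = n} χ₁(a) χ₂(b)` of `L(s) = L(s, χ₁) L(s, χ₂)`. -/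
def rCoeff : ℕ → ℂ := ↗χ₁ ⍟ ↗χ₂

/-- The coefficients `α(ν)` of the Dirichlet series of
`L(s)^{-1/2} = L(s, χ₁)^{-1/2} L(s, χ₂)^{-1/2}`. As `χ` is completely multiplicative, the
coefficients of `L(s, χ)^{-1/2} = ∏_p (1 - χ(p) p^{-s})^{1/2}` are `χ(n)` times those of
`ζ(s)^{-1/2}`. -/
def alpha : ℕ → ℂ := (↗χ₁ * zetaInvSqrtCoeff) ⍟ (↗χ₂ * zetaInvSqrtCoeff)

/-- The coefficients `α(ν)` are those of `L(s)^{-1/2}` (the branch that tends to `1` as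
`Re s → ∞`), where `L(s) = ∑ r(n) n^{-s} = L(s, χ₁) L(s, χ₂)`. -/
theorem alpha_spec :
    alpha χ₁ χ₂ 1 = 1 ∧ ∀ s : ℂ, 1 < s.re →
      LSeriesSummable (alpha χ₁ χ₂) s ∧
        LSeries (rCoeff χ₁ χ₂) s = LSeries ↗χ₁ s * LSeries ↗χ₂ s ∧
        LSeries (alpha χ₁ χ₂) s ^ 2 * LSeries (rCoeff χ₁ χ₂) s = 1 := by
  refine ⟨?_, fun s hs => ?_⟩
  · simp [alpha, LSeries.convolution_def, zetaInvSqrtCoeff]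
  have h1 := twist_sq χ₁ hs
  have h2 := twist_sq χ₂ hs
  have h3 : LSeries (rCoeff χ₁ χ₂) s = LSeries ↗χ₁ s * LSeries ↗χ₂ s :=
    LSeries_convolution' (DirichletCharacter.LSeriesSummable_of_one_lt_re χ₁ hs)
      (DirichletCharacter.LSeriesSummable_of_one_lt_re χ₂ hs)
  refine ⟨(twist_summable χ₁ hs).convolution (twist_summable χ₂ hs), h3, ?_⟩
  rw [alpha, LSeries_convolution' (twist_summable χ₁ hs) (twist_summable χ₂ hs), h3]
  linear_combination h1 * (LSeries (↗χ₂ * zetaInvSqrtCoeff) s ^ 2 * LSeries ↗χ₂ s) + h2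

/-- The smoothing weight `ℒ(ν)` attached to the length `X`. -/
def weight (X : ℝ) (ν : ℕ) : ℝ :=
  if (ν : ℝ) < Real.sqrt X then 1
  else if (ν : ℝ) ≤ X then 2 * (Real.log (X / ν) / Real.log X)
  else 0

/-- `β(ν) = α(ν) ℒ(ν)`. -/
def beta (X : ℝ) (ν : ℕ) : ℂ := alpha χ₁ χ₂ ν * (weight X ν : ℂ)

/-- `K(m, s) = ∏_{p ∣ m} (∑_{k ≥ 0} r(p^k)^2 p^{-ks})^{-1}
      * ∏_{p^a ∥ m} ∑_{k ≥ 0} r(p^{a+k}) r(p^k) p^{-ks}`. -/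
def K (m : ℕ) (s : ℂ) : ℂ :=
  (∏ p ∈ m.primeFactors,
      (∑' k : ℕ, rCoeff χ₁ χ₂ (p ^ k) ^ 2 / (p : ℂ) ^ (k * s))⁻¹) *
    ∏ p ∈ m.primeFactors,
      ∑' k : ℕ, rCoeff χ₁ χ₂ (p ^ (m.factorization p + k)) * rCoeff χ₁ χ₂ (p ^ k) /
        (p : ℂ) ^ (k * s)

/-- The term of the diagonal Selberg sum at `(ν₁, ν₂, ν₃, ν₄)`, with `q = (ν₁ν₄, ν₂ν₃)`. -/
def selbergTerm (X : ℝ) (z : ℂ) (ν₁ ν₂ ν₃ ν₄ : ℕ) : ℂ :=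
  let q : ℕ := Nat.gcd (ν₁ * ν₄) (ν₂ * ν₃)
  beta χ₁ χ₂ X ν₁ * beta χ₁ χ₂ X ν₂ * beta χ₁ χ₂ X ν₃ * beta χ₁ χ₂ X ν₄ / ((ν₂ : ℂ) * ν₄) *
    ((q : ℂ) / ((ν₁ : ℂ) * ν₃)) ^ (1 - z) *
    K χ₁ χ₂ (ν₁ * ν₄ / q) (1 - z) * K χ₁ χ₂ (ν₂ * ν₃ / q) (1 - z)

/-- The diagonal Selberg sum `S(z) = S_X(z)`, over all `1 ≤ ν₁, ν₂, ν₃, ν₄ ≤ X`. -/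
def S (X : ℝ) (z : ℂ) : ℂ :=
  ∑ ν₁ ∈ Finset.Icc 1 ⌊X⌋₊, ∑ ν₂ ∈ Finset.Icc 1 ⌊X⌋₊,
    ∑ ν₃ ∈ Finset.Icc 1 ⌊X⌋₊, ∑ ν₄ ∈ Finset.Icc 1 ⌊X⌋₊,
      selbergTerm χ₁ χ₂ X z ν₁ ν₂ ν₃ ν₄

end SelbergSum

end

/-! Put δ = 1/log X. Each weight ℒ(ν) is an integral of ν^(-w) over a vertical line against a kernel
of size X^(Re w)/(|w|² log X). Hence S_X(z) is a fourfold integral of these kernels against an Euler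
product in w₁, …, w₄ (`S_eq_integral`). No contour is moved: w₂, w₄ stay on Re w = δ and w₁, w₃ on
Re w = max(Re z, 0) + δ. The condition Re z ≥ -δ then keeps every argument met below in Re s ≥ 1 +
δ.

With r(p) = χ₁(p) + χ₂(p) and c(p) = r(p)²/2, the local factor at p is 1 + c(p)·(-Σ p^(-s) + ½ Σ
p^(-s')) + O(p^(-7/4)). Here s runs over 1-z+w₁, 1+w₂, 1-z+w₃, 1+w₄ and s' over 1+w₁+w₂, 1-z+w₁+w₃,
1+z+w₂+w₄, 1+w₃+w₄. Off D one has c(p) = 1 + χ(p) with χ = χ₁χ₂ nonprincipal, so Re Σ c(p)p^(-s) is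
log|ζ(s)L(s,χ)| up to a bounded error. The Euler product is therefore dominated by |ζL|^(-1) at the
four points s times |ζL|^(1/2) at the four points s' (`exists_norm_prod_localSum_le_factors`).

The analytic input is that |ζL| is comparable to 1/|s-1| up to powers of the height
(`exp_primeSum_bounds`). Its lower bound comes from the 3-4-1 inequality, available because c ≥ 0,
together with a bound for horizontal increments.

Power counting finishes the proof (`exists_norm_S_le`). The kernels contribute (log X)^(-4), and
each inverse factor cancels one of the two powers of |w| in the denominator. By AM-GM the square
roots become two products, each coupling the variables in disjoint pairs, and each pair integral is
O(1/δ) (`exists_lintegral_pairKernel_mul_le`), so (log X)² is lost. The factor X^(2|z|) comes from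
w₁ and w₃, through |w-z| ≤ 2X^(|z|-max(Re z,0))|w| on their line. -/

noncomputable section

/-! ### Partial summation and growth of Dirichlet series to the right of Re s = 1. -/

namespace SelbergSum
open Complex MeasureTheory

/-- Tail of an `L`-series by partial summation. -/
theorem norm_LSeries_indicator_sub_le {a : ℕ → ℂ} {κ : ℂ} {B : ℝ}
    (ha : ∀ n, ‖a n‖ ≤ 1) (N : ℕ) (hN : 1 ≤ N)
    (hB : ∀ t : ℝ, (N : ℝ) ≤ t → ‖∑ k ∈ Finset.Icc 1 ⌊t⌋₊, (if N < k then a k else 0) - κ * (t - N)‖ ≤ B)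
    {s : ℂ} (hs : 1 < s.re) :
    ‖LSeries (fun k => if N < k then a k else 0) s - κ * ((N : ℂ) ^ (1 - s) / (s - 1))‖
      ≤ B * ‖s‖ / N := by
  have hNpos : (0 : ℝ) < N := by exact_mod_cast hN
  set a' : ℕ → ℂ := fun k => if N < k then a k else 0 with ha'
  have ha'1 : ∀ n, ‖a' n‖ ≤ 1 := fun n => by
    simp only [ha']; split_ifs
    · exact ha n
    · simp
  have hO : (fun n ↦ ∑ k ∈ Finset.Icc 1 n, ‖a' k‖) =O[Filter.atTop] fun n ↦ (n : ℝ) ^ (1 : ℝ) := by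
    refine Asymptotics.isBigO_of_le _ fun n => ?_
    rw [Real.norm_of_nonneg (Finset.sum_nonneg fun _ _ => norm_nonneg _)]
    refine (Finset.sum_le_sum fun k _ => ha'1 k).trans ?_
    simp
  have h1 := LSeries_eq_mul_integral' a' zero_le_one hs hO
  set S : ℝ → ℂ := fun t => ∑ k ∈ Finset.Icc 1 ⌊t⌋₊, a' k with hS
  have hSmeas : Measurable S := by
    have : Measurable (fun n : ℕ => ∑ k ∈ Finset.Icc 1 n, a' k) := measurable_from_top
    exact this.comp Nat.measurable_floor
  have hS0 : ∀ t : ℝ, t ≤ N → S t = 0 := by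
    intro t ht
    refine Finset.sum_eq_zero fun k hk => ?_
    have : k ≤ N := (Finset.mem_Icc.mp hk).2.trans (Nat.floor_le_of_le ht)
    simp [ha', this]
  have hI1 : IntegrableOn (fun t : ℝ => (t : ℂ) ^ (-s)) (Set.Ioi N) :=
    integrableOn_Ioi_cpow_of_lt (by simpa using hs) hNpos
  have hI2 : IntegrableOn (fun t : ℝ => (t : ℂ) ^ (-(s + 1))) (Set.Ioi N) :=
    integrableOn_Ioi_cpow_of_lt (by simp; linarith) hNpos
  have hs1 : s - 1 ≠ 0 := by intro h; rw [sub_eq_zero.mp h] at hs; simp at hs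
  have hs0 : s ≠ 0 := by intro h; rw [h] at hs; simp at hs; linarith
  have hNc : (N : ℂ) ≠ 0 := by exact_mod_cast hNpos.ne'
  -- The linear main term of the partial sums integrates exactly to the pole term divided by s; only
  -- the deviation, bounded by B, has to be estimated.
  have hmain : ∫ t in Set.Ioi (N : ℝ), (κ * (t - N)) * (t : ℂ) ^ (-(s + 1)) =
      κ * ((N : ℂ) ^ (1 - s) / (s - 1)) / s := by
    have : ∀ t ∈ Set.Ioi (N : ℝ), (κ * (t - N)) * (t : ℂ) ^ (-(s + 1)) =
        κ * ((t : ℂ) ^ (-s) - N * (t : ℂ) ^ (-(s + 1))) := by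
      intro t ht
      have ht0 : (t : ℂ) ≠ 0 := by exact_mod_cast (hNpos.trans ht).ne'
      have : (t : ℂ) ^ (-s) = t * (t : ℂ) ^ (-(s + 1)) := by
        rw [show -s = 1 + -(s + 1) by ring, Complex.cpow_add _ _ ht0, Complex.cpow_one]
      rw [this]; ring
    rw [setIntegral_congr_fun measurableSet_Ioi this, integral_const_mul,
      integral_sub hI1 (hI2.const_mul _), integral_const_mul,
      integral_Ioi_cpow_of_lt (by simpa using hs) hNpos,
      integral_Ioi_cpow_of_lt (by simp; linarith) hNpos]
    have e1 : (N : ℂ) ^ (1 - s) = N * (N : ℂ) ^ (-s) := by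
      rw [show 1 - s = 1 + -s by ring, Complex.cpow_add _ _ hNc, Complex.cpow_one]
    rw [show -(s + 1) + 1 = -s by ring, show -s + 1 = 1 - s by ring]
    simp only [Complex.ofReal_natCast]
    rw [e1]
    have h3 : 1 - s ≠ 0 := by intro h; apply hs1; linear_combination -h
    field_simp
    ring
  have hEI : IntegrableOn (fun t : ℝ => (S t - κ * (t - N)) * (t : ℂ) ^ (-(s + 1))) (Set.Ioi N) := by
    refine Integrable.bdd_mul (c := B) hI2 ?_ ?_
    · exact (hSmeas.sub (by fun_prop)).aestronglyMeasurable
    · exact (ae_restrict_iff' measurableSet_Ioi).mpr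
        (Filter.Eventually.of_forall fun t ht => hB t (le_of_lt ht))
  have hMI : IntegrableOn (fun t : ℝ => (κ * (t - N)) * (t : ℂ) ^ (-(s + 1))) (Set.Ioi N) := by
    have : ∀ t ∈ Set.Ioi (N : ℝ), κ * ((t : ℂ) ^ (-s) - N * (t : ℂ) ^ (-(s + 1))) =
       (κ * (t - N)) * (t : ℂ) ^ (-(s + 1)) := by
      intro t ht
      have ht0 : (t : ℂ) ≠ 0 := by exact_mod_cast (hNpos.trans ht).ne'
      have : (t : ℂ) ^ (-s) = t * (t : ℂ) ^ (-(s + 1)) := by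
        rw [show -s = 1 + -(s + 1) by ring, Complex.cpow_add _ _ ht0, Complex.cpow_one]
      rw [this]; ring
    exact IntegrableOn.congr_fun ((hI1.sub (hI2.const_mul _)).const_mul _) this measurableSet_Ioi
  have h2 : ∫ t in Set.Ioi (1 : ℝ), S t * (t : ℂ) ^ (-(s + 1)) =
      ∫ t in Set.Ioi (N : ℝ), S t * (t : ℂ) ^ (-(s + 1)) := by
    refine setIntegral_eq_of_subset_of_forall_sdiff_eq_zero measurableSet_Ioi ?_ ?_
    · exact Set.Ioi_subset_Ioi (by exact_mod_cast hN)
    · intro t ht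
      rw [hS0 t (not_lt.mp ht.2), zero_mul]
  have h4 : ∫ t in Set.Ioi (N : ℝ), S t * (t : ℂ) ^ (-(s + 1)) =
      (∫ t in Set.Ioi (N : ℝ), (S t - κ * (t - N)) * (t : ℂ) ^ (-(s + 1))) +
        κ * ((N : ℂ) ^ (1 - s) / (s - 1)) / s := by
    rw [← hmain, ← integral_add hEI hMI]
    congr 1; ext t; ring
  rw [h1, h2, h4, mul_add, mul_div_cancel₀ _ hs0, add_sub_cancel_right, norm_mul]
  have hB0 : 0 ≤ B := (norm_nonneg _).trans (hB N le_rfl)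
  have h5 : ‖∫ t in Set.Ioi (N : ℝ), (S t - κ * (t - N)) * (t : ℂ) ^ (-(s + 1))‖ ≤ B / N := by
    have hg : IntegrableOn (fun t : ℝ => B * t ^ (-2 : ℝ)) (Set.Ioi N) :=
      (integrableOn_Ioi_rpow_of_lt (by norm_num) hNpos).const_mul _
    refine (norm_integral_le_of_norm_le hg ?_).trans ?_
    · refine (ae_restrict_iff' measurableSet_Ioi).mpr (Filter.Eventually.of_forall fun t ht => ?_)
      have ht0 : 0 < t := hNpos.trans ht
      rw [norm_mul, Complex.norm_cpow_eq_rpow_re_of_pos ht0]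
      refine mul_le_mul (hB t (le_of_lt ht)) ?_ (by positivity) hB0
      refine Real.rpow_le_rpow_of_exponent_le ?_ (by simp; linarith)
      exact le_trans (by exact_mod_cast hN) (le_of_lt ht)
    · rw [integral_const_mul, integral_Ioi_rpow_of_lt (by norm_num) hNpos]
      apply le_of_eq
      norm_num [Real.rpow_neg_one]
      field_simp
  calc _ ≤ ‖s‖ * (B / N) := by gcongr
    _ = _ := by ring

/-- A truncation of an `L`-series. -/
theorem LSeries_truncation {a : ℕ → ℂ} {κ : ℂ} {B : ℝ}
    (ha : ∀ n, ‖a n‖ ≤ 1) (N : ℕ) (hN : 1 ≤ N)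
    (hB : ∀ t : ℝ, (N : ℝ) ≤ t → ‖∑ k ∈ Finset.Icc 1 ⌊t⌋₊, (if N < k then a k else 0) - κ * (t - N)‖ ≤ B)
    {s : ℂ} (hs : 1 < s.re) :
    ‖LSeries a s - ∑ n ∈ Finset.Icc 1 N, a n * (n : ℂ) ^ (-s) - κ * ((N : ℂ) ^ (1 - s) / (s - 1))‖
      ≤ B * ‖s‖ / N := by
  have h := norm_LSeries_indicator_sub_le ha N hN hB hs
  have hsplit : LSeries a s = LSeries (fun k => if N < k then a k else 0) s +
      ∑ n ∈ Finset.Icc 1 N, a n * (n : ℂ) ^ (-s) := by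
    have hfin : LSeriesHasSum (fun k => if N < k then 0 else a k) s
        (∑ n ∈ Finset.Icc 1 N, a n * (n : ℂ) ^ (-s)) := by
      have hz : ∀ n ∉ Finset.Icc 1 N, LSeries.term (fun k => if N < k then 0 else a k) s n = 0 := by
        intro n hn
        rcases Nat.eq_zero_or_pos n with rfl | h0
        · simp
        · rw [LSeries.term_of_ne_zero h0.ne', if_pos, zero_div]
          by_contra h2
          exact hn (Finset.mem_Icc.mpr ⟨h0, by omega⟩)
      have hv : ∀ n ∈ Finset.Icc 1 N, LSeries.term (fun k => if N < k then 0 else a k) s n =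
          a n * (n : ℂ) ^ (-s) := by
        intro n hn
        obtain ⟨h1, h2⟩ := Finset.mem_Icc.mp hn
        rw [LSeries.term_of_ne_zero (by omega), if_neg (by omega), Complex.cpow_neg]
        rfl
      rw [← Finset.sum_congr rfl hv]
      exact hasSum_sum_of_ne_finset_zero hz
    have hs' : LSeriesSummable (fun k => if N < k then a k else 0) s :=
      LSeriesSummable_of_bounded_of_one_lt_re (m := 1) (fun n _ => by
        split_ifs
        · exact ha n
        · simp) hs
    rw [← hfin.LSeries_eq, ← LSeries_add hs' hfin.LSeriesSummable]
    congr 1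
    ext n
    simp only [Pi.add_apply]
    split_ifs <;> simp
  rw [hsplit]
  simpa using h

/-- The two points lie at the same height, so the quotient of the powers is the real number
n^(-(σ'-σ)), and 1 - e^(-x) ≤ x. -/
theorem norm_natCast_cpow_sub_le {n : ℕ} (hn : 1 ≤ n) {s s' : ℂ} (hs : 1 < s.re)
    (hss : s.re ≤ s'.re) (him : s.im = s'.im) :
    ‖(n : ℂ) ^ (-s) - (n : ℂ) ^ (-s')‖ ≤ (n : ℝ)⁻¹ * ((s'.re - s.re) * Real.log n) := by
  have hn0 : (n : ℂ) ≠ 0 := by exact_mod_cast (by omega : n ≠ 0)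
  have hnr : (0 : ℝ) < n := by exact_mod_cast hn
  have e : (n : ℂ) ^ (-s') = (n : ℂ) ^ (-s) * (((n : ℝ) ^ (-(s'.re - s.re)) : ℝ) : ℂ) := by
    rw [Complex.ofReal_cpow hnr.le]
    push_cast
    rw [← Complex.cpow_add _ _ hn0]
    congr 1
    refine Complex.ext (by simp; ring) (by simp [him])
  rw [e, ← mul_one_sub, norm_mul, Complex.norm_natCast_cpow_of_pos (by omega)]
  have hl : 0 ≤ Real.log n := Real.log_natCast_nonneg n
  have h1 : (n : ℝ) ^ (-s).re ≤ (n : ℝ)⁻¹ := by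
    rw [← Real.rpow_neg_one]
    exact Real.rpow_le_rpow_of_exponent_le (by exact_mod_cast hn) (by simp; linarith)
  have h2 : ‖(1 : ℂ) - (((n : ℝ) ^ (-(s'.re - s.re)) : ℝ) : ℂ)‖ ≤ (s'.re - s.re) * Real.log n := by
    rw [← Complex.ofReal_one, ← Complex.ofReal_sub, Complex.norm_real, Real.norm_eq_abs, abs_le,
      Real.rpow_def_of_pos hnr]
    have h3 := Real.add_one_le_exp (Real.log n * (-(s'.re - s.re)))
    have h4 : Real.exp (Real.log n * (-(s'.re - s.re))) ≤ 1 := by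
      rw [Real.exp_le_one_iff]; nlinarith
    constructor <;> nlinarith
  exact mul_le_mul h1 h2 (norm_nonneg _) (by positivity)

/-- Growth of an `L`-series, and of its horizontal increments, to the right of the line `Re s = 1`,
for coefficients with partial sums `κ x + O(1)`. -/
theorem LSeries_growth {a : ℕ → ℂ} {κ : ℂ} {B : ℝ} (hκ : ‖κ‖ ≤ 1)
    (ha : ∀ n, ‖a n‖ ≤ 1)
    (hB : ∀ N : ℕ, 1 ≤ N → ∀ t : ℝ, (N : ℝ) ≤ t →
      ‖∑ k ∈ Finset.Icc 1 ⌊t⌋₊, (if N < k then a k else 0) - κ * (t - N)‖ ≤ B) {ε : ℝ} (hε : 0 < ε) :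
    ∃ K : ℝ, 1 ≤ K ∧ (∀ s : ℂ, 1 < s.re → s.re ≤ 5 → 1 ≤ |s.im| → ‖LSeries a s‖ ≤ K * |s.im| ^ ε) ∧
      ∀ s s' : ℂ, 1 < s.re → s.re ≤ s'.re → s'.re ≤ 5 → s.im = s'.im → 1 ≤ |s.im| →
        ‖LSeries a s - LSeries a s'‖ ≤ K * ((s'.re - s.re) * |s.im| ^ (2 * ε) + |s.im|⁻¹) := by
  -- Truncation at N ≈ |Im s|² brings the remainder B|s|/N down to O(1/|Im s|), while 1 + log N ≤
  -- q|Im s|^ε because log t ≤ t^ε/ε.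
  set q : ℝ := 2 + 2 / ε with hq
  have hq2 : 2 ≤ q := by rw [hq]; have : 0 < 2 / ε := by positivity
                         linarith
  have hB0 : 0 ≤ B := (norm_nonneg _).trans (hB 1 le_rfl 1 (by simp))
  have hN : ∀ t : ℝ, 1 ≤ t → ∃ N : ℕ, 1 ≤ N ∧ t ^ 2 ≤ N ∧ 1 + Real.log N ≤ q * t ^ ε := by
    intro t ht
    refine ⟨⌈t ^ 2⌉₊, Nat.one_le_iff_ne_zero.mpr (by positivity), Nat.le_ceil _, ?_⟩
    have h1 : (⌈t ^ 2⌉₊ : ℝ) ≤ 2 * t ^ 2 := by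
      have := (Nat.ceil_lt_add_one (by positivity : (0 : ℝ) ≤ t ^ 2)).le
      nlinarith
    have h2 : Real.log (⌈t ^ 2⌉₊ : ℝ) ≤ Real.log 2 + 2 * Real.log t := by
      rw [← Real.log_rpow (by linarith), ← Real.log_mul (by norm_num) (by positivity)]
      refine Real.log_le_log (by positivity) (h1.trans (by norm_cast))
    have h3 : Real.log t ≤ t ^ ε / ε := Real.log_le_rpow_div (by linarith) hε
    have h4 : (1 : ℝ) ≤ t ^ ε := Real.one_le_rpow ht hε.le
    have h5 := Real.log_two_lt_d9
    have h6 : 2 * Real.log t ≤ 2 / ε * t ^ ε := by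
      calc 2 * Real.log t ≤ 2 * (t ^ ε / ε) := by linarith
        _ = _ := by ring
    rw [hq]; nlinarith
  have hsum1 : ∀ N : ℕ, ∑ n ∈ Finset.Icc 1 N, (n : ℝ)⁻¹ ≤ 1 + Real.log N := by
    intro N
    have := harmonic_le_one_add_log N
    rw [harmonic_eq_sum_Icc] at this
    simpa using this
  have hNs : ∀ (N : ℕ) (s : ℂ), s.re ≤ 5 → 1 < s.re → 1 ≤ |s.im| → |s.im| ^ 2 ≤ N →
      B * ‖s‖ / N ≤ 6 * B * |s.im|⁻¹ := by
    intro N s h5 h1 ht hN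
    have hn : ‖s‖ ≤ 6 * |s.im| := by
      refine (Complex.norm_le_abs_re_add_abs_im s).trans ?_
      rw [abs_of_pos (by linarith)]; linarith
    have ht0 : 0 < |s.im| := by linarith
    rw [div_le_iff₀ (lt_of_lt_of_le (by positivity) hN)]
    calc B * ‖s‖ ≤ B * (6 * |s.im|) := by gcongr
      _ = 6 * B * |s.im|⁻¹ * |s.im| ^ 2 := by field_simp
      _ ≤ _ := by gcongr
  have hpole : ∀ (N : ℕ) (s : ℂ), 1 ≤ N → 1 < s.re → 1 ≤ |s.im| →
      ‖κ * ((N : ℂ) ^ (1 - s) / (s - 1))‖ ≤ |s.im|⁻¹ := by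
    intro N s hN h1 ht
    have ht0 : 0 < |s.im| := by linarith
    rw [norm_mul, norm_div, Complex.norm_natCast_cpow_of_pos (by omega)]
    have h2 : (N : ℝ) ^ (1 - s).re ≤ 1 :=
      Real.rpow_le_one_of_one_le_of_nonpos (by exact_mod_cast hN) (by simp; linarith)
    have h3 : |s.im| ≤ ‖s - 1‖ := by simpa using Complex.abs_im_le_norm (s - 1)
    calc ‖κ‖ * ((N : ℝ) ^ (1 - s).re / ‖s - 1‖) ≤ 1 * (1 / |s.im|) := by gcongr
      _ = _ := by ring
  -- For increments q² covers the square of the logarithm, 2 the two pole terms and 12B the two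
  -- remainders.
  refine ⟨q ^ 2 + 2 + 12 * B, by nlinarith, ?_, ?_⟩
  · intro s h1 h5 ht
    obtain ⟨N, hN1, hN2, hN3⟩ := hN _ ht
    have hT := LSeries_truncation ha N hN1 (hB N hN1) h1
    have hx : (1 : ℝ) ≤ |s.im| ^ ε := Real.one_le_rpow ht hε.le
    have hinv : |s.im|⁻¹ ≤ 1 := inv_le_one_of_one_le₀ ht
    have hsm : ‖∑ n ∈ Finset.Icc 1 N, a n * (n : ℂ) ^ (-s)‖ ≤ q * |s.im| ^ ε := by
      refine (norm_sum_le _ _).trans (le_trans ?_ ((hsum1 N).trans hN3))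
      refine Finset.sum_le_sum fun n hn => ?_
      have hn1 := (Finset.mem_Icc.mp hn).1
      rw [norm_mul, Complex.norm_natCast_cpow_of_pos (by omega)]
      have h1 : (n : ℝ) ^ (-s).re ≤ (n : ℝ)⁻¹ := by
        rw [← Real.rpow_neg_one]
        exact Real.rpow_le_rpow_of_exponent_le (by exact_mod_cast hn1) (by simp; linarith)
      calc _ ≤ 1 * (n : ℝ)⁻¹ := mul_le_mul (ha n) h1 (by positivity) zero_le_one
        _ = _ := one_mul _
    have h6 := hNs N s h5 h1 ht hN2
    have h7 := hpole N s hN1 h1 ht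
    have h8 : ‖LSeries a s‖ ≤ ‖LSeries a s - ∑ n ∈ Finset.Icc 1 N, a n * (n : ℂ) ^ (-s) -
        κ * ((N : ℂ) ^ (1 - s) / (s - 1))‖ + ‖∑ n ∈ Finset.Icc 1 N, a n * (n : ℂ) ^ (-s)‖ +
        ‖κ * ((N : ℂ) ^ (1 - s) / (s - 1))‖ := by
      refine le_trans (le_of_eq ?_) (norm_add₃_le)
      congr 1; ring
    have h9 : 6 * B * |s.im|⁻¹ ≤ 6 * B * |s.im| ^ ε := by gcongr; linarith
    have h10 : (q + 1 + 6 * B) * |s.im| ^ ε ≤ (q ^ 2 + 2 + 12 * B) * |s.im| ^ ε :=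
      mul_le_mul_of_nonneg_right (by nlinarith) (by linarith)
    linarith
  · intro s s' h1 hss h5 him ht
    obtain ⟨N, hN1, hN2, hN3⟩ := hN _ ht
    have hT := LSeries_truncation ha N hN1 (hB N hN1) h1
    have hT' := LSeries_truncation ha N hN1 (hB N hN1) (s := s') (by linarith)
    -- One factor log N comes from the difference of the powers and one from the harmonic sum, hence
    -- the exponent 2ε.
    have hsm : ‖∑ n ∈ Finset.Icc 1 N, a n * (n : ℂ) ^ (-s) -
        ∑ n ∈ Finset.Icc 1 N, a n * (n : ℂ) ^ (-s')‖ ≤ (s'.re - s.re) * (q ^ 2 * |s.im| ^ (2 * ε)) := by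
      rw [← Finset.sum_sub_distrib]
      have hN0 : 0 ≤ Real.log N := Real.log_natCast_nonneg N
      have h0 : ‖∑ n ∈ Finset.Icc 1 N, (a n * (n : ℂ) ^ (-s) - a n * (n : ℂ) ^ (-s'))‖ ≤
          ∑ n ∈ Finset.Icc 1 N, (n : ℝ)⁻¹ * ((s'.re - s.re) * Real.log N) := by
        refine (norm_sum_le _ _).trans (Finset.sum_le_sum fun n hn => ?_)
        obtain ⟨hn1, hn2⟩ := Finset.mem_Icc.mp hn
        have hn0 : (0 : ℝ) < n := by exact_mod_cast hn1
        rw [← mul_sub, norm_mul]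
        calc _ ≤ 1 * ((n : ℝ)⁻¹ * ((s'.re - s.re) * Real.log n)) :=
              mul_le_mul (ha n) (norm_natCast_cpow_sub_le hn1 h1 hss him) (norm_nonneg _) zero_le_one
          _ ≤ _ := by
              rw [one_mul]
              have : Real.log n ≤ Real.log N := Real.log_le_log hn0 (by exact_mod_cast hn2)
              have : 0 ≤ s'.re - s.re := by linarith
              gcongr
      refine h0.trans ?_
      rw [← Finset.sum_mul]
      have h6 : (∑ n ∈ Finset.Icc 1 N, (n : ℝ)⁻¹) * Real.log N ≤ (q * |s.im| ^ ε) ^ 2 := by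
        rw [sq]
        exact mul_le_mul ((hsum1 N).trans hN3) (by linarith) hN0 (by positivity)
      have h7 : (q * |s.im| ^ ε) ^ 2 = q ^ 2 * |s.im| ^ (2 * ε) := by
        rw [mul_pow, mul_comm 2 ε, Real.rpow_mul (by positivity)]; norm_cast
      calc _ = (s'.re - s.re) * ((∑ n ∈ Finset.Icc 1 N, (n : ℝ)⁻¹) * Real.log N) := by ring
        _ ≤ _ := by
          rw [← h7]; exact mul_le_mul_of_nonneg_left h6 (by linarith)
    have ht' : 1 ≤ |s'.im| := him ▸ ht
    have h6 := hNs N s (by linarith) h1 ht hN2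
    have h6' := hNs N s' h5 (by linarith) ht' (him ▸ hN2)
    have h7 := hpole N s hN1 h1 ht
    have h7' := hpole N s' hN1 (by linarith) ht'
    rw [← him] at h6' h7'
    set P := ∑ n ∈ Finset.Icc 1 N, a n * (n : ℂ) ^ (-s)
    set P' := ∑ n ∈ Finset.Icc 1 N, a n * (n : ℂ) ^ (-s')
    set Q := κ * ((N : ℂ) ^ (1 - s) / (s - 1))
    set Q' := κ * ((N : ℂ) ^ (1 - s') / (s' - 1))
    have h8 : ‖LSeries a s - LSeries a s'‖ ≤ ‖LSeries a s - P - Q‖ + ‖LSeries a s' - P' - Q'‖ +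
        ‖P - P'‖ + ‖Q‖ + ‖Q'‖ := by
      have e : LSeries a s - LSeries a s' = (LSeries a s - P - Q) - (LSeries a s' - P' - Q') +
        (P - P') + Q - Q' := by ring
      rw [e]
      refine (norm_sub_le _ _).trans (add_le_add_left ?_ _)
      refine (norm_add_le _ _).trans (add_le_add_left ?_ _)
      refine (norm_add_le _ _).trans (add_le_add_left ?_ _)
      exact norm_sub_le _ _
    have hy : 0 ≤ (s'.re - s.re) * |s.im| ^ (2 * ε) := mul_nonneg (by linarith) (by positivity)
    have hi : 0 ≤ |s.im|⁻¹ := by positivity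
    nlinarith [mul_nonneg hB0 hy, mul_nonneg (sq_nonneg q) hi]

end SelbergSum

end

noncomputable section

/-! ### Character sums, the prime sum compared with log|ζL|, and the 3-4-1 inequality. -/

namespace SelbergSum
open Complex MeasureTheory

/-- A full period sums to zero by orthogonality, so only the incomplete last period survives. -/
theorem norm_sum_range_dirichletCharacter_le {D : ℕ} [NeZero D] {χ : DirichletCharacter ℂ D}
    (hχ : χ ≠ 1) (m : ℕ) : ‖∑ k ∈ Finset.range m, χ k‖ ≤ D := by
  have hD : ∑ k ∈ Finset.range D, χ k = 0 := by
    rw [← MulChar.sum_eq_zero_of_ne_one hχ]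
    refine Finset.sum_bij' (fun k _ => (k : ZMod D)) (fun a _ => a.val) ?_ ?_ ?_ ?_ ?_
    · simp
    · intro a _; simpa using ZMod.val_lt a
    · intro a ha; exact ZMod.val_cast_of_lt (Finset.mem_range.mp ha)
    · intro a _; simp
    · intro a _; rfl
  have hper : ∀ q r : ℕ, ∑ k ∈ Finset.range (D * q + r), χ k = ∑ k ∈ Finset.range r, χ k := by
    intro q r
    induction q with
    | zero => simp
    | succ q ih =>
      rw [show D * (q + 1) + r = D + (D * q + r) by ring, Finset.sum_range_add, hD, zero_add, ← ih]
      simp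
  rw [← Nat.div_add_mod m D, hper]
  refine (norm_sum_le _ _).trans ?_
  refine (Finset.sum_le_sum fun (k : ℕ) _ => χ.norm_le_one (k : ZMod D)).trans ?_
  simpa using (Nat.mod_lt m (NeZero.pos D)).le

/-- Written with κ = 0 to match the hypothesis of `LSeries_growth`; `norm_tail_sum_one_le` plays the
same role for ζ, with κ = 1. -/
theorem norm_tail_sum_dirichletCharacter_le {D : ℕ} [NeZero D] {χ : DirichletCharacter ℂ D}
    (hχ : χ ≠ 1) (N : ℕ) (t : ℝ) (ht : (N : ℝ) ≤ t) :
    ‖∑ k ∈ Finset.Icc 1 ⌊t⌋₊, (if N < k then χ k else 0) - 0 * ((t : ℂ) - N)‖ ≤ 2 * D := by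
  have hN : N ≤ ⌊t⌋₊ := Nat.le_floor ht
  have e : ∑ k ∈ Finset.Icc 1 ⌊t⌋₊, (if N < k then χ k else 0) =
      ∑ k ∈ Finset.range (⌊t⌋₊ + 1), χ k - ∑ k ∈ Finset.range (N + 1), χ k := by
    rw [← Finset.sum_Ico_eq_sub _ (by omega), ← Finset.sum_filter]
    refine Finset.sum_congr ?_ fun _ _ => rfl
    ext k; simp only [Finset.mem_filter, Finset.mem_Icc, Finset.mem_Ico]; omega
  rw [zero_mul, sub_zero, e]
  refine (norm_sub_le _ _).trans ?_
  have := norm_sum_range_dirichletCharacter_le hχ (⌊t⌋₊ + 1)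
  have := norm_sum_range_dirichletCharacter_le hχ (N + 1)
  linarith

theorem norm_tail_sum_one_le (N : ℕ) (t : ℝ) (ht : (N : ℝ) ≤ t) :
    ‖∑ k ∈ Finset.Icc 1 ⌊t⌋₊, (if N < k then (1 : ℂ) else 0) - 1 * ((t : ℂ) - N)‖ ≤ 1 := by
  have hN : N ≤ ⌊t⌋₊ := Nat.le_floor ht
  have e : ∑ k ∈ Finset.Icc 1 ⌊t⌋₊, (if N < k then (1 : ℂ) else 0) = (⌊t⌋₊ : ℂ) - N := by
    rw [← Finset.sum_filter, Finset.sum_const]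
    have : (Finset.Icc 1 ⌊t⌋₊).filter (fun k => N < k) = Finset.Ioc N ⌊t⌋₊ := by
      ext k; simp only [Finset.mem_filter, Finset.mem_Icc, Finset.mem_Ioc]; omega
    rw [this, Nat.card_Ioc]
    simp [Nat.cast_sub hN]
  rw [e]
  have : ((⌊t⌋₊ : ℂ) - N - 1 * ((t : ℂ) - N)) = (((⌊t⌋₊ : ℝ) - t : ℝ) : ℂ) := by push_cast; ring
  rw [this, Complex.norm_real, Real.norm_eq_abs, abs_le]
  have h0 : 0 ≤ t := (Nat.cast_nonneg N).trans ht
  have h1 := Nat.floor_le h0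
  have h2 := Nat.lt_floor_add_one t
  constructor <;> linarith

/-- The prime Dirichlet series `∑_p c(p) p^{-s}`. -/
def primeSum (c : ℕ → ℝ) (s : ℂ) : ℂ := ∑' p : Nat.Primes, (c p : ℂ) * (p : ℂ) ^ (-s)

theorem norm_primes_cpow (p : Nat.Primes) (s : ℂ) : ‖(p : ℂ) ^ (-s)‖ = (p : ℝ) ^ (-s.re) := by
  rw [Complex.norm_natCast_cpow_of_pos p.prop.pos]; simp

theorem summable_primes_rpow {x : ℝ} (hx : 1 < x) :
    Summable fun p : Nat.Primes => (p : ℝ) ^ (-x) := by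
  exact (Real.summable_nat_rpow.mpr (by linarith)).comp_injective Nat.Primes.coe_nat_injective

theorem summable_primeSum {c : ℕ → ℝ} (h0 : ∀ p, 0 ≤ c p) (h2 : ∀ p, c p ≤ 2) {s : ℂ}
    (hs : 1 < s.re) : Summable fun p : Nat.Primes => (c p : ℂ) * (p : ℂ) ^ (-s) := by
  refine Summable.of_norm_bounded ((summable_primes_rpow hs).mul_left 2) fun p => ?_
  rw [norm_mul, norm_primes_cpow, Complex.norm_real, Real.norm_of_nonneg (h0 _)]
  gcongr
  exact h2 _

theorem norm_neg_log_one_sub_sub_le {z : ℂ} (hz : ‖z‖ ≤ 1 / 2) :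
    ‖-Complex.log (1 - z) - z‖ ≤ ‖z‖ ^ 2 := by
  have h1 := Complex.norm_log_one_add_sub_self_le (z := -z) (by simp; linarith)
  rw [norm_neg] at h1
  have h2 : ‖-Complex.log (1 - z) - z‖ = ‖Complex.log (1 + -z) - -z‖ := by
    rw [← norm_neg]; congr 1; ring_nf
  rw [h2]
  refine h1.trans ?_
  have h3 : (1 - ‖z‖)⁻¹ ≤ 2 := by
    rw [inv_le_comm₀ (by linarith) (by norm_num)]; linarith
  nlinarith [sq_nonneg ‖z‖]

/-- Comparison of `∑_p (1 + χ(p)) p^{-s}` with `log |ζ(s) L(s, χ)|`. -/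
theorem abs_re_primeSum_sub_log_le {D : ℕ} [NeZero D] (χ : DirichletCharacter ℂ D) {c : ℕ → ℝ}
    (h0 : ∀ p, 0 ≤ c p) (h2 : ∀ p, c p ≤ 2)
    (hc : ∀ p : ℕ, p.Prime → ¬ p ∣ D → (c p : ℂ) = 1 + χ p) :
    ∃ K : ℝ, 0 ≤ K ∧ ∀ s : ℂ, 1 < s.re → ∃ e : ℝ, |e| ≤ K ∧
      Real.exp (primeSum c s).re =
        Real.exp e * (‖LSeries (fun _ => 1) s‖ * ‖LSeries (fun n => χ n) s‖) := by
  -- The error at p: 2p^(-2) from the quadratic tails of the two logarithms, and 4 at the finitely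
  -- many p dividing D, where c(p) is not tied to 1 + χ(p).
  set b : Nat.Primes → ℝ := fun p => 2 * (p : ℝ) ^ (-2 : ℝ) + (if (p : ℕ) ∣ D then 4 else 0) with hb
  have hbs : Summable b := by
    refine ((summable_primes_rpow (by norm_num : (1 : ℝ) < 2)).mul_left 2).add ?_
    refine summable_of_hasFiniteSupport ?_
    refine Set.Finite.subset (s := ((fun p : Nat.Primes => (p : ℕ)) ⁻¹' (D.divisors : Set ℕ))) ?_ ?_
    · exact Set.Finite.preimage Nat.Primes.coe_nat_injective.injOn (Finset.finite_toSet _)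
    · intro p hp
      simp only [Function.mem_support, ne_eq, ite_eq_right_iff, OfNat.ofNat_ne_zero, imp_false,
        not_not] at hp
      simp [hp, NeZero.ne D]
  have hb0 : ∀ p, 0 ≤ b p := fun p => by simp only [hb]; positivity
  refine ⟨∑' p, b p, tsum_nonneg hb0, fun s hs => ?_⟩
  set u : Nat.Primes → ℂ := fun p => -Complex.log (1 - (p : ℂ) ^ (-s)) with hu
  set v : Nat.Primes → ℂ := fun p => -Complex.log (1 - χ p * (p : ℂ) ^ (-s)) with hv
  have hX : ∀ p : Nat.Primes, ‖(p : ℂ) ^ (-s)‖ ≤ (p : ℝ)⁻¹ := fun p => by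
    rw [norm_primes_cpow, ← Real.rpow_neg_one]
    exact Real.rpow_le_rpow_of_exponent_le (by exact_mod_cast p.prop.one_le) (by linarith)
  have hinv : ∀ p : Nat.Primes, (p : ℝ)⁻¹ ≤ 1 / 2 := fun p => by
    rw [one_div]
    exact inv_anti₀ (by norm_num) (by exact_mod_cast p.prop.two_le)
  have hY : ∀ p : Nat.Primes, ‖χ p * (p : ℂ) ^ (-s)‖ ≤ (p : ℝ)⁻¹ := fun p => by
    rw [norm_mul]
    calc _ ≤ 1 * (p : ℝ)⁻¹ := mul_le_mul (χ.norm_le_one _) (hX p) (norm_nonneg _) zero_le_one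
      _ = _ := one_mul _
  have hsq : ∀ p : Nat.Primes, ((p : ℝ)⁻¹) ^ 2 = (p : ℝ) ^ (-2 : ℝ) := fun p => by
    rw [Real.rpow_neg (by positivity), inv_pow]; norm_cast
  have hdiff : ∀ p : Nat.Primes, ‖(c p : ℂ) * (p : ℂ) ^ (-s) - (u p + v p)‖ ≤ b p := by
    intro p
    have e : (c p : ℂ) * (p : ℂ) ^ (-s) - (u p + v p) =
        ((c p : ℂ) - (1 + χ p)) * (p : ℂ) ^ (-s) - (u p - (p : ℂ) ^ (-s)) -
          (v p - χ p * (p : ℂ) ^ (-s)) := by ring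
    have h3 : ‖u p - (p : ℂ) ^ (-s)‖ ≤ (p : ℝ) ^ (-2 : ℝ) := by
      rw [← hsq]
      refine (norm_neg_log_one_sub_sub_le ((hX p).trans (hinv p))).trans ?_
      gcongr; exact hX p
    have h4 : ‖v p - χ p * (p : ℂ) ^ (-s)‖ ≤ (p : ℝ) ^ (-2 : ℝ) := by
      rw [← hsq]
      refine (norm_neg_log_one_sub_sub_le ((hY p).trans (hinv p))).trans ?_
      gcongr; exact hY p
    have h5 : ‖((c p : ℂ) - (1 + χ p)) * (p : ℂ) ^ (-s)‖ ≤ if (p : ℕ) ∣ D then 4 else 0 := by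
      split_ifs with h
      · rw [norm_mul]
        have h6 : ‖(c p : ℂ) - (1 + χ p)‖ ≤ 4 := by
          refine (norm_sub_le _ _).trans ?_
          have := norm_add_le (1 : ℂ) (χ p)
          have := χ.norm_le_one p
          have : ‖(c p : ℂ)‖ ≤ 2 := by
            rw [Complex.norm_real, Real.norm_of_nonneg (h0 _)]; exact h2 _
          have : ‖(1 : ℂ)‖ = 1 := norm_one
          linarith
        calc _ ≤ 4 * (1 : ℝ) := mul_le_mul h6 ((hX p).trans ((hinv p).trans (by norm_num)))
              (norm_nonneg _) (by norm_num)
          _ = 4 := by norm_num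
      · rw [hc p p.prop h]; simp
    rw [e]
    refine (norm_sub_le _ _).trans ((add_le_add_left (norm_sub_le _ _) _).trans ?_)
    simp only [hb]; linarith
  have hds : Summable fun p : Nat.Primes => (c p : ℂ) * (p : ℂ) ^ (-s) - (u p + v p) :=
    Summable.of_norm_bounded hbs hdiff
  have hcs := summable_primeSum h0 h2 hs
  have hvs : Summable v := DirichletCharacter.summable_neg_log_one_sub_mul_prime_cpow χ hs
  have hus : Summable u := by
    have := DirichletCharacter.summable_neg_log_one_sub_mul_prime_cpow (1 : DirichletCharacter ℂ 1) hs
    refine this.congr fun p => ?_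
    rw [MulChar.one_apply (isUnit_of_subsingleton _), one_mul]
  refine ⟨(∑' p : Nat.Primes, ((c p : ℂ) * (p : ℂ) ^ (-s) - (u p + v p))).re, ?_, ?_⟩
  · exact (Complex.abs_re_le_norm _).trans
      ((norm_tsum_le_tsum_norm hds.norm).trans (hds.norm.tsum_le_tsum hdiff hbs))
  · have e1 : LSeries (fun n => χ n) s = Complex.exp (∑' p, v p) :=
      (DirichletCharacter.LSeries_eulerProduct_exp_log χ hs).symm
    have e2 : LSeries (fun _ => 1) s = Complex.exp (∑' p, u p) := by
      have := LSeries_one_eq_riemannZeta hs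
      rw [← riemannZeta_eulerProduct_exp_log hs] at this
      exact this
    rw [e1, e2, Complex.norm_exp, Complex.norm_exp, ← Real.exp_add, ← Real.exp_add]
    congr 1
    rw [hcs.tsum_sub (hus.add hvs), hus.tsum_add hvs, primeSum]
    simp only [Complex.sub_re, Complex.add_re]
    ring

/-- The `3-4-1` inequality for nonnegative coefficients. -/
theorem re_primeSum_three_four_one {c : ℕ → ℝ} (h0 : ∀ p, 0 ≤ c p) (h2 : ∀ p, c p ≤ 2) {x : ℝ}
    (hx : 1 < x) (t : ℝ) :
    0 ≤ 3 * (primeSum c x).re + 4 * (primeSum c (x + t * I)).re +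
      (primeSum c (x + (2 * t : ℝ) * I)).re := by
  have s1 := summable_primeSum h0 h2 (s := x) (by simpa)
  have s2 := summable_primeSum h0 h2 (s := x + t * I) (by simpa)
  have s3 := summable_primeSum h0 h2 (s := x + (2 * t : ℝ) * I) (by simpa)
  have r1 := (Complex.hasSum_re s1.hasSum).mul_left 3
  have r2 := (Complex.hasSum_re s2.hasSum).mul_left 4
  have r3 := Complex.hasSum_re s3.hasSum
  refine ((r1.add r2).add r3).nonneg fun p => ?_
  have hp0 : (p : ℂ) ≠ 0 := by exact_mod_cast p.prop.ne_zero
  have e1 : (p : ℂ) ^ (-(x : ℂ)) = (((p : ℝ) ^ (-x) : ℝ) : ℂ) := by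
    rw [Complex.ofReal_cpow (by positivity)]; simp
  set w : ℂ := (p : ℂ) ^ (-(t * I)) with hw
  have e2 : (p : ℂ) ^ (-(x + t * I)) = (((p : ℝ) ^ (-x) : ℝ) : ℂ) * w := by
    rw [← e1, hw, ← Complex.cpow_add _ _ hp0]; congr 1; ring
  have e3 : (p : ℂ) ^ (-(x + (2 * t : ℝ) * I)) = (((p : ℝ) ^ (-x) : ℝ) : ℂ) * (w * w) := by
    rw [← e1, hw, ← Complex.cpow_add _ _ hp0, ← Complex.cpow_add _ _ hp0]; congr 1; push_cast; ring
  have hn : ‖w‖ = 1 := by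
    rw [hw, Complex.norm_natCast_cpow_of_pos p.prop.pos]; simp
  have hn2 : w.re * w.re + w.im * w.im = 1 := by
    have := Complex.sq_norm w
    rw [hn, Complex.normSq_apply] at this; linarith
  have hy : 0 ≤ (p : ℝ) ^ (-x) := by positivity
  rw [e1, e2, e3]
  simp only [Complex.ofReal_re, Complex.ofReal_im, Complex.mul_re, Complex.mul_im]
  -- This is 3 + 4 cos θ + cos 2θ = 2(1 + cos θ)², with w = p^(-it) on the unit circle.
  have hk : 3 + 4 * w.re + (w.re * w.re - w.im * w.im) = 2 * (1 + w.re) ^ 2 := by nlinarith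
  calc (0 : ℝ) ≤ c p * (p : ℝ) ^ (-x) * (2 * (1 + w.re) ^ 2) :=
        mul_nonneg (mul_nonneg (h0 _) hy) (by positivity)
    _ = _ := by rw [← hk]; ring

end SelbergSum

end

noncomputable section

/-! ### Upper and lower bounds for ζ(s)L(s, χ) in Re s > 1. -/

namespace SelbergSum
open Complex MeasureTheory

/-- `|ζ(s) L(s, χ)|` for `Re s > 1`. -/
def zetaL {D : ℕ} (χ : DirichletCharacter ℂ D) (s : ℂ) : ℂ :=
  LSeries (fun _ => 1) s * LSeries (fun n => χ n) s

/-- The function (s-1)ζ(s)L(s,χ) is continuous and has no zeros on Re s ≥ 1, so on a compact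
rectangle it is bounded and bounded away from zero. -/
theorem zetaL_bounded_height {D : ℕ} [NeZero D] {χ : DirichletCharacter ℂ D} (hχ : χ ≠ 1) (T : ℝ) :
    ∃ K : ℝ, 0 < K ∧ ∀ s : ℂ, 1 < s.re → s.re ≤ 5 → |s.im| ≤ T →
      ‖zetaL χ s‖ ≤ K / ‖s - 1‖ ∧ ‖s - 1‖⁻¹ ≤ K * ‖zetaL χ s‖ := by
  set g : ℂ → ℂ := fun s => DirichletCharacter.LFunctionTrivChar₁ 1 s * DirichletCharacter.LFunction χ s
    with hg
  have hgc : Continuous g :=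
    (DirichletCharacter.differentiable_LFunctionTrivChar₁ 1).continuous.mul
      (DirichletCharacter.differentiable_LFunction hχ).continuous
  have hcomp : IsCompact (Set.Icc (1 : ℝ) 5 ×ℂ Set.Icc (-T) T) := isCompact_Icc.reProdIm isCompact_Icc
  have hg0 : ∀ s ∈ Set.Icc (1 : ℝ) 5 ×ℂ Set.Icc (-T) T, g s ≠ 0 := by
    intro s hs
    have hs1 : 1 ≤ s.re := (Complex.mem_reProdIm.mp hs).1.1
    refine mul_ne_zero ?_ (DirichletCharacter.LFunction_ne_zero_of_one_le_re χ (.inl hχ) hs1)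
    rcases eq_or_ne s 1 with rfl | h
    · exact DirichletCharacter.LFunctionTrivChar₁_apply_one_ne_zero 1
    · rw [DirichletCharacter.LFunctionTrivChar₁, Function.update_of_ne h]
      exact mul_ne_zero (sub_ne_zero.mpr h)
        (DirichletCharacter.LFunction_ne_zero_of_one_le_re _ (.inr h) hs1)
  obtain ⟨K₁, hK₁⟩ := hcomp.exists_bound_of_continuousOn hgc.continuousOn
  obtain ⟨K₂, hK₂⟩ := hcomp.exists_bound_of_continuousOn (f := fun s => (g s)⁻¹)
    (hgc.continuousOn.inv₀ hg0)
  refine ⟨max 1 (max K₁ K₂), by positivity, fun s h1 h5 ht => ?_⟩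
  have hmem : s ∈ Set.Icc (1 : ℝ) 5 ×ℂ Set.Icc (-T) T :=
    Complex.mem_reProdIm.mpr ⟨⟨h1.le, h5⟩, abs_le.mp ht⟩
  have hs1 : s ≠ 1 := by rintro rfl; simp at h1
  have hs1' : 0 < ‖s - 1‖ := norm_pos_iff.mpr (sub_ne_zero.mpr hs1)
  have e : g s = (s - 1) * zetaL χ s := by
    simp only [hg, DirichletCharacter.LFunctionTrivChar₁, Function.update_of_ne hs1]
    rw [DirichletCharacter.LFunctionTrivChar, DirichletCharacter.LFunction_eq_LSeries _ h1,
      DirichletCharacter.LFunction_eq_LSeries _ h1, zetaL, mul_assoc]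
    congr 3
    ext n
    exact MulChar.one_apply (isUnit_of_subsingleton _)
  have hk1 := hK₁ s hmem
  have hk2 := hK₂ s hmem
  rw [e, norm_mul] at hk1
  have hz : 0 < ‖zetaL χ s‖ := by
    have := hg0 s hmem
    rw [e] at this
    exact norm_pos_iff.mpr (right_ne_zero_of_mul this)
  rw [e, norm_inv, norm_mul, mul_inv] at hk2
  constructor
  · rw [le_div_iff₀ hs1', mul_comm]
    exact hk1.trans (by simp)
  · rw [← div_eq_mul_inv, div_le_iff₀ hz] at hk2
    exact hk2.trans (by gcongr; simp)

/-- Upper bound and increments of `ζ(s) L(s, χ)` away from the real axis. -/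
theorem zetaL_growth {D : ℕ} [NeZero D] {χ : DirichletCharacter ℂ D} (hχ : χ ≠ 1) {ε : ℝ}
    (hε : 0 < ε) :
    ∃ K : ℝ, 1 ≤ K ∧ (∀ s : ℂ, 1 < s.re → s.re ≤ 5 → 1 ≤ |s.im| →
        ‖zetaL χ s‖ ≤ K * |s.im| ^ (2 * ε)) ∧
      ∀ s s' : ℂ, 1 < s.re → s.re ≤ s'.re → s'.re ≤ 5 → s.im = s'.im → 1 ≤ |s.im| →
        ‖zetaL χ s - zetaL χ s'‖ ≤
          K * ((s'.re - s.re) * |s.im| ^ (3 * ε) + |s.im| ^ (ε - 1)) := by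
  obtain ⟨K₁, hK₁, hu₁, hd₁⟩ := LSeries_growth (a := fun _ => 1) (κ := 1) (by simp) (by simp)
    (fun N _ t ht => norm_tail_sum_one_le N t ht) hε
  obtain ⟨K₂, hK₂, hu₂, hd₂⟩ := LSeries_growth (a := fun n => χ n) (κ := 0) (by simp)
    (fun n => χ.norm_le_one n)
    (fun N _ t ht => norm_tail_sum_dirichletCharacter_le hχ N t ht) hε
  refine ⟨2 * (K₁ * K₂), by nlinarith, fun s h1 h5 ht => ?_, fun s s' h1 hss h5 him ht => ?_⟩
  · have ht0 : 0 < |s.im| := by linarith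
    rw [zetaL, norm_mul]
    have := mul_le_mul (hu₁ s h1 h5 ht) (hu₂ s h1 h5 ht) (norm_nonneg _) (by positivity)
    refine this.trans ?_
    rw [two_mul ε, Real.rpow_add ht0]
    have : 0 ≤ K₁ * K₂ * (|s.im| ^ ε * |s.im| ^ ε) := by positivity
    nlinarith
  · have ht0 : 0 < |s.im| := by linarith
    have e : zetaL χ s - zetaL χ s' =
        LSeries (fun _ => 1) s * (LSeries (fun n => χ n) s - LSeries (fun n => χ n) s') +
        (LSeries (fun _ => 1) s - LSeries (fun _ => 1) s') * LSeries (fun n => χ n) s' := by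
      rw [zetaL, zetaL]; ring
    have a1 := hu₁ s h1 (by linarith) ht
    have a2 := hu₂ s' (by linarith) h5 (him ▸ ht)
    rw [← him] at a2
    have b1 := hd₁ s s' h1 hss h5 him ht
    have b2 := hd₂ s s' h1 hss h5 him ht
    have x1 : |s.im| ^ (3 * ε) = |s.im| ^ ε * |s.im| ^ (2 * ε) := by
      rw [← Real.rpow_add ht0]; congr 1; ring
    have x2 : |s.im| ^ (ε - 1) = |s.im| ^ ε * |s.im|⁻¹ := by
      rw [Real.rpow_sub_one ht0.ne', div_eq_mul_inv]
    rw [e]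
    refine (norm_add_le _ _).trans ?_
    rw [norm_mul, norm_mul]
    have hh : 0 ≤ s'.re - s.re := by linarith
    have c1 := mul_le_mul a1 b2 (norm_nonneg _) (by positivity)
    have c2 := mul_le_mul b1 a2 (norm_nonneg _) (by positivity)
    rw [x1, x2]
    refine (add_le_add c1 c2).trans (le_of_eq ?_)
    ring

/-- Since c ≥ 0, the 3-4-1 inequality applies to ζL as a whole: |ζL(σ)|³|ζL(σ+it)|⁴|ζL(σ+2it)| ≫ 1.
The simple pole bounds the first factor by a multiple of (σ-1)^(-3), and `zetaL_growth` bounds the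
last. -/
theorem zetaL_lower_three_four_one {D : ℕ} [NeZero D] {χ : DirichletCharacter ℂ D} (hχ : χ ≠ 1)
    {c : ℕ → ℝ} (h0 : ∀ p, 0 ≤ c p) (h2 : ∀ p, c p ≤ 2)
    (hc : ∀ p : ℕ, p.Prime → ¬ p ∣ D → (c p : ℂ) = 1 + χ p) {ε : ℝ} (hε : 0 < ε) :
    ∃ k : ℝ, 0 < k ∧ ∀ s : ℂ, 1 < s.re → s.re ≤ 5 → 1 ≤ |s.im| →
      k * ((s.re - 1) ^ (3 / 4 : ℝ) * |s.im| ^ (-(ε / 2))) ≤ ‖zetaL χ s‖ := by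
  obtain ⟨E, hE, hP⟩ := abs_re_primeSum_sub_log_le χ h0 h2 hc
  -- Height zero is enough, because this bound is applied only at the real point Re s.
  obtain ⟨K₀, hK₀, hb⟩ := zetaL_bounded_height hχ 0
  obtain ⟨K₁, hK₁, hu, -⟩ := zetaL_growth hχ hε
  have hP' : ∀ s : ℂ, 1 < s.re → 0 < ‖zetaL χ s‖ ∧
      |(primeSum c s).re - Real.log ‖zetaL χ s‖| ≤ E := by
    intro s hs
    obtain ⟨e, he, h⟩ := hP s hs
    have hz : 0 < ‖zetaL χ s‖ := by
      have := Real.exp_pos (primeSum c s).re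
      rw [h, ← norm_mul] at this
      exact pos_of_mul_pos_right this (Real.exp_pos e).le
    refine ⟨hz, ?_⟩
    have : (primeSum c s).re = e + Real.log ‖zetaL χ s‖ := by
      rw [← Real.log_exp (primeSum c s).re, h, ← norm_mul]
      change Real.log (Real.exp e * ‖zetaL χ s‖) = _
      rw [Real.log_mul (Real.exp_pos e).ne' hz.ne',
        Real.log_exp]
    rw [this]; simpa using he
  refine ⟨Real.exp (-(2 * E + 3 / 4 * Real.log K₀ + 1 / 4 * Real.log (K₁ * 2 ^ (2 * ε)))),
    Real.exp_pos _, fun s h1 h5 ht => ?_⟩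
  have ht0 : 0 < |s.im| := by linarith
  obtain ⟨z1, p1⟩ := hP' (s.re : ℂ) (by simpa)
  obtain ⟨z2, p2⟩ := hP' s h1
  obtain ⟨z3, p3⟩ := hP' (s.re + (2 * s.im : ℝ) * I) (by simpa)
  have h341 := re_primeSum_three_four_one h0 h2 h1 s.im
  rw [Complex.re_add_im] at h341
  have b1 := (hb (s.re : ℂ) (by simpa) (by simpa) (by simp)).1
  have b3 := hu (s.re + (2 * s.im : ℝ) * I) (by simpa) (by simpa)
    (by simp [abs_mul]; linarith)
  have n1 : ‖(s.re : ℂ) - 1‖ = s.re - 1 := by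
    rw [← Complex.ofReal_one, ← Complex.ofReal_sub, Complex.norm_real, Real.norm_of_nonneg (by linarith)]
  rw [n1] at b1
  have i3 : |((s.re : ℂ) + (2 * s.im : ℝ) * I).im| = 2 * |s.im| := by simp [abs_mul]
  rw [i3, Real.mul_rpow (by norm_num) ht0.le] at b3
  have l1 : Real.log ‖zetaL χ (s.re : ℂ)‖ ≤ Real.log K₀ - Real.log (s.re - 1) := by
    rw [← Real.log_div hK₀.ne' (by linarith)]
    exact Real.log_le_log z1 b1
  have l3 : Real.log ‖zetaL χ (s.re + (2 * s.im : ℝ) * I)‖ ≤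
      Real.log (K₁ * 2 ^ (2 * ε)) + 2 * ε * Real.log |s.im| := by
    rw [← Real.log_rpow ht0, ← Real.log_mul (by positivity) (by positivity)]
    exact Real.log_le_log z3 (b3.trans (by rw [mul_assoc]))
  rw [← Real.exp_log z2, Real.rpow_def_of_pos (by linarith : 0 < s.re - 1),
    Real.rpow_def_of_pos ht0, ← Real.exp_add, ← Real.exp_add, Real.exp_le_exp]
  have := abs_le.mp p1
  have := abs_le.mp p2
  have := abs_le.mp p3
  nlinarith

/-- This removes the factor (σ-1)^(3/4). At distance at least η from the line the 3-4-1 bound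
suffices; closer in, the value at abscissa 1 + η is compared with the value at s, and the increment
is smaller than the lower bound already known at 1 + η. -/
theorem zetaL_lower_of_large {D : ℕ} [NeZero D] {χ : DirichletCharacter ℂ D} (hχ : χ ≠ 1)
    {c : ℕ → ℝ} (h0 : ∀ p, 0 ≤ c p) (h2 : ∀ p, c p ≤ 2)
    (hc : ∀ p : ℕ, p.Prime → ¬ p ∣ D → (c p : ℂ) = 1 + χ p) :
    ∃ k T : ℝ, 0 < k ∧ 1 ≤ T ∧ ∀ s : ℂ, 1 < s.re → s.re ≤ 5 → T ≤ |s.im| →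
      k * |s.im| ^ (-(1 / 8) : ℝ) ≤ ‖zetaL χ s‖ := by
  obtain ⟨k, hk, hlow⟩ := zetaL_lower_three_four_one hχ h0 h2 hc (ε := 1 / 100) (by norm_num)
  obtain ⟨K, hK, -, hd⟩ := zetaL_growth hχ (ε := 1 / 100) (by norm_num)
  -- The choice of r keeps the part of the increment proportional to η below a quarter of
  -- k·r³·t^(-1/8). The choice of M, with t ≥ M², does the same for the term t^(ε-1), so half of the
  -- lower bound is left.
  set r : ℝ := min 1 (k / (4 * K)) with hr
  have hr0 : 0 < r := by positivity
  have hr1 : r ≤ 1 := min_le_left _ _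
  have hrK : K * r ≤ k / 4 := by
    have : r ≤ k / (4 * K) := min_le_right _ _
    calc K * r ≤ K * (k / (4 * K)) := by gcongr
      _ = k / 4 := by field_simp
  set M : ℝ := 4 * K / (k * r ^ 3) with hM
  have hM0 : 0 < M := by positivity
  refine ⟨k * r ^ 3 / 2, max 1 (M ^ 2), by positivity, le_max_left _ _, fun s h1 h5 hT => ?_⟩
  have ht1 : 1 ≤ |s.im| := (le_max_left _ _).trans hT
  have htM : M ^ 2 ≤ |s.im| := (le_max_right _ _).trans hT
  set t := |s.im| with ht
  have ht0 : 0 < t := by linarith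
  -- the point to the right at distance `η`
  set η : ℝ := r ^ 4 * t ^ (-(16 / 100) : ℝ) with hη
  have hη0 : 0 < η := by positivity
  have hη1 : η ≤ 1 := by
    have a : t ^ (-(16 / 100) : ℝ) ≤ 1 := Real.rpow_le_one_of_one_le_of_nonpos ht1 (by norm_num)
    have b : r ^ 4 ≤ 1 := pow_le_one₀ hr0.le hr1
    calc η ≤ 1 * 1 := mul_le_mul b a (by positivity) (by norm_num)
      _ = 1 := by norm_num
  -- The exponent 16/100 in η satisfies (16/100)(3/4) + 1/200 = 1/8, while 16/100 - 3/100 = 13/100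
  -- still exceeds 1/8, as the increment requires.
  have hη34 : η ^ (3 / 4 : ℝ) * t ^ (-((1 / 100 : ℝ) / 2)) = r ^ 3 * t ^ (-(1 / 8) : ℝ) := by
    rw [hη, Real.mul_rpow (by positivity) (by positivity), ← Real.rpow_mul ht0.le, mul_assoc,
      ← Real.rpow_add ht0, ← Real.rpow_natCast r 4, ← Real.rpow_mul hr0.le]
    norm_num
  have hx0 : 0 < t ^ (-(1 / 8) : ℝ) := by positivity
  rcases le_total η (s.re - 1) with h | h
  · have a := hlow s h1 h5 ht1
    have b : η ^ (3 / 4 : ℝ) ≤ (s.re - 1) ^ (3 / 4 : ℝ) := Real.rpow_le_rpow hη0.le h (by norm_num)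
    have d : k * (η ^ (3 / 4 : ℝ) * t ^ (-((1 / 100 : ℝ) / 2))) ≤ ‖zetaL χ s‖ := by
      refine le_trans ?_ a; gcongr
    rw [hη34] at d
    have : 0 < k * r ^ 3 * t ^ (-(1 / 8) : ℝ) := by positivity
    linarith
  · set s' : ℂ := (1 + η : ℝ) + s.im * I with hs'
    have hre : s'.re = 1 + η := by simp [hs']
    have him : s'.im = s.im := by simp [hs']
    have a := hlow s' (by rw [hre]; linarith) (by rw [hre]; linarith) (by rw [him]; exact ht1)
    rw [hre, him, add_sub_cancel_left, ← ht, hη34] at a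
    have b := hd s s' h1 (by rw [hre]; linarith) (by rw [hre]; linarith) him.symm ht1
    rw [hre, ← ht] at b
    have e1 : (1 + η - s.re) * t ^ (3 * (1 / 100) : ℝ) ≤ r ^ 4 * t ^ (-(1 / 8) : ℝ) := by
      calc (1 + η - s.re) * t ^ (3 * (1 / 100) : ℝ) ≤ η * t ^ (3 * (1 / 100) : ℝ) := by
            gcongr; linarith
        _ = r ^ 4 * t ^ (-(13 / 100) : ℝ) := by
            rw [hη, mul_assoc, ← Real.rpow_add ht0]; norm_num
        _ ≤ _ := by
            exact mul_le_mul_of_nonneg_left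
              (Real.rpow_le_rpow_of_exponent_le ht1 (by norm_num)) (by positivity)
    have e2 : t ^ ((1 / 100 : ℝ) - 1) ≤ M⁻¹ * t ^ (-(1 / 8) : ℝ) := by
      have : M ≤ t ^ (1 / 2 : ℝ) := by
        rw [← Real.sqrt_eq_rpow]
        exact Real.le_sqrt_of_sq_le htM
      have e3 : t ^ ((1 / 100 : ℝ) - 1) ≤ t ^ (-(1 / 2) : ℝ) * t ^ (-(1 / 8) : ℝ) := by
        rw [← Real.rpow_add ht0]
        exact Real.rpow_le_rpow_of_exponent_le ht1 (by norm_num)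
      refine e3.trans ?_
      rw [Real.rpow_neg ht0.le]
      gcongr
    have e4 : K * (r ^ 4 * t ^ (-(1 / 8) : ℝ)) ≤ k / 4 * r ^ 3 * t ^ (-(1 / 8) : ℝ) := by
      calc K * (r ^ 4 * t ^ (-(1 / 8) : ℝ)) = (K * r) * (r ^ 3 * t ^ (-(1 / 8) : ℝ)) := by ring
        _ ≤ k / 4 * (r ^ 3 * t ^ (-(1 / 8) : ℝ)) := by gcongr
        _ = _ := by ring
    have e5 : K * (M⁻¹ * t ^ (-(1 / 8) : ℝ)) = k / 4 * r ^ 3 * t ^ (-(1 / 8) : ℝ) := by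
      rw [hM]; field_simp
    have e6 : K * ((1 + η - s.re) * t ^ (3 * (1 / 100) : ℝ) + t ^ ((1 / 100 : ℝ) - 1)) ≤
        K * (r ^ 4 * t ^ (-(1 / 8) : ℝ) + M⁻¹ * t ^ (-(1 / 8) : ℝ)) := by gcongr
    have e7 : ‖zetaL χ s'‖ ≤ ‖zetaL χ s‖ + ‖zetaL χ s - zetaL χ s'‖ := by
      have := norm_sub_le (zetaL χ s) (zetaL χ s - zetaL χ s')
      simpa using this
    nlinarith

/-- Upper and lower bounds for the exponential of the prime sum to the right of `Re s = 1`. -/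
theorem exp_primeSum_bounds {D : ℕ} [NeZero D] {χ : DirichletCharacter ℂ D} (hχ : χ ≠ 1)
    {c : ℕ → ℝ} (h0 : ∀ p, 0 ≤ c p) (h2 : ∀ p, c p ≤ 2)
    (hc : ∀ p : ℕ, p.Prime → ¬ p ∣ D → (c p : ℂ) = 1 + χ p) :
    ∃ K : ℝ, 0 < K ∧ ∀ s : ℂ, 1 < s.re → s.re ≤ 5 →
      Real.exp (primeSum c s).re ≤ K * ((1 + |s.im|) ^ (9 / 8 : ℝ) / ‖s - 1‖) ∧
      Real.exp (-(primeSum c s).re) ≤ K * (‖s - 1‖ * (1 + |s.im|) ^ (-(7 / 8) : ℝ)) := by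
  obtain ⟨E, hE, hP⟩ := abs_re_primeSum_sub_log_le χ h0 h2 hc
  obtain ⟨k, T, hk, hT, hlow⟩ := zetaL_lower_of_large hχ h0 h2 hc
  obtain ⟨K₀, hK₀, hb⟩ := zetaL_bounded_height hχ T
  -- This gives |ζL| ≪ |t|^(1/8), and |s-1| ≪ |t| at large height turns it into |t|^(9/8)/|s-1|.
  obtain ⟨K₁, hK₁, hu, -⟩ := zetaL_growth hχ (ε := 1 / 16) (by norm_num)
  set K₂ : ℝ := max (max K₀ (5 * K₁)) (max (K₀ * (1 + T) ^ (7 / 8 : ℝ)) (2 / k)) with hK₂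
  have hK₂0 : 0 < K₂ := lt_of_lt_of_le hK₀ ((le_max_left _ _).trans (le_max_left _ _))
  have key : ∀ s : ℂ, 1 < s.re → s.re ≤ 5 →
      ‖zetaL χ s‖ ≤ K₂ * ((1 + |s.im|) ^ (9 / 8 : ℝ) / ‖s - 1‖) ∧
      ‖zetaL χ s‖⁻¹ ≤ K₂ * (‖s - 1‖ * (1 + |s.im|) ^ (-(7 / 8) : ℝ)) := by
    intro s h1 h5
    have hs1 : 0 < ‖s - 1‖ := norm_pos_iff.mpr (sub_ne_zero.mpr (by rintro rfl; simp at h1))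
    have hone : (1 : ℝ) ≤ 1 + |s.im| := by linarith [abs_nonneg s.im]
    rcases le_total |s.im| T with h | h
    · obtain ⟨a, b⟩ := hb s h1 h5 h
      have hz : 0 < ‖zetaL χ s‖ := by
        have : 0 < ‖s - 1‖⁻¹ := by positivity
        exact pos_of_mul_pos_right (this.trans_le b) hK₀.le
      constructor
      · refine a.trans ?_
        have : (1 : ℝ) ≤ (1 + |s.im|) ^ (9 / 8 : ℝ) := Real.one_le_rpow hone (by norm_num)
        have h3 : K₀ ≤ K₂ := (le_max_left _ _).trans (le_max_left _ _)
        calc K₀ / ‖s - 1‖ = K₀ * (1 / ‖s - 1‖) := by ring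
          _ ≤ _ := by gcongr
      · have h3 : ‖zetaL χ s‖⁻¹ ≤ K₀ * ‖s - 1‖ := by
          rw [inv_le_iff_one_le_mul₀ hz]
          rw [inv_le_iff_one_le_mul₀ hs1] at b
          linarith
        refine h3.trans ?_
        have h4 : (1 : ℝ) ≤ (1 + T) ^ (7 / 8 : ℝ) * (1 + |s.im|) ^ (-(7 / 8) : ℝ) := by
          rw [Real.rpow_neg (by linarith), ← div_eq_mul_inv, le_div_iff₀ (by positivity), one_mul]
          gcongr
        have h5 : K₀ * (1 + T) ^ (7 / 8 : ℝ) ≤ K₂ := (le_max_left _ _).trans (le_max_right _ _)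
        calc K₀ * ‖s - 1‖ ≤ K₀ * ‖s - 1‖ * ((1 + T) ^ (7 / 8 : ℝ) * (1 + |s.im|) ^ (-(7 / 8) : ℝ)) :=
              le_mul_of_one_le_right (by positivity) h4
          _ = K₀ * (1 + T) ^ (7 / 8 : ℝ) * (‖s - 1‖ * (1 + |s.im|) ^ (-(7 / 8) : ℝ)) := by ring
          _ ≤ _ := by gcongr
    · have ht1 : 1 ≤ |s.im| := hT.trans h
      have ht0 : 0 < |s.im| := by linarith
      have him : |s.im| ≤ ‖s - 1‖ := by simpa using Complex.abs_im_le_norm (s - 1)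
      constructor
      · refine (hu s h1 h5 ht1).trans ?_
        have hn : ‖s - 1‖ ≤ 5 * |s.im| := by
          refine (Complex.norm_le_abs_re_add_abs_im _).trans ?_
          simp only [Complex.sub_re, Complex.one_re, Complex.sub_im, Complex.one_im, sub_zero]
          rw [abs_of_pos (by linarith)]; linarith
        have h3 : 5 * K₁ ≤ K₂ := (le_max_right _ _).trans (le_max_left _ _)
        rw [← mul_div_assoc K₂, le_div_iff₀ hs1]
        calc K₁ * |s.im| ^ (2 * (1 / 16) : ℝ) * ‖s - 1‖ ≤ K₁ * |s.im| ^ (2 * (1 / 16) : ℝ) * (5 * |s.im|) := by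
              gcongr
          _ = 5 * K₁ * (|s.im| ^ (2 * (1 / 16) : ℝ) * |s.im|) := by ring
          _ = 5 * K₁ * |s.im| ^ (9 / 8 : ℝ) := by
              rw [← Real.rpow_add_one ht0.ne']; norm_num
          _ ≤ _ := by
              gcongr; linarith
      · have a := hlow s h1 h5 h
        have h3 : ‖zetaL χ s‖⁻¹ ≤ k⁻¹ * |s.im| ^ (1 / 8 : ℝ) := by
          have := inv_anti₀ (by positivity) a
          rwa [mul_inv, ← Real.rpow_neg ht0.le, neg_neg] at this
        refine h3.trans ?_
        have h4 : |s.im| ^ (1 / 8 : ℝ) ≤ 2 * (‖s - 1‖ * (1 + |s.im|) ^ (-(7 / 8) : ℝ)) := by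
          have h6 : (1 + |s.im|) ^ (7 / 8 : ℝ) ≤ 2 * |s.im| ^ (7 / 8 : ℝ) := by
            calc (1 + |s.im|) ^ (7 / 8 : ℝ) ≤ (2 * |s.im|) ^ (7 / 8 : ℝ) := by gcongr; linarith
              _ = 2 ^ (7 / 8 : ℝ) * |s.im| ^ (7 / 8 : ℝ) := Real.mul_rpow (by norm_num) ht0.le
              _ ≤ 2 ^ (1 : ℝ) * |s.im| ^ (7 / 8 : ℝ) := by
                  gcongr <;> norm_num
              _ = _ := by norm_num
          rw [Real.rpow_neg (by linarith), ← div_eq_mul_inv, ← mul_div_assoc, le_div_iff₀ (by positivity)]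
          calc |s.im| ^ (1 / 8 : ℝ) * (1 + |s.im|) ^ (7 / 8 : ℝ)
              ≤ |s.im| ^ (1 / 8 : ℝ) * (2 * |s.im| ^ (7 / 8 : ℝ)) := by gcongr
            _ = 2 * (|s.im| ^ (1 / 8 : ℝ) * |s.im| ^ (7 / 8 : ℝ)) := by ring
            _ = 2 * |s.im| := by rw [← Real.rpow_add ht0]; norm_num
            _ ≤ _ := by gcongr
        have h5 : 2 / k ≤ K₂ := (le_max_right _ _).trans (le_max_right _ _)
        calc k⁻¹ * |s.im| ^ (1 / 8 : ℝ) ≤ k⁻¹ * (2 * (‖s - 1‖ * (1 + |s.im|) ^ (-(7 / 8) : ℝ))) := by gcongr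
          _ = 2 / k * (‖s - 1‖ * (1 + |s.im|) ^ (-(7 / 8) : ℝ)) := by ring
          _ ≤ _ := by gcongr
  refine ⟨Real.exp E * K₂, by positivity, fun s h1 h5 => ?_⟩
  obtain ⟨e, he, h⟩ := hP s h1
  obtain ⟨a, b⟩ := key s h1 h5
  have he' := abs_le.mp he
  rw [Real.exp_neg, h, ← norm_mul, mul_assoc, mul_assoc]
  change Real.exp e * ‖zetaL χ s‖ ≤ _ ∧ (Real.exp e * ‖zetaL χ s‖)⁻¹ ≤ _
  rw [mul_inv, ← Real.exp_neg]
  constructor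
  · gcongr; exact he'.2
  · gcongr; linarith [he'.1]

end SelbergSum

end

noncomputable section

/-! ### The smoothing weight as a Mellin integral. -/

namespace SelbergSum
open Complex MeasureTheory Set

theorem integrable_inv_sq_line {c : ℝ} (hc : 0 < c) :
    Integrable fun t : ℝ => ((c + t * I : ℂ) ^ 2)⁻¹ := by
  have hne : ∀ t : ℝ, (c + t * I : ℂ) ≠ 0 := fun t h => by
    have := congrArg Complex.re h; simp at this; exact hc.ne' this
  refine Integrable.mono' ((integrable_inv_one_add_sq).const_mul (max 1 (c ^ 2)⁻¹)) ?_ ?_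
  · refine Continuous.aestronglyMeasurable ?_
    exact Continuous.inv₀ (by fun_prop) fun t => pow_ne_zero 2 (hne t)
  · refine Filter.Eventually.of_forall fun t => ?_
    have e : ‖((c + t * I : ℂ) ^ 2)⁻¹‖ = (c ^ 2 + t ^ 2)⁻¹ := by
      rw [norm_inv, norm_pow, Complex.sq_norm, Complex.normSq_add_mul_I]
    rw [e, ← div_eq_mul_inv, inv_eq_one_div, div_le_div_iff₀ (by positivity) (by positivity)]
    have h1 : (1 : ℝ) ≤ max 1 (c ^ 2)⁻¹ := le_max_left _ _
    have h2 : 1 ≤ max 1 (c ^ 2)⁻¹ * c ^ 2 := by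
      rw [← inv_le_iff_one_le_mul₀ (by positivity)]; exact le_max_right _ _
    nlinarith [sq_nonneg t]

/-- Mellin inversion for `max (log y) 0`. -/
theorem integral_cpow_div_sq {y c : ℝ} (hy : 0 < y) (hc : 0 < c) :
    ∫ t : ℝ, (y : ℂ) ^ (c + t * I : ℂ) * ((c + t * I : ℂ) ^ 2)⁻¹ =
      2 * Real.pi * (max (Real.log y) 0 : ℝ) := by
  -- The Mellin transform of f is 1/s, so that of g = f·log is its derivative -1/s². Inversion is
  -- then taken at 1/y, which turns x^(-s) into y^s and g into -max(log y, 0).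
  set f : ℝ → ℂ := indicator (Ioc 0 1) (fun _ => 1) with hf
  set g : ℝ → ℂ := fun t => Real.log t • f t with hg
  have hloc : LocallyIntegrableOn f (Ioi 0) := by
    refine LocallyIntegrable.locallyIntegrableOn ?_ _
    refine Integrable.locallyIntegrable ?_
    exact (integrable_indicator_iff measurableSet_Ioc).mpr (by simp)
  have hmel : ∀ s : ℂ, 0 < s.re → MellinConvergent g s ∧ mellin g s = -(s ^ 2)⁻¹ := by
    intro s hs
    have h := mellin_hasDerivAt_of_isBigO_rpow (f := f) (s := s) (a := s.re + 1) (b := 0) hloc ?_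
      (by linarith) ?_ hs
    · refine ⟨h.1, ?_⟩
      have h2 : HasDerivAt (mellin f) (-(s ^ 2)⁻¹) s := by
        have hs0 : s ≠ 0 := by rintro rfl; simp at hs
        refine (hasDerivAt_inv hs0).congr_of_eventuallyEq ?_
        have : {w : ℂ | 0 < w.re} ∈ nhds s :=
          (isOpen_lt continuous_const Complex.continuous_re).mem_nhds hs
        filter_upwards [this] with w hw
        rw [(hasMellin_one_Ioc hw).2, one_div]
      exact h.2.unique h2
    · refine Asymptotics.IsBigO.of_bound 0 ?_
      filter_upwards [Filter.eventually_gt_atTop 1] with t ht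
      simp [hf, ht]
    · refine Asymptotics.IsBigO.of_bound 1 (Filter.Eventually.of_forall fun t => ?_)
      simp only [hf, indicator]
      split_ifs <;> simp
  have hne : ∀ t : ℝ, (0 : ℝ) < (c + t * I : ℂ).re := fun t => by simpa
  have hgm : ∀ x : ℝ, 0 < x → g x = ((min (Real.log x) 0 : ℝ) : ℂ) := by
    intro x hx
    simp only [hg, hf, indicator, mem_Ioc, hx, true_and]
    split_ifs with h
    · rw [min_eq_left (Real.log_nonpos hx.le h)]; simp
    · rw [min_eq_right (Real.log_nonneg (not_le.mp h).le)]; simp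
  have hx : 0 < y⁻¹ := inv_pos.mpr hy
  have hcont : ContinuousAt g y⁻¹ := by
    have : ContinuousAt (fun x : ℝ => ((min (Real.log x) 0 : ℝ) : ℂ)) y⁻¹ :=
      Complex.continuous_ofReal.continuousAt.comp
        ((Real.continuousAt_log hx.ne').min continuousAt_const)
    refine this.congr ?_
    filter_upwards [Ioi_mem_nhds hx] with x hx
    exact (hgm x hx).symm
  have hvert : VerticalIntegrable (mellin g) c := by
    rw [VerticalIntegrable]
    refine ((integrable_inv_sq_line hc).neg).congr (Filter.Eventually.of_forall fun t => ?_)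
    simp only [Pi.neg_apply]
    rw [(hmel _ (hne t)).2]
  have hinv := mellinInv_mellin_eq c g hx (hmel c (by simpa)).1 hvert hcont
  rw [hgm _ hx, Real.log_inv, mellinInv] at hinv
  have e1 : ∀ t : ℝ, ((y⁻¹ : ℝ) : ℂ) ^ (-(c + t * I : ℂ)) • mellin g (c + t * I) =
      -((y : ℂ) ^ (c + t * I : ℂ) * ((c + t * I : ℂ) ^ 2)⁻¹) := by
    intro t
    rw [(hmel _ (hne t)).2, smul_eq_mul, mul_neg, Complex.ofReal_inv, Complex.cpow_neg,
      Complex.inv_cpow _ _ (by rw [Complex.arg_ofReal_of_nonneg hy.le]; exact Real.pi_ne_zero.symm),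
      inv_inv]
  simp only [e1] at hinv
  rw [integral_neg] at hinv
  have e2 : (max (Real.log y) 0 : ℝ) = -min (-Real.log y) 0 := by
    rw [← neg_zero, ← max_neg_neg]; simp
  rw [e2]
  push_cast at hinv ⊢
  rw [← hinv]
  have hpi : (Real.pi : ℂ) ≠ 0 := by exact_mod_cast Real.pi_ne_zero
  rw [smul_neg, neg_neg, Complex.real_smul]
  push_cast
  generalize (∫ t : ℝ, (y : ℂ) ^ (c + t * I : ℂ) * ((c + t * I : ℂ) ^ 2)⁻¹) = J
  field_simp

/-- The Mellin kernel of the smoothing weight. -/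
def kern (X c t : ℝ) : ℂ :=
  ((Real.pi * Real.log X : ℝ) : ℂ)⁻¹ *
    (((X : ℂ) ^ (c + t * I : ℂ) - ((Real.sqrt X : ℝ) : ℂ) ^ (c + t * I : ℂ)) *
      ((c + t * I : ℂ) ^ 2)⁻¹)

/-- The decay |w|^(-2) reflects that the weight is piecewise linear in log ν; one of the two powers
is later spent against the factor |w - z|. -/
theorem norm_kern_le {X c : ℝ} (hX : 3 ≤ X) (hc : 0 < c) (t : ℝ) :
    ‖kern X c t‖ ≤ X ^ c / Real.log X * ‖(c + t * I : ℂ)‖⁻¹ ^ 2 := by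
  have hlog : 0 < Real.log X := Real.log_pos (by linarith)
  have hX0 : 0 < X := by linarith
  have h1 : ‖(X : ℂ) ^ (c + t * I : ℂ)‖ = X ^ c := by
    rw [Complex.norm_cpow_eq_rpow_re_of_pos hX0]; simp
  have hsq : Real.sqrt X ≤ X := by
    rw [Real.sqrt_le_left (by linarith)]; nlinarith
  have h2 : ‖((Real.sqrt X : ℝ) : ℂ) ^ (c + t * I : ℂ)‖ ≤ X ^ c := by
    rw [Complex.norm_cpow_eq_rpow_re_of_pos (Real.sqrt_pos.mpr hX0)]
    simp only [add_re, ofReal_re, mul_re, I_re, mul_zero, ofReal_im, I_im, mul_one, sub_self, add_zero]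
    exact Real.rpow_le_rpow (Real.sqrt_nonneg _) hsq hc.le
  rw [kern, norm_mul, norm_mul, norm_inv, norm_inv, norm_pow, Complex.norm_real,
    Real.norm_of_nonneg (by positivity), inv_pow, ← mul_assoc]
  refine mul_le_mul_of_nonneg_right ?_ (by positivity)
  have h3 : ‖(X : ℂ) ^ (c + t * I : ℂ) - ((Real.sqrt X : ℝ) : ℂ) ^ (c + t * I : ℂ)‖ ≤ 2 * X ^ c :=
    (norm_sub_le _ _).trans (by linarith)
  calc _ ≤ (Real.pi * Real.log X)⁻¹ * (2 * X ^ c) := by gcongr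
    _ = 2 / Real.pi * (X ^ c / Real.log X) := by field_simp
    _ ≤ 1 * (X ^ c / Real.log X) := by
        gcongr
        rw [div_le_one Real.pi_pos]; exact Real.two_le_pi
    _ = _ := one_mul _

theorem integrable_cpow_div_sq {y c : ℝ} (hy : 0 < y) (hc : 0 < c) :
    Integrable fun t : ℝ => (y : ℂ) ^ (c + t * I : ℂ) * ((c + t * I : ℂ) ^ 2)⁻¹ := by
  refine Integrable.bdd_mul (c := y ^ c) (integrable_inv_sq_line hc) ?_ ?_
  · refine Continuous.aestronglyMeasurable ?_
    refine Continuous.const_cpow (by fun_prop) (Or.inl ?_)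
    exact_mod_cast hy.ne'
  · refine Filter.Eventually.of_forall fun t => ?_
    rw [Complex.norm_cpow_eq_rpow_re_of_pos hy]; simp

/-- In the variable log ν the weight is a difference of two ramps, and each ramp has the Mellin
kernel y^w/w². -/
theorem weight_eq_log {X : ℝ} (hX : 3 ≤ X) {ν : ℕ} (hν : 1 ≤ ν) :
    weight X ν = 2 / Real.log X *
      (max (Real.log (X / ν)) 0 - max (Real.log (Real.sqrt X / ν)) 0) := by
  have hlog : 0 < Real.log X := Real.log_pos (by linarith)
  have hX0 : 0 < X := by linarith
  have hs0 : 0 < Real.sqrt X := Real.sqrt_pos.mpr hX0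
  have hν0 : (0 : ℝ) < ν := by exact_mod_cast hν
  have hsq : Real.sqrt X ≤ X := by
    rw [Real.sqrt_le_left (by linarith)]; nlinarith
  rw [weight]
  split_ifs with h1 h2
  · rw [max_eq_left (Real.log_nonneg ((one_le_div hν0).mpr (by linarith))),
      max_eq_left (Real.log_nonneg ((one_le_div hν0).mpr h1.le)),
      Real.log_div hX0.ne' hν0.ne', Real.log_div hs0.ne' hν0.ne', Real.log_sqrt hX0.le]
    field_simp
    ring
  · rw [max_eq_left (Real.log_nonneg ((one_le_div hν0).mpr h2)),
      max_eq_right (Real.log_nonpos (by positivity) ((div_le_one hν0).mpr (not_lt.mp h1)))]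
    ring
  · have h3 := not_le.mp h2
    rw [max_eq_right (Real.log_nonpos (by positivity) ((div_le_one hν0).mpr h3.le)),
      max_eq_right (Real.log_nonpos (by positivity) ((div_le_one hν0).mpr (by linarith)))]
    ring

theorem ofReal_div_natCast_cpow {y : ℝ} (hy : 0 < y) {ν : ℕ} (w : ℂ) :
    ((y / ν : ℝ) : ℂ) ^ w = (y : ℂ) ^ w * (ν : ℂ) ^ (-w) := by
  rw [div_eq_mul_inv, Complex.ofReal_mul, Complex.mul_cpow_ofReal_nonneg hy.le (by positivity),
    Complex.ofReal_inv, Complex.ofReal_natCast, Complex.inv_cpow _ _ (by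
      rw [Complex.natCast_arg]; exact Real.pi_ne_zero.symm), Complex.cpow_neg]

theorem kern_mul_cpow {X c : ℝ} (hX : 3 ≤ X) {ν : ℕ} (t : ℝ) :
    kern X c t * (ν : ℂ) ^ (-(c + t * I : ℂ)) = ((Real.pi * Real.log X : ℝ) : ℂ)⁻¹ *
      (((X / ν : ℝ) : ℂ) ^ (c + t * I : ℂ) * ((c + t * I : ℂ) ^ 2)⁻¹ -
        ((Real.sqrt X / ν : ℝ) : ℂ) ^ (c + t * I : ℂ) * ((c + t * I : ℂ) ^ 2)⁻¹) := by
  have hX0 : 0 < X := by linarith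
  rw [ofReal_div_natCast_cpow hX0, ofReal_div_natCast_cpow (Real.sqrt_pos.mpr hX0), kern]
  ring

theorem integrable_kern_mul_cpow {X c : ℝ} (hX : 3 ≤ X) (hc : 0 < c) {ν : ℕ} (hν : 1 ≤ ν) :
    Integrable fun t : ℝ => kern X c t * (ν : ℂ) ^ (-(c + t * I : ℂ)) := by
  have hX0 : 0 < X := by linarith
  have hν0 : (0 : ℝ) < ν := by exact_mod_cast hν
  simp only [kern_mul_cpow hX]
  exact ((integrable_cpow_div_sq (div_pos hX0 hν0) hc).sub
    (integrable_cpow_div_sq (div_pos (Real.sqrt_pos.mpr hX0) hν0) hc)).const_mul _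

theorem weight_eq_integral {X c : ℝ} (hX : 3 ≤ X) (hc : 0 < c) {ν : ℕ} (hν : 1 ≤ ν) :
    (weight X ν : ℂ) = ∫ t : ℝ, kern X c t * (ν : ℂ) ^ (-(c + t * I : ℂ)) := by
  have hX0 : 0 < X := by linarith
  have hν0 : (0 : ℝ) < ν := by exact_mod_cast hν
  simp only [kern_mul_cpow hX]
  rw [integral_const_mul, integral_sub (integrable_cpow_div_sq (div_pos hX0 hν0) hc)
    (integrable_cpow_div_sq (div_pos (Real.sqrt_pos.mpr hX0) hν0) hc),
    integral_cpow_div_sq (div_pos hX0 hν0) hc,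
    integral_cpow_div_sq (div_pos (Real.sqrt_pos.mpr hX0) hν0) hc, weight_eq_log hX hν]
  have hpi : (Real.pi : ℂ) ≠ 0 := by exact_mod_cast Real.pi_ne_zero
  have hlog : (Real.log X : ℂ) ≠ 0 := by exact_mod_cast (Real.log_pos (by linarith)).ne'
  push_cast
  field_simp

end SelbergSum

end

noncomputable section

/-! ### The coefficients r, α and the factor K at a single prime. -/

namespace SelbergSum
open Complex

section LocalFactors

variable {d₁ d₂ : ℕ} (χ₁ : DirichletCharacter ℂ d₁) (χ₂ : DirichletCharacter ℂ d₂)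

theorem convolution_prime_pow (f g : ℕ → ℂ) {p : ℕ} (hp : p.Prime) (k : ℕ) :
    LSeries.convolution f g (p ^ k) = ∑ i ∈ Finset.range (k + 1), f (p ^ i) * g (p ^ (k - i)) := by
  simp only [LSeries.convolution_def]
  rw [Nat.sum_divisorsAntidiagonal (f := fun a b => f a * g b),
    Nat.sum_divisors_prime_pow hp]
  refine Finset.sum_congr rfl fun i hi => ?_
  rw [Nat.pow_div (Nat.lt_succ_iff.mp (Finset.mem_range.mp hi)) hp.pos]

theorem rCoeff_prime_pow {p : ℕ} (hp : p.Prime) (k : ℕ) :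
    rCoeff χ₁ χ₂ (p ^ k) = ∑ i ∈ Finset.range (k + 1), χ₁ p ^ i * χ₂ p ^ (k - i) := by
  rw [rCoeff, convolution_prime_pow _ _ hp]
  simp

theorem norm_rCoeff_prime_pow_le {p : ℕ} (hp : p.Prime) (k : ℕ) :
    ‖rCoeff χ₁ χ₂ (p ^ k)‖ ≤ k + 1 := by
  rw [rCoeff_prime_pow χ₁ χ₂ hp]
  refine (norm_sum_le _ _).trans ?_
  have : ∀ i ∈ Finset.range (k + 1), ‖χ₁ p ^ i * χ₂ p ^ (k - i)‖ ≤ 1 := fun i _ => by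
    rw [norm_mul, norm_pow, norm_pow]
    exact mul_le_one₀ (pow_le_one₀ (norm_nonneg _) (χ₁.norm_le_one _)) (by positivity)
      (pow_le_one₀ (norm_nonneg _) (χ₂.norm_le_one _))
  refine (Finset.sum_le_sum this).trans ?_
  simp

theorem alpha_prime_pow {p : ℕ} (hp : p.Prime) (k : ℕ) :
    alpha χ₁ χ₂ (p ^ k) = ∑ i ∈ Finset.range (k + 1),
      (χ₁ p ^ i * zetaInvSqrtCoeff (p ^ i)) * (χ₂ p ^ (k - i) * zetaInvSqrtCoeff (p ^ (k - i))) := by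
  rw [alpha, convolution_prime_pow _ _ hp]
  simp

theorem norm_alpha_prime_pow_le {p : ℕ} (hp : p.Prime) (k : ℕ) :
    ‖alpha χ₁ χ₂ (p ^ k)‖ ≤ k + 1 := by
  rw [alpha_prime_pow χ₁ χ₂ hp]
  refine (norm_sum_le _ _).trans ?_
  have : ∀ i ∈ Finset.range (k + 1), ‖(χ₁ p ^ i * zetaInvSqrtCoeff (p ^ i)) *
      (χ₂ p ^ (k - i) * zetaInvSqrtCoeff (p ^ (k - i)))‖ ≤ 1 := fun i _ => by
    rw [norm_mul, norm_mul, norm_mul, norm_pow, norm_pow]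
    exact mul_le_one₀ (mul_le_one₀ (pow_le_one₀ (norm_nonneg _) (χ₁.norm_le_one _)) (norm_nonneg _)
      (norm_zetaInvSqrtCoeff_le _)) (by positivity)
      (mul_le_one₀ (pow_le_one₀ (norm_nonneg _) (χ₂.norm_le_one _)) (norm_nonneg _)
      (norm_zetaInvSqrtCoeff_le _))
  refine (Finset.sum_le_sum this).trans ?_
  simp

theorem rCoeff_one : rCoeff χ₁ χ₂ 1 = 1 := by
  simp [rCoeff, LSeries.convolution_def]

theorem rCoeff_prime {p : ℕ} (hp : p.Prime) : rCoeff χ₁ χ₂ p = χ₁ p + χ₂ p := by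
  have := rCoeff_prime_pow χ₁ χ₂ hp 1
  rw [pow_one] at this
  rw [this, Finset.sum_range_succ, Finset.sum_range_one]
  simp [add_comm]

theorem alpha_one : alpha χ₁ χ₂ 1 = 1 := (alpha_spec χ₁ χ₂).1

/-- Thus α(p)r(p) = -c(p) and α(p)² = c(p)/2, which are the coefficients -1 and 1/2 in `firstOrder`.
-/
theorem alpha_prime {p : ℕ} (hp : p.Prime) : alpha χ₁ χ₂ p = -(χ₁ p + χ₂ p) / 2 := by
  have := alpha_prime_pow χ₁ χ₂ hp 1
  rw [pow_one] at this
  rw [this, Finset.sum_range_succ, Finset.sum_range_one]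
  have h0 : zetaInvSqrtCoeff 1 = 1 := by simp [zetaInvSqrtCoeff]
  have h1 : zetaInvSqrtCoeff p = -(1 / 2) := by
    have := zetaInvSqrtCoeff_prime_pow hp 1
    rw [pow_one] at this
    rw [this, Ring.choose_one_right]; ring
  simp [h0, h1]
  ring

/-- The local factor of `K` at the prime `p`, as a function of the exponent. -/
def localK (p : ℕ) (s : ℂ) (n : ℕ) : ℂ :=
  (∑' k : ℕ, rCoeff χ₁ χ₂ (p ^ k) ^ 2 / (p : ℂ) ^ (k * s))⁻¹ *
    ∑' k : ℕ, rCoeff χ₁ χ₂ (p ^ (n + k)) * rCoeff χ₁ χ₂ (p ^ k) / (p : ℂ) ^ (k * s)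

variable {χ₁ χ₂}

theorem hasSum_succ_sq_mul_geometric {x : ℂ} (hx : ‖x‖ < 1) :
    HasSum (fun k : ℕ => ((k : ℂ) + 1) ^ 2 * x ^ k) ((1 + x) / (1 - x) ^ 3) := by
  have h1 := hasSum_choose_mul_geometric_of_norm_lt_one 2 hx
  have h2 := hasSum_choose_mul_geometric_of_norm_lt_one 1 hx
  have hx1 : (1 - x) ≠ 0 := by
    intro h
    rw [← sub_eq_zero.mp h] at hx; simp at hx
  have ev : (1 + x) / (1 - x) ^ 3 = 2 * (1 / (1 - x) ^ (2 + 1)) - 1 / (1 - x) ^ (1 + 1) := by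
    field_simp
    ring
  rw [ev]
  have hh := (h1.mul_left 2).sub h2
  refine Eq.mp (congrArg (fun f => HasSum f _) (funext fun k => ?_)) hh
  have : (((k + 2).choose 2 : ℕ) : ℂ) = (k + 2) * (k + 1) / 2 := by
    rw [Nat.cast_choose_two]; push_cast; ring
  simp only [this, Nat.choose_one_right]; push_cast; ring

/-- A common majorant for the local series with |x| ≤ 3/5; the value is (1 + x)/(1 - x)³ at x = 3/5.
-/
theorem hasSum_succ_sq_mul_three_fifths :
    HasSum (fun k : ℕ => ((k : ℝ) + 1) ^ 2 * (3 / 5 : ℝ) ^ k) 25 := by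
  have h := hasSum_succ_sq_mul_geometric (x := ((3 / 5 : ℝ) : ℂ)) (by
    rw [Complex.norm_real]; norm_num)
  have e : (1 + ((3 / 5 : ℝ) : ℂ)) / (1 - ((3 / 5 : ℝ) : ℂ)) ^ 3 = ((25 : ℝ) : ℂ) := by
    push_cast; norm_num
  rw [e] at h
  refine Complex.hasSum_ofReal.mp ?_
  exact_mod_cast h

/-- The diagonal local sum stays away from zero. -/
theorem norm_tsum_rCoeff_sq_ge (hq₁ : χ₁.IsQuadratic) (hq₂ : χ₂.IsQuadratic) {p : ℕ} (hp : p.Prime)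
    {x : ℂ} (hx : ‖x‖ ≤ 3 / 5) :
    1 / 20 ≤ ‖∑' k : ℕ, rCoeff χ₁ χ₂ (p ^ k) ^ 2 * x ^ k‖ := by
  have hx1 : ‖x‖ < 1 := by linarith
  have key : ∀ v : ℂ, 1 / 20 ≤ ‖v‖ →
      HasSum (fun k : ℕ => rCoeff χ₁ χ₂ (p ^ k) ^ 2 * x ^ k) v →
      1 / 20 ≤ ‖∑' k : ℕ, rCoeff χ₁ χ₂ (p ^ k) ^ 2 * x ^ k‖ := fun v hv h => by rwa [h.tsum_eq]
  have hge : ∀ y : ℂ, ‖y‖ ≤ 3 / 5 → 2 / 5 ≤ ‖1 - y‖ ∧ ‖1 - y‖ ≤ 2 := by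
    intro y hy
    have h1 := norm_sub_norm_le (1 : ℂ) y
    have h2 := norm_sub_le (1 : ℂ) y
    rw [norm_one] at h1 h2
    constructor <;> linarith
  obtain ⟨a1, a2⟩ := hge x hx
  obtain ⟨b1, b2⟩ := hge (-x) (by rwa [norm_neg])
  rw [sub_neg_eq_add] at b1 b2
  have hx1' : (1 - x) ≠ 0 := norm_pos_iff.mp (by linarith)
  have hx2' : (1 + x) ≠ 0 := norm_pos_iff.mp (by linarith)
  -- As χ₁(p) and χ₂(p) lie in {0, 1, -1}, the series is 1, 1/(1-x), 1/(1-x²) or (1+x)/(1-x)³. The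
  -- last gives the smallest bound, (2/5)/2³ = 1/20.
  have case_sq : (∀ k : ℕ, rCoeff χ₁ χ₂ (p ^ k) ^ 2 = ((k : ℂ) + 1) ^ 2) →
      1 / 20 ≤ ‖∑' k : ℕ, rCoeff χ₁ χ₂ (p ^ k) ^ 2 * x ^ k‖ := by
    intro h
    refine key _ ?_ (by simpa only [h] using hasSum_succ_sq_mul_geometric hx1)
    rw [norm_div, norm_pow, le_div_iff₀ (by positivity)]
    have : ‖1 - x‖ ^ 3 ≤ 2 ^ 3 := by gcongr
    linarith
  have case_one : (∀ k : ℕ, rCoeff χ₁ χ₂ (p ^ k) ^ 2 = 1) →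
      1 / 20 ≤ ‖∑' k : ℕ, rCoeff χ₁ χ₂ (p ^ k) ^ 2 * x ^ k‖ := by
    intro h
    refine key _ ?_ (by simpa only [h, one_mul] using hasSum_geometric_of_norm_lt_one hx1)
    rw [norm_inv, one_div]
    exact inv_anti₀ (by linarith) (by linarith)
  have case_even : (∀ k : ℕ, rCoeff χ₁ χ₂ (p ^ k) ^ 2 = (1 + (-1) ^ k) / 2) →
      1 / 20 ≤ ‖∑' k : ℕ, rCoeff χ₁ χ₂ (p ^ k) ^ 2 * x ^ k‖ := by
    intro h
    have h1 := hasSum_geometric_of_norm_lt_one hx1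
    have h2 := hasSum_geometric_of_norm_lt_one (ξ := -x) (by rwa [norm_neg])
    refine key ((1 - x) * (1 + x))⁻¹ ?_ ?_
    · rw [norm_inv, norm_mul, one_div]
      refine inv_anti₀ (mul_pos (by linarith) (by linarith)) ?_
      nlinarith
    · have ev : ((1 - x) * (1 + x))⁻¹ = 1 / 2 * ((1 - x)⁻¹ + (1 - -x)⁻¹) := by
        rw [sub_neg_eq_add]
        field_simp
        ring
      rw [ev]
      have hh := (h1.add h2).mul_left (1 / 2)
      refine Eq.mp (congrArg (fun f => HasSum f _) (funext fun k => ?_)) hh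
      simp only [h, neg_pow x]; ring
  rcases hq₁ p with h1 | h1 | h1 <;> rcases hq₂ p with h2 | h2 | h2
  · -- both characters vanish
    refine key 1 (by norm_num) ?_
    have : (fun k : ℕ => rCoeff χ₁ χ₂ (p ^ k) ^ 2 * x ^ k) = fun k => if k = 0 then 1 else 0 := by
      ext k
      rcases Nat.eq_zero_or_pos k with rfl | hk
      · simp [rCoeff_one]
      · rw [rCoeff_prime_pow χ₁ χ₂ hp, h1, h2, Finset.sum_eq_zero, if_neg hk.ne']
        · ring
        · intro i hi
          rcases Nat.eq_zero_or_pos i with rfl | hi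
          · simp [hk.ne']
          · simp [hi.ne']
    rw [this]
    exact hasSum_ite_eq 0 1
  · refine case_one fun k => ?_
    rw [rCoeff_prime_pow χ₁ χ₂ hp, h1, h2, Finset.sum_eq_single 0]
    · simp
    · intro i _ hi; simp [hi]
    · simp
  · refine case_one fun k => ?_
    rw [rCoeff_prime_pow χ₁ χ₂ hp, h1, h2, Finset.sum_eq_single 0]
    · simp [← pow_mul, mul_comm k 2]
    · intro i _ hi; simp [hi]
    · simp
  · refine case_one fun k => ?_
    rw [rCoeff_prime_pow χ₁ χ₂ hp, h1, h2, Finset.sum_eq_single k]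
    · simp
    · intro i hi hik
      have : k - i ≠ 0 := by have := Finset.mem_range.mp hi; omega
      simp [this]
    · simp
  · refine case_sq fun k => ?_
    rw [rCoeff_prime_pow χ₁ χ₂ hp, h1, h2]
    simp
  · refine case_even fun k => ?_
    have h3 : rCoeff χ₁ χ₂ (p ^ k) * 2 = 1 + (-1) ^ k := by
      have := (Commute.all (1 : ℂ) (-1)).geom_sum₂_mul (k + 1)
      rw [rCoeff_prime_pow χ₁ χ₂ hp, h1, h2]
      simp only [Nat.add_sub_cancel] at this
      rw [show (2 : ℂ) = 1 - -1 by norm_num, this, one_pow, pow_succ]; ring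
    have h4 : ((-1 : ℂ) ^ k) ^ 2 = 1 := by rw [← pow_mul, mul_comm, pow_mul]; simp
    linear_combination (1 / 4 * (rCoeff χ₁ χ₂ (p ^ k) * 2 + (1 + (-1) ^ k))) * h3 + h4 / 4
  · refine case_one fun k => ?_
    rw [rCoeff_prime_pow χ₁ χ₂ hp, h1, h2, Finset.sum_eq_single k]
    · simp [← pow_mul, mul_comm k 2]
    · intro i hi hik
      have : k - i ≠ 0 := by have := Finset.mem_range.mp hi; omega
      simp [this]
    · simp
  · refine case_even fun k => ?_
    have h3 : rCoeff χ₁ χ₂ (p ^ k) * 2 = 1 + (-1) ^ k := by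
      have := (Commute.all (-1 : ℂ) 1).geom_sum₂_mul (k + 1)
      rw [rCoeff_prime_pow χ₁ χ₂ hp, h1, h2]
      simp only [Nat.add_sub_cancel] at this
      rw [show (2 : ℂ) = -(-1 - 1) by norm_num, mul_neg, this, one_pow, pow_succ]; ring
    have h4 : ((-1 : ℂ) ^ k) ^ 2 = 1 := by rw [← pow_mul, mul_comm, pow_mul]; simp
    linear_combination (1 / 4 * (rCoeff χ₁ χ₂ (p ^ k) * 2 + (1 + (-1) ^ k))) * h3 + h4 / 4
  · refine case_sq fun k => ?_
    have h3 : rCoeff χ₁ χ₂ (p ^ k) = (-1) ^ k * (k + 1) := by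
      rw [rCoeff_prime_pow χ₁ χ₂ hp, h1, h2]
      have : ∀ i ∈ Finset.range (k + 1), (-1 : ℂ) ^ i * (-1) ^ (k - i) = (-1) ^ k := by
        intro i hi
        rw [← pow_add]; congr 1; have := Finset.mem_range.mp hi; omega
      rw [Finset.sum_congr rfl this]; simp; ring
    rw [h3, mul_pow, ← pow_mul, mul_comm k 2, pow_mul]; simp

theorem natCast_cpow_mul_eq_pow (p k : ℕ) (s : ℂ) (y : ℂ) :
    y / (p : ℂ) ^ (k * s) = y * ((p : ℂ) ^ (-s)) ^ k := by
  rw [Complex.cpow_nat_mul, Complex.cpow_neg, inv_pow, div_eq_mul_inv]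

/-- The worst prime is 2, and 2^(-3/4) < 3/5. The range Re s ≥ 3/4 is what |z| ≤ 1/4 guarantees for
s = 1 - z. -/
theorem norm_prime_cpow_le {p : ℕ} (hp : p.Prime) {s : ℂ} (hs : 3 / 4 ≤ s.re) :
    ‖(p : ℂ) ^ (-s)‖ ≤ 3 / 5 := by
  rw [Complex.norm_natCast_cpow_of_pos hp.pos, Complex.neg_re]
  have h2 : (2 : ℝ) ≤ p := by exact_mod_cast hp.two_le
  have h1 : (p : ℝ) ^ (-s.re) ≤ (2 : ℝ) ^ (-(3 / 4) : ℝ) := by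
    calc (p : ℝ) ^ (-s.re) ≤ (p : ℝ) ^ (-(3 / 4) : ℝ) :=
          Real.rpow_le_rpow_of_exponent_le (by linarith) (by linarith)
      _ ≤ _ := Real.rpow_le_rpow_of_nonpos (by norm_num) h2 (by norm_num)
  refine h1.trans ?_
  have h3 : (5 / 3 : ℝ) ≤ 2 ^ (3 / 4 : ℝ) := by
    have : (5 / 3 : ℝ) = ((5 / 3 : ℝ) ^ (4 / 3 : ℝ)) ^ (3 / 4 : ℝ) := by
      rw [← Real.rpow_mul (by norm_num)]; norm_num
    rw [this]
    refine Real.rpow_le_rpow (by positivity) ?_ (by norm_num)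
    have h4 : ((5 / 3 : ℝ) ^ (4 / 3 : ℝ)) ^ (3 : ℕ) ≤ 2 ^ 3 := by
      rw [← Real.rpow_natCast, ← Real.rpow_mul (by norm_num)]; norm_num
    exact le_of_pow_le_pow_left₀ (by norm_num) (by norm_num) h4
  rw [Real.rpow_neg (by norm_num), inv_le_comm₀ (by positivity) (by norm_num)]
  linarith

theorem norm_rCoeff_mul_le {p : ℕ} (hp : p.Prime) (n k : ℕ) {x : ℂ} (hx : ‖x‖ ≤ 3 / 5) :
    ‖rCoeff χ₁ χ₂ (p ^ (n + k)) * rCoeff χ₁ χ₂ (p ^ k) * x ^ k‖ ≤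
      (n + 1) * (((k : ℝ) + 1) ^ 2 * (3 / 5 : ℝ) ^ k) := by
  rw [norm_mul, norm_mul, norm_pow]
  have h1 := norm_rCoeff_prime_pow_le χ₁ χ₂ hp (n + k)
  have h2 := norm_rCoeff_prime_pow_le χ₁ χ₂ hp k
  have h3 : ((n + k : ℕ) : ℝ) + 1 ≤ (n + 1) * (k + 1) := by
    push_cast; nlinarith [(Nat.cast_nonneg n : (0 : ℝ) ≤ n), (Nat.cast_nonneg k : (0 : ℝ) ≤ k),
      mul_nonneg (Nat.cast_nonneg n : (0 : ℝ) ≤ n) (Nat.cast_nonneg k : (0 : ℝ) ≤ k)]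
  calc _ ≤ ((n + 1 : ℝ) * (k + 1)) * (k + 1) * (3 / 5 : ℝ) ^ k := by
        gcongr; exact h1.trans h3
    _ = _ := by ring

theorem summable_rCoeff_mul {p : ℕ} (hp : p.Prime) (n : ℕ) {x : ℂ} (hx : ‖x‖ ≤ 3 / 5) :
    Summable fun k : ℕ => rCoeff χ₁ χ₂ (p ^ (n + k)) * rCoeff χ₁ χ₂ (p ^ k) * x ^ k :=
  Summable.of_norm_bounded (hasSum_succ_sq_mul_three_fifths.summable.mul_left _)
    fun k => norm_rCoeff_mul_le hp n k hx

theorem localK_eq (p : ℕ) (s : ℂ) (n : ℕ) : localK χ₁ χ₂ p s n =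
    (∑' k : ℕ, rCoeff χ₁ χ₂ (p ^ k) ^ 2 * ((p : ℂ) ^ (-s)) ^ k)⁻¹ *
    ∑' k : ℕ, rCoeff χ₁ χ₂ (p ^ (n + k)) * rCoeff χ₁ χ₂ (p ^ k) * ((p : ℂ) ^ (-s)) ^ k := by
  simp only [localK, natCast_cpow_mul_eq_pow]

theorem tsum_rCoeff_sq_ne_zero (hq₁ : χ₁.IsQuadratic) (hq₂ : χ₂.IsQuadratic) {p : ℕ}
    (hp : p.Prime) {x : ℂ} (hx : ‖x‖ ≤ 3 / 5) :
    ∑' k : ℕ, rCoeff χ₁ χ₂ (p ^ k) ^ 2 * x ^ k ≠ 0 := by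
  have := norm_tsum_rCoeff_sq_ge hq₁ hq₂ hp hx
  exact norm_pos_iff.mp (by linarith)

theorem localK_zero (hq₁ : χ₁.IsQuadratic) (hq₂ : χ₂.IsQuadratic) {p : ℕ} (hp : p.Prime)
    {s : ℂ} (hs : 3 / 4 ≤ s.re) : localK χ₁ χ₂ p s 0 = 1 := by
  rw [localK_eq]
  simp only [zero_add, ← sq]
  exact inv_mul_cancel₀ (tsum_rCoeff_sq_ne_zero hq₁ hq₂ hp (norm_prime_cpow_le hp hs))

theorem norm_localK_le (hq₁ : χ₁.IsQuadratic) (hq₂ : χ₂.IsQuadratic) {p : ℕ} (hp : p.Prime)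
    {s : ℂ} (hs : 3 / 4 ≤ s.re) (n : ℕ) : ‖localK χ₁ χ₂ p s n‖ ≤ 500 * (n + 1) := by
  have hx := norm_prime_cpow_le hp hs
  have h1 := norm_tsum_rCoeff_sq_ge hq₁ hq₂ hp hx
  have h2 : ‖∑' k : ℕ, rCoeff χ₁ χ₂ (p ^ (n + k)) * rCoeff χ₁ χ₂ (p ^ k) * ((p : ℂ) ^ (-s)) ^ k‖ ≤
      (n + 1) * 25 :=
    tsum_of_norm_bounded (hasSum_succ_sq_mul_three_fifths.mul_left _)
      fun k => norm_rCoeff_mul_le hp n k hx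
  rw [localK_eq, norm_mul, norm_inv]
  have h3 : ‖∑' k : ℕ, rCoeff χ₁ χ₂ (p ^ k) ^ 2 * ((p : ℂ) ^ (-s)) ^ k‖⁻¹ ≤ 20 := by
    rw [inv_le_comm₀ (by linarith) (by norm_num)]; linarith
  calc _ ≤ 20 * ((n + 1 : ℝ) * 25) := mul_le_mul h3 h2 (norm_nonneg _) (by norm_num)
    _ = _ := by ring

/-- If r(p^(1+k)) is replaced by r(p)r(p^k), the numerator becomes r(p) times the denominator. The
replacement changes nothing at k = 0, so its cost carries at least one factor p^(-s). -/
theorem norm_localK_one_sub_le (hq₁ : χ₁.IsQuadratic) (hq₂ : χ₂.IsQuadratic) {p : ℕ} (hp : p.Prime)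
    {s : ℂ} (hs : 3 / 4 ≤ s.re) :
    ‖localK χ₁ χ₂ p s 1 - (χ₁ p + χ₂ p)‖ ≤ 4000 * ‖(p : ℂ) ^ (-s)‖ := by
  have hx := norm_prime_cpow_le hp hs
  have h1 := norm_tsum_rCoeff_sq_ge hq₁ hq₂ hp hx
  set x := (p : ℂ) ^ (-s)
  set r := χ₁ p + χ₂ p with hr
  have hs0 := summable_rCoeff_mul (χ₁ := χ₁) (χ₂ := χ₂) hp 0 hx
  have hs1 := summable_rCoeff_mul (χ₁ := χ₁) (χ₂ := χ₂) hp 1 hx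
  simp only [zero_add, ← sq] at hs0
  have e : localK χ₁ χ₂ p s 1 - r = (∑' k : ℕ, rCoeff χ₁ χ₂ (p ^ k) ^ 2 * x ^ k)⁻¹ *
      ∑' k : ℕ, (rCoeff χ₁ χ₂ (p ^ (1 + k)) * rCoeff χ₁ χ₂ (p ^ k) * x ^ k -
        r * (rCoeff χ₁ χ₂ (p ^ k) ^ 2 * x ^ k)) := by
    rw [hs1.tsum_sub (hs0.mul_left r), tsum_mul_left, mul_sub, localK_eq]
    congr 1
    have := tsum_rCoeff_sq_ne_zero hq₁ hq₂ hp hx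
    rw [mul_left_comm, inv_mul_cancel₀ this, mul_one]
  have hb : ∀ k : ℕ, ‖rCoeff χ₁ χ₂ (p ^ (1 + k)) * rCoeff χ₁ χ₂ (p ^ k) * x ^ k -
        r * (rCoeff χ₁ χ₂ (p ^ k) ^ 2 * x ^ k)‖ ≤
      (20 / 3 * ‖x‖) * (((k : ℝ) + 1) ^ 2 * (3 / 5 : ℝ) ^ k) := by
    intro k
    rcases Nat.eq_zero_or_pos k with rfl | hk
    · simp only [add_zero, pow_one, pow_zero, rCoeff_one, rCoeff_prime χ₁ χ₂ hp]
      simp only [hr, mul_one, one_pow, sub_self, norm_zero]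
      positivity
    · have e1 : rCoeff χ₁ χ₂ (p ^ (1 + k)) * rCoeff χ₁ χ₂ (p ^ k) * x ^ k -
        r * (rCoeff χ₁ χ₂ (p ^ k) ^ 2 * x ^ k) =
        (rCoeff χ₁ χ₂ (p ^ (1 + k)) - r * rCoeff χ₁ χ₂ (p ^ k)) * rCoeff χ₁ χ₂ (p ^ k) * x ^ k := by
        ring
      have a1 := norm_rCoeff_prime_pow_le χ₁ χ₂ hp (1 + k)
      have a2 := norm_rCoeff_prime_pow_le χ₁ χ₂ hp k
      have a3 : ‖r‖ ≤ 2 := by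
        refine (norm_add_le _ _).trans ?_
        have := χ₁.norm_le_one p
        have := χ₂.norm_le_one p
        linarith
      have a4 : ‖rCoeff χ₁ χ₂ (p ^ (1 + k)) - r * rCoeff χ₁ χ₂ (p ^ k)‖ ≤ 4 * (k + 1) := by
        refine (norm_sub_le _ _).trans ?_
        rw [norm_mul]
        have : ‖r‖ * ‖rCoeff χ₁ χ₂ (p ^ k)‖ ≤ 2 * (k + 1) := by gcongr
        have hk1 : (1 : ℝ) ≤ k := by exact_mod_cast hk
        push_cast at a1
        linarith
      have a5 : ‖x‖ ^ k ≤ ‖x‖ * (5 / 3 * (3 / 5 : ℝ) ^ k) := by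
        obtain ⟨j, rfl⟩ : ∃ j, k = j + 1 := ⟨k - 1, by omega⟩
        rw [pow_succ, pow_succ]
        have : ‖x‖ ^ j ≤ (3 / 5 : ℝ) ^ j := by gcongr
        nlinarith [norm_nonneg x]
      rw [e1, norm_mul, norm_mul, norm_pow]
      calc _ ≤ (4 * (k + 1)) * (k + 1) * (‖x‖ * (5 / 3 * (3 / 5 : ℝ) ^ k)) := by gcongr
        _ = _ := by ring
  have h2 := tsum_of_norm_bounded (hasSum_succ_sq_mul_three_fifths.mul_left (20 / 3 * ‖x‖)) hb
  rw [e, norm_mul, norm_inv]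
  have h3 : ‖∑' k : ℕ, rCoeff χ₁ χ₂ (p ^ k) ^ 2 * x ^ k‖⁻¹ ≤ 20 := by
    rw [inv_le_comm₀ (by linarith) (by norm_num)]; linarith
  calc _ ≤ 20 * ((20 / 3 * ‖x‖) * 25) := mul_le_mul h3 h2 (norm_nonneg _) (by norm_num)
    _ ≤ _ := by nlinarith [norm_nonneg x]

end LocalFactors

end SelbergSum

end

noncomputable section

/-! ### Local factors of the Selberg sum and their first-order expansion. -/

namespace SelbergSum
open Complex

/-- The abscissae on which the four Mellin variables live. -/
structure OnLines (z : ℂ) (δ : ℝ) (w₁ w₂ w₃ w₄ : ℂ) : Prop where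
  norm_le : ‖z‖ ≤ 1 / 4
  pos : 0 < δ
  le_re : -δ ≤ z.re
  re₁ : w₁.re = max z.re 0 + δ
  re₂ : w₂.re = δ
  re₃ : w₃.re = max z.re 0 + δ
  re₄ : w₄.re = δ

section LocalSum

variable {d₁ d₂ : ℕ} (χ₁ : DirichletCharacter ℂ d₁) (χ₂ : DirichletCharacter ℂ d₂)

/-- The coefficient `(χ₁(p) + χ₂(p))² / 2`. -/
def primeCoeff (p : ℕ) : ℝ := ((χ₁ p + χ₂ p) ^ 2 / 2 : ℂ).re

/-- The exponent of `1 / p` in the local term at `(p^k₁, p^k₂, p^k₃, p^k₄)`. -/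
def localExponent (z w₁ w₂ w₃ w₄ : ℂ) (k : ℕ × ℕ × ℕ × ℕ) : ℂ :=
  (1 - z) * ((k.1 : ℂ) + k.2.2.1 - (min (k.1 + k.2.2.2) (k.2.1 + k.2.2.1) : ℕ)) + k.2.1 + k.2.2.2 +
    (k.1 * w₁ + k.2.1 * w₂ + k.2.2.1 * w₃ + k.2.2.2 * w₄)

/-- The part of the local term at `(p^k₁, p^k₂, p^k₃, p^k₄)` that does not depend on the size of
`p`. -/
def localCoeff (z : ℂ) (p : ℕ) (k : ℕ × ℕ × ℕ × ℕ) : ℂ :=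
  alpha χ₁ χ₂ (p ^ k.1) * alpha χ₁ χ₂ (p ^ k.2.1) * alpha χ₁ χ₂ (p ^ k.2.2.1) *
    alpha χ₁ χ₂ (p ^ k.2.2.2) *
    (localK χ₁ χ₂ p (1 - z) (k.1 + k.2.2.2 - min (k.1 + k.2.2.2) (k.2.1 + k.2.2.1)) *
      localK χ₁ χ₂ p (1 - z) (k.2.1 + k.2.2.1 - min (k.1 + k.2.2.2) (k.2.1 + k.2.2.1)))

/-- The local term of the Selberg sum at `(p^k₁, p^k₂, p^k₃, p^k₄)`. -/
def localTerm (z w₁ w₂ w₃ w₄ : ℂ) (p : ℕ) (k : ℕ × ℕ × ℕ × ℕ) : ℂ :=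
  localCoeff χ₁ χ₂ z p k * (p : ℂ) ^ (-localExponent z w₁ w₂ w₃ w₄ k)

/-- The box of exponents `[0, E]⁴`. -/
def exponentBox (E : ℕ) : Finset (ℕ × ℕ × ℕ × ℕ) :=
  Finset.range (E + 1) ×ˢ Finset.range (E + 1) ×ˢ Finset.range (E + 1) ×ˢ Finset.range (E + 1)

/-- The exponents that contribute at first order. -/
def mainExponents : Finset (ℕ × ℕ × ℕ × ℕ) :=
  {(0, 0, 0, 0), (1, 0, 0, 0), (0, 1, 0, 0), (0, 0, 1, 0), (0, 0, 0, 1),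
    (1, 1, 0, 0), (1, 0, 1, 0), (0, 1, 0, 1), (0, 0, 1, 1)}

/-- The first-order part of the local factor, for a general Dirichlet series `f` in place of
`p^{-s}`. -/
def firstOrder (f : ℂ → ℂ) (z w₁ w₂ w₃ w₄ : ℂ) : ℂ :=
  -(f (1 - z + w₁) + f (1 + w₂) + f (1 - z + w₃) + f (1 + w₄)) +
    (f (1 + w₁ + w₂) + f (1 - z + w₁ + w₃) + f (1 + z + w₂ + w₄) + f (1 + w₃ + w₄)) / 2

variable {χ₁ χ₂}

/-- Nonnegativity of c(p) is what the 3-4-1 inequality needs; taking the real part in the definition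
loses nothing, since quadratic characters have real values. -/
theorem primeCoeff_cases (hq₁ : χ₁.IsQuadratic) (hq₂ : χ₂.IsQuadratic) (p : ℕ) :
    0 ≤ primeCoeff χ₁ χ₂ p ∧ primeCoeff χ₁ χ₂ p ≤ 2 ∧
      (primeCoeff χ₁ χ₂ p : ℂ) = (χ₁ p + χ₂ p) ^ 2 / 2 := by
  have h : ∃ x : ℝ, 0 ≤ x ∧ x ≤ 2 ∧ (χ₁ p + χ₂ p) ^ 2 / 2 = (x : ℂ) := by
    rcases hq₁ p with h1 | h1 | h1 <;> rcases hq₂ p with h2 | h2 | h2 <;> rw [h1, h2]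
    · exact ⟨0, by norm_num, by norm_num, by norm_num⟩
    · exact ⟨1 / 2, by norm_num, by norm_num, by norm_num⟩
    · exact ⟨1 / 2, by norm_num, by norm_num, by norm_num⟩
    · exact ⟨1 / 2, by norm_num, by norm_num, by norm_num⟩
    · exact ⟨2, by norm_num, by norm_num, by norm_num⟩
    · exact ⟨0, by norm_num, by norm_num, by norm_num⟩
    · exact ⟨1 / 2, by norm_num, by norm_num, by norm_num⟩
    · exact ⟨0, by norm_num, by norm_num, by norm_num⟩
    · exact ⟨2, by norm_num, by norm_num, by norm_num⟩
  obtain ⟨x, h0, h2, hx⟩ := h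
  rw [primeCoeff, hx, Complex.ofReal_re]
  exact ⟨h0, h2, rfl⟩

/-- Let σ = Re z and let m be the minimum. Beyond the integer on the left, the real part contains
max(σ,0)(k₁+k₃) - σ(k₁+k₃-m) + δ(k₁+k₂+k₃+k₄). For σ ≥ 0 the first two terms leave σm ≥ 0; for σ < 0
the loss |σ|m ≤ δm is paid by δ(k₁+k₄). -/
theorem re_localExponent_ge {z : ℂ} {δ : ℝ} {w₁ w₂ w₃ w₄ : ℂ} (h : OnLines z δ w₁ w₂ w₃ w₄)
    (k : ℕ × ℕ × ℕ × ℕ) :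
    ((k.1 + k.2.1 + k.2.2.1 + k.2.2.2 - min (k.1 + k.2.2.2) (k.2.1 + k.2.2.1) : ℕ) : ℝ) ≤
      (localExponent z w₁ w₂ w₃ w₄ k).re := by
  obtain ⟨k₁, k₂, k₃, k₄⟩ := k
  simp only [localExponent]
  set m := min (k₁ + k₄) (k₂ + k₃) with hm
  have hm1 : m ≤ k₁ + k₄ := min_le_left _ _
  have hm2 : m ≤ k₂ + k₃ := min_le_right _ _
  have hmn : m ≤ k₁ + k₂ + k₃ + k₄ := by omega
  have hre : ((1 - z) * ((k₁ : ℂ) + k₃ - (m : ℕ))).re =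
      (1 - z.re) * ((k₁ : ℝ) + k₃ - m) := by
    have : ((k₁ : ℂ) + k₃ - (m : ℕ)) = (((k₁ : ℝ) + k₃ - m : ℝ) : ℂ) := by push_cast; ring
    rw [this, Complex.re_mul_ofReal]; simp
  rw [Nat.cast_sub hmn]
  simp only [Complex.add_re, hre, Complex.natCast_re, Complex.mul_re, Complex.natCast_im, zero_mul,
    sub_zero, h.re₁, h.re₂, h.re₃, h.re₄]
  push_cast
  have hm1' : (m : ℝ) ≤ k₁ + k₄ := by exact_mod_cast hm1
  have hm2' : (m : ℝ) ≤ k₂ + k₃ := by exact_mod_cast hm2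
  have hm0 : (0 : ℝ) ≤ m := Nat.cast_nonneg m
  have a1 : (0 : ℝ) ≤ k₁ := Nat.cast_nonneg _
  have a2 : (0 : ℝ) ≤ k₂ := Nat.cast_nonneg _
  have a3 : (0 : ℝ) ≤ k₃ := Nat.cast_nonneg _
  have a4 : (0 : ℝ) ≤ k₄ := Nat.cast_nonneg _
  have hδ := h.pos
  have hσ := h.le_re
  rcases le_total 0 z.re with h0 | h0
  · rw [max_eq_left h0]
    nlinarith [mul_nonneg h0 hm0, mul_nonneg hδ.le a1, mul_nonneg hδ.le a2, mul_nonneg hδ.le a3,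
      mul_nonneg hδ.le a4]
  · rw [max_eq_right h0]
    have b1 : -z.re * m ≤ δ * m := mul_le_mul_of_nonneg_right (by linarith) hm0
    have b2 : δ * m ≤ δ * (k₁ + k₄) := mul_le_mul_of_nonneg_left hm1' hδ.le
    nlinarith [mul_nonneg (neg_nonneg.mpr h0) a1, mul_nonneg (neg_nonneg.mpr h0) a3,
      mul_nonneg hδ.le a2, mul_nonneg hδ.le a3]

theorem norm_prime_cpow_neg_le {p : ℕ} (hp : p.Prime) {n : ℕ} {s : ℂ} (h : (n : ℝ) ≤ s.re) :
    ‖(p : ℂ) ^ (-s)‖ ≤ ((p : ℝ)⁻¹) ^ n := by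
  rw [Complex.norm_natCast_cpow_of_pos hp.pos, Complex.neg_re, inv_pow, ← Real.rpow_natCast,
    ← Real.rpow_neg (by positivity)]
  exact Real.rpow_le_rpow_of_exponent_le (by exact_mod_cast hp.one_le) (by linarith)

/-- The defect is at most 1 only for the zero exponent, the four unit vectors, and the four sums of
two unit vectors with one index in {1,4} and one in {2,3}. -/
theorem exponent_defect_ge_two {k : ℕ × ℕ × ℕ × ℕ} (hk : k ∉ mainExponents) :
    2 ≤ k.1 + k.2.1 + k.2.2.1 + k.2.2.2 - min (k.1 + k.2.2.2) (k.2.1 + k.2.2.1) := by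
  obtain ⟨k₁, k₂, k₃, k₄⟩ := k
  simp only [mainExponents, Finset.mem_insert, Finset.mem_singleton, Prod.mk.injEq, not_or] at hk
  dsimp only
  omega

theorem norm_localCoeff_le (hq₁ : χ₁.IsQuadratic) (hq₂ : χ₂.IsQuadratic) {z : ℂ} (hz : ‖z‖ ≤ 1 / 4)
    {p : ℕ} (hp : p.Prime) (k : ℕ × ℕ × ℕ × ℕ) :
    ‖localCoeff χ₁ χ₂ z p k‖ ≤ 250000 * (((k.1 : ℝ) + 1) ^ 3 * ((k.2.1 : ℝ) + 1) ^ 3 *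
      ((k.2.2.1 : ℝ) + 1) ^ 3 * ((k.2.2.2 : ℝ) + 1) ^ 3) := by
  obtain ⟨k₁, k₂, k₃, k₄⟩ := k
  have hs : 3 / 4 ≤ (1 - z).re := by
    have := (Complex.abs_re_le_norm z).trans hz
    rw [Complex.sub_re, Complex.one_re]; linarith [(abs_le.mp this).2]
  simp only [localCoeff]
  set m := min (k₁ + k₄) (k₂ + k₃) with hm
  have a1 : (0 : ℝ) ≤ k₁ := Nat.cast_nonneg _
  have a2 : (0 : ℝ) ≤ k₂ := Nat.cast_nonneg _
  have a3 : (0 : ℝ) ≤ k₃ := Nat.cast_nonneg _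
  have a4 : (0 : ℝ) ≤ k₄ := Nat.cast_nonneg _
  have hpair : ∀ x y : ℝ, 0 ≤ x → 0 ≤ y → x + y + 1 ≤ (x + 1) * (y + 1) := fun x y hx hy => by
    nlinarith [mul_nonneg hx hy]
  set P : ℝ := ((k₁ : ℝ) + 1) * (k₂ + 1) * (k₃ + 1) * (k₄ + 1) with hP
  have hP14 : ((k₁ : ℝ) + 1) * (k₄ + 1) * ((k₂ + 1) * (k₃ + 1)) = P := by rw [hP]; ring
  have g1 := norm_localK_le hq₁ hq₂ hp hs (k₁ + k₄ - m)
  have g2 := norm_localK_le hq₁ hq₂ hp hs (k₂ + k₃ - m)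
  have c1 : ((k₁ + k₄ - m : ℕ) : ℝ) + 1 ≤ (k₁ + 1) * (k₄ + 1) := by
    refine le_trans ?_ (hpair _ _ a1 a4)
    have : ((k₁ + k₄ - m : ℕ) : ℝ) ≤ (k₁ + k₄ : ℕ) := by exact_mod_cast Nat.sub_le _ _
    push_cast at this; linarith
  have c2 : ((k₂ + k₃ - m : ℕ) : ℝ) + 1 ≤ (k₂ + 1) * (k₃ + 1) := by
    refine le_trans ?_ (hpair _ _ a2 a3)
    have : ((k₂ + k₃ - m : ℕ) : ℝ) ≤ (k₂ + k₃ : ℕ) := by exact_mod_cast Nat.sub_le _ _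
    push_cast at this; linarith
  have e : ‖alpha χ₁ χ₂ (p ^ k₁) * alpha χ₁ χ₂ (p ^ k₂) * alpha χ₁ χ₂ (p ^ k₃) *
      alpha χ₁ χ₂ (p ^ k₄) * (localK χ₁ χ₂ p (1 - z) (k₁ + k₄ - m) *
        localK χ₁ χ₂ p (1 - z) (k₂ + k₃ - m))‖ ≤
      P * ((500 * ((k₁ + 1) * (k₄ + 1))) * (500 * ((k₂ + 1) * (k₃ + 1)))) := by
    rw [norm_mul, norm_mul, norm_mul, norm_mul, norm_mul]
    have := norm_alpha_prime_pow_le χ₁ χ₂ hp k₁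
    have := norm_alpha_prime_pow_le χ₁ χ₂ hp k₂
    have := norm_alpha_prime_pow_le χ₁ χ₂ hp k₃
    have := norm_alpha_prime_pow_le χ₁ χ₂ hp k₄
    rw [hP]
    gcongr
    · exact g1.trans (by gcongr)
    · exact g2.trans (by gcongr)
  refine e.trans ?_
  have hP1 : 1 ≤ P := by
    rw [hP]
    have := one_le_mul_of_one_le_of_one_le (one_le_mul_of_one_le_of_one_le
      (one_le_mul_of_one_le_of_one_le (by linarith : 1 ≤ (k₁ : ℝ) + 1) (by linarith : 1 ≤ (k₂ : ℝ) + 1))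
      (by linarith : 1 ≤ (k₃ : ℝ) + 1)) (by linarith : 1 ≤ (k₄ : ℝ) + 1)
    exact this
  calc _ = 250000 * P ^ 2 := by rw [← hP14]; ring
    _ ≤ 250000 * P ^ 3 := by
        have : P ^ 2 ≤ P ^ 3 := pow_le_pow_right₀ hP1 (by norm_num)
        linarith
    _ = _ := by rw [hP]; ring

theorem norm_localTerm_le_of_notMem (hq₁ : χ₁.IsQuadratic) (hq₂ : χ₂.IsQuadratic) {z : ℂ} {δ : ℝ}
    {w₁ w₂ w₃ w₄ : ℂ} (h : OnLines z δ w₁ w₂ w₃ w₄) {p : ℕ} (hp : p.Prime) {k : ℕ × ℕ × ℕ × ℕ}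
    (hk : k ∉ mainExponents) :
    ‖localTerm χ₁ χ₂ z w₁ w₂ w₃ w₄ p k‖ ≤ 1000000 * ((p : ℝ)⁻¹) ^ 2 *
      ((((k.1 : ℝ) + 1) ^ 3 * (3 / 4 : ℝ) ^ k.1) * ((((k.2.1 : ℝ) + 1) ^ 3 * (3 / 4 : ℝ) ^ k.2.1) *
      ((((k.2.2.1 : ℝ) + 1) ^ 3 * (3 / 4 : ℝ) ^ k.2.2.1) *
        (((k.2.2.2 : ℝ) + 1) ^ 3 * (3 / 4 : ℝ) ^ k.2.2.2)))) := by
  have h2 := exponent_defect_ge_two hk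
  have hE := norm_prime_cpow_neg_le hp (re_localExponent_ge h k)
  have hC := norm_localCoeff_le hq₁ hq₂ h.norm_le hp k
  rw [localTerm, norm_mul]
  obtain ⟨k₁, k₂, k₃, k₄⟩ := k
  dsimp only at *
  set j := k₁ + k₂ + k₃ + k₄ - min (k₁ + k₄) (k₂ + k₃) with hj
  -- The minimum is at most half the total. After p^(-2) is set aside, the remaining decay (1/2)^j ≤
  -- (9/16)^j is therefore shared among the four exponents as powers of 3/4.
  have hjn : k₁ + k₂ + k₃ + k₄ ≤ 2 * j := by omega
  have hp2 : (p : ℝ)⁻¹ ≤ 1 / 2 := by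
    rw [one_div]; exact inv_anti₀ (by norm_num) (by exact_mod_cast hp.two_le)
  have hpow : ((p : ℝ)⁻¹) ^ j ≤ 4 * ((p : ℝ)⁻¹) ^ 2 * (3 / 4 : ℝ) ^ (k₁ + k₂ + k₃ + k₄) := by
    obtain ⟨i, hi⟩ : ∃ i, j = 2 + i := ⟨j - 2, by omega⟩
    have b1 : ((p : ℝ)⁻¹) ^ i ≤ (1 / 2) ^ i := by gcongr
    have b2 : (1 / 2 : ℝ) ^ i = 4 * (1 / 2) ^ j := by rw [hi, pow_add]; ring
    have b3 : (1 / 2 : ℝ) ^ j ≤ (3 / 4 : ℝ) ^ (2 * j) := by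
      rw [pow_mul]; gcongr; norm_num
    have b4 : (3 / 4 : ℝ) ^ (2 * j) ≤ (3 / 4 : ℝ) ^ (k₁ + k₂ + k₃ + k₄) :=
      pow_le_pow_of_le_one (by norm_num) (by norm_num) hjn
    calc ((p : ℝ)⁻¹) ^ j = ((p : ℝ)⁻¹) ^ 2 * ((p : ℝ)⁻¹) ^ i := by rw [hi, pow_add]
      _ ≤ ((p : ℝ)⁻¹) ^ 2 * (4 * (3 / 4 : ℝ) ^ (k₁ + k₂ + k₃ + k₄)) := by
          gcongr; linarith
      _ = _ := by ring
  calc _ ≤ (250000 * (((k₁ : ℝ) + 1) ^ 3 * ((k₂ : ℝ) + 1) ^ 3 * ((k₃ : ℝ) + 1) ^ 3 *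
        ((k₄ : ℝ) + 1) ^ 3)) * (4 * ((p : ℝ)⁻¹) ^ 2 * (3 / 4 : ℝ) ^ (k₁ + k₂ + k₃ + k₄)) :=
        mul_le_mul hC (hE.trans hpow) (norm_nonneg _) (by positivity)
    _ = _ := by rw [pow_add, pow_add, pow_add]; ring

/-- The pair exponents match exactly: their K-factors are 1 and α(p)² = c(p)/2. For single exponents
α(p)r(p) = -c(p), and the only error is that of replacing K(p, 1-z) by r(p), of size
p^(-3/4)·p^(-1). -/
theorem sum_mainExponents_localTerm (hq₁ : χ₁.IsQuadratic) (hq₂ : χ₂.IsQuadratic) {z : ℂ} {δ : ℝ}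
    {w₁ w₂ w₃ w₄ : ℂ} (h : OnLines z δ w₁ w₂ w₃ w₄) {p : ℕ} (hp : p.Prime) :
    ‖∑ k ∈ mainExponents, localTerm χ₁ χ₂ z w₁ w₂ w₃ w₄ p k -
      (1 + primeCoeff χ₁ χ₂ p * firstOrder (fun s => (p : ℂ) ^ (-s)) z w₁ w₂ w₃ w₄)‖ ≤
      16000 * (p : ℝ) ^ (-(7 / 4) : ℝ) := by
  have hs : 3 / 4 ≤ (1 - z).re := by
    have := (Complex.abs_re_le_norm z).trans h.norm_le
    rw [Complex.sub_re, Complex.one_re]; linarith [(abs_le.mp this).2]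
  have hc := (primeCoeff_cases hq₁ hq₂ p).2.2
  have hK0 := localK_zero hq₁ hq₂ hp hs
  have hK1 := norm_localK_one_sub_le hq₁ hq₂ hp hs
  set κ := localK χ₁ χ₂ p (1 - z) 1 with hκ
  set r := χ₁ p + χ₂ p with hr
  have hα : alpha χ₁ χ₂ p = -r / 2 := alpha_prime χ₁ χ₂ hp
  have hr2 : ‖r‖ ≤ 2 := by
    refine (norm_add_le _ _).trans ?_
    have := χ₁.norm_le_one p
    have := χ₂.norm_le_one p
    linarith
  have hsum : ∑ k ∈ mainExponents, localTerm χ₁ χ₂ z w₁ w₂ w₃ w₄ p k -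
      (1 + primeCoeff χ₁ χ₂ p * firstOrder (fun s => (p : ℂ) ^ (-s)) z w₁ w₂ w₃ w₄) =
      (-r / 2) * (κ - r) * ((p : ℂ) ^ (-(1 - z + w₁)) + (p : ℂ) ^ (-(1 + w₂)) +
        (p : ℂ) ^ (-(1 - z + w₃)) + (p : ℂ) ^ (-(1 + w₄))) := by
    rw [mainExponents]
    repeat rw [Finset.sum_insert (by decide)]
    rw [Finset.sum_singleton]
    -- The exponents are put in the form in which `localExponent` produces them, so that the powers
    -- of p match.
    have x1 : (1 : ℂ) + z + w₂ + w₄ = (1 - z) * (-1) + 1 + 1 + (w₂ + w₄) := by ring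
    simp only [localTerm, localCoeff, localExponent, firstOrder, pow_zero, pow_one, alpha_one, hα, hc, ← hκ,
      hK0, add_zero, zero_add, Nat.min_self, Nat.sub_self, Nat.sub_zero, Nat.zero_min, Nat.min_zero,
      Nat.cast_zero, Nat.cast_one, mul_zero, zero_mul, mul_one, one_mul, sub_self, neg_zero,
      Complex.cpow_zero, sub_zero, zero_sub, x1]
    rw [show (1 : ℂ) + w₁ + w₂ = 1 + (w₁ + w₂) by ring, show (1 : ℂ) + w₃ + w₄ = 1 + (w₃ + w₄) by ring,
      show (1 - z : ℂ) + w₁ + w₃ = (1 - z) * (1 + 1 - 1) + (w₁ + w₃) by ring]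
    ring_nf
  have hexp : ∀ s : ℂ, 1 ≤ s.re → ‖(p : ℂ) ^ (-s)‖ ≤ (p : ℝ)⁻¹ := fun s hs => by
    simpa using norm_prime_cpow_neg_le hp (n := 1) (s := s) (by simpa)
  have hδ := h.pos
  have hm0 := le_max_left z.re 0
  have hm1 := le_max_right z.re 0
  have n1 := hexp (1 - z + w₁) (by simp [h.re₁]; linarith)
  have n2 := hexp (1 + w₂) (by simp [h.re₂]; linarith)
  have n3 := hexp (1 - z + w₃) (by simp [h.re₃]; linarith)
  have n4 := hexp (1 + w₄) (by simp [h.re₄]; linarith)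
  have hx : ‖(p : ℂ) ^ (-(1 - z))‖ ≤ (p : ℝ) ^ (-(3 / 4) : ℝ) := by
    rw [Complex.norm_natCast_cpow_of_pos hp.pos, Complex.neg_re]
    exact Real.rpow_le_rpow_of_exponent_le (by exact_mod_cast hp.one_le) (by linarith)
  rw [hsum, norm_mul, norm_mul]
  have m1 : ‖-r / 2‖ ≤ 1 := by
    rw [norm_div, norm_neg, Complex.norm_ofNat]; linarith
  have m2 : ‖κ - r‖ ≤ 4000 * (p : ℝ) ^ (-(3 / 4) : ℝ) := hK1.trans (by gcongr)
  have m3 : ‖(p : ℂ) ^ (-(1 - z + w₁)) + (p : ℂ) ^ (-(1 + w₂)) +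
        (p : ℂ) ^ (-(1 - z + w₃)) + (p : ℂ) ^ (-(1 + w₄))‖ ≤ 4 * (p : ℝ)⁻¹ :=
    (norm_add_le_of_le (norm_add₃_le.trans (add_le_add (add_le_add n1 n2) n3)) n4).trans (by linarith)
  have hp0 : (0 : ℝ) < p := by exact_mod_cast hp.pos
  calc _ ≤ 1 * (4000 * (p : ℝ) ^ (-(3 / 4) : ℝ)) * (4 * (p : ℝ)⁻¹) := by gcongr
    _ = 16000 * ((p : ℝ) ^ (-(3 / 4) : ℝ) * (p : ℝ) ^ (-1 : ℝ)) := by rw [Real.rpow_neg_one]; ring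
    _ = _ := by rw [← Real.rpow_add hp0]; norm_num

variable (χ₁ χ₂) in
/-- The local factor of the Selberg sum at `p`, truncated at exponents `≤ E`. -/
def localSum (z w₁ w₂ w₃ w₄ : ℂ) (p E : ℕ) : ℂ :=
  ∑ k ∈ exponentBox E, localTerm χ₁ χ₂ z w₁ w₂ w₃ w₄ p k

/-- Exponents outside `mainExponents` contribute O(p^(-2)) uniformly in E, by convergence of Σ
(j+1)³(3/4)^j; E ≥ 1 ensures that the main exponents lie in the box. -/
theorem exists_norm_localSum_sub_le (hq₁ : χ₁.IsQuadratic) (hq₂ : χ₂.IsQuadratic) :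
    ∃ C : ℝ, 0 < C ∧ ∀ (z : ℂ) (δ : ℝ) (w₁ w₂ w₃ w₄ : ℂ), OnLines z δ w₁ w₂ w₃ w₄ →
      ∀ p E : ℕ, p.Prime → 1 ≤ E →
      ‖localSum χ₁ χ₂ z w₁ w₂ w₃ w₄ p E -
        (1 + primeCoeff χ₁ χ₂ p * firstOrder (fun s => (p : ℂ) ^ (-s)) z w₁ w₂ w₃ w₄)‖ ≤
        C * (p : ℝ) ^ (-(7 / 4) : ℝ) := by
  set g : ℕ → ℝ := fun j => ((j : ℝ) + 1) ^ 3 * (3 / 4 : ℝ) ^ j with hg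
  have hg0 : ∀ j, 0 ≤ g j := fun j => by simp only [hg]; positivity
  have hgs : Summable g := by
    have h := summable_pow_mul_geometric_of_norm_lt_one 3 (r := (3 / 4 : ℝ)) (by norm_num)
    have h2 := ((summable_nat_add_iff 1).mpr h).mul_left (4 / 3)
    refine h2.congr fun j => ?_
    simp only [hg]; push_cast; rw [pow_succ]; ring
  set B := ∑' j, g j with hB
  have hB0 : 0 ≤ B := tsum_nonneg hg0
  refine ⟨16000 + 1000000 * B ^ 4, by positivity, fun z δ w₁ w₂ w₃ w₄ h p E hp hE => ?_⟩
  have hsub : mainExponents ⊆ exponentBox E := by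
    intro k hk
    have h1 : ∀ k ∈ mainExponents, k.1 ≤ 1 ∧ k.2.1 ≤ 1 ∧ k.2.2.1 ≤ 1 ∧ k.2.2.2 ≤ 1 := by decide
    obtain ⟨a, b, c, d⟩ := h1 k hk
    simp only [exponentBox, Finset.mem_product, Finset.mem_range]
    omega
  have hp0 : (0 : ℝ) < p := by exact_mod_cast hp.pos
  have herr : ‖∑ k ∈ exponentBox E \ mainExponents, localTerm χ₁ χ₂ z w₁ w₂ w₃ w₄ p k‖ ≤
      1000000 * B ^ 4 * (p : ℝ) ^ (-(7 / 4) : ℝ) := by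
    have h1 : ‖∑ k ∈ exponentBox E \ mainExponents, localTerm χ₁ χ₂ z w₁ w₂ w₃ w₄ p k‖ ≤
        ∑ k ∈ exponentBox E, 1000000 * ((p : ℝ)⁻¹) ^ 2 *
          (g k.1 * (g k.2.1 * (g k.2.2.1 * g k.2.2.2))) := by
      refine (norm_sum_le _ _).trans ?_
      refine (Finset.sum_le_sum fun k hk => norm_localTerm_le_of_notMem hq₁ hq₂ h hp
        (Finset.mem_sdiff.mp hk).2).trans ?_
      refine Finset.sum_le_sum_of_subset_of_nonneg Finset.sdiff_subset fun k _ _ => ?_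
      have := hg0 k.1; have := hg0 k.2.1; have := hg0 k.2.2.1; have := hg0 k.2.2.2
      positivity
    refine h1.trans ?_
    rw [← Finset.mul_sum, exponentBox, Finset.sum_product]
    have h2 : ∑ x ∈ Finset.range (E + 1), ∑ y ∈ Finset.range (E + 1) ×ˢ Finset.range (E + 1) ×ˢ
        Finset.range (E + 1), (g (x, y).1 * (g (x, y).2.1 * (g (x, y).2.2.1 * g (x, y).2.2.2))) =
        (∑ j ∈ Finset.range (E + 1), g j) ^ 4 := by
      simp only [Finset.sum_product, ← Finset.mul_sum, ← Finset.sum_mul]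
      ring
    rw [h2]
    have h3 : ∑ j ∈ Finset.range (E + 1), g j ≤ B := hgs.sum_le_tsum _ fun j _ => hg0 j
    have h4 : ((p : ℝ)⁻¹) ^ 2 ≤ (p : ℝ) ^ (-(7 / 4) : ℝ) := by
      rw [inv_pow, ← Real.rpow_natCast, ← Real.rpow_neg hp0.le]
      exact Real.rpow_le_rpow_of_exponent_le (by exact_mod_cast hp.one_le) (by norm_num)
    have h5 : (∑ j ∈ Finset.range (E + 1), g j) ^ 4 ≤ B ^ 4 := by
      gcongr
    calc _ ≤ 1000000 * (p : ℝ) ^ (-(7 / 4) : ℝ) * B ^ 4 := by gcongr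
      _ = _ := by ring
  have hmain := sum_mainExponents_localTerm hq₁ hq₂ h hp
  rw [localSum, ← Finset.sum_sdiff hsub, add_sub_assoc]
  refine (norm_add_le _ _).trans ((add_le_add herr hmain).trans (le_of_eq ?_))
  ring

end LocalSum

end SelbergSum

end

noncomputable section

/-! ### From local factors to a bound for the Euler product. -/

namespace SelbergSum
open Complex

section GlobalBound

variable {d₁ d₂ : ℕ} {χ₁ : DirichletCharacter ℂ d₁} {χ₂ : DirichletCharacter ℂ d₂}

/-- All Dirichlet series exponents of the first-order part have real part at least `1 + δ`. -/
theorem OnLines.exponents_re_ge {z : ℂ} {δ : ℝ} {w₁ w₂ w₃ w₄ : ℂ} (h : OnLines z δ w₁ w₂ w₃ w₄) :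
    (1 + δ ≤ (1 - z + w₁).re ∧ 1 + δ ≤ (1 + w₂).re ∧ 1 + δ ≤ (1 - z + w₃).re ∧
      1 + δ ≤ (1 + w₄).re) ∧
    1 + δ ≤ (1 + w₁ + w₂).re ∧ 1 + δ ≤ (1 - z + w₁ + w₃).re ∧ 1 + δ ≤ (1 + z + w₂ + w₄).re ∧
      1 + δ ≤ (1 + w₃ + w₄).re := by
  have h0 := le_max_left z.re 0
  have h1 := le_max_right z.re 0
  have := h.pos
  have := h.le_re
  simp only [add_re, sub_re, one_re, h.re₁, h.re₂, h.re₃, h.re₄]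
  refine ⟨⟨?_, ?_, ?_, ?_⟩, ?_, ?_, ?_, ?_⟩ <;> linarith

/-- Keeps all arguments in the strip Re s ≤ 5 where `exp_primeSum_bounds` applies. -/
theorem OnLines.exponents_re_le {z : ℂ} {δ : ℝ} {w₁ w₂ w₃ w₄ : ℂ} (h : OnLines z δ w₁ w₂ w₃ w₄)
    (hδ : δ ≤ 1) :
    ((1 - z + w₁).re ≤ 5 ∧ (1 + w₂).re ≤ 5 ∧ (1 - z + w₃).re ≤ 5 ∧ (1 + w₄).re ≤ 5) ∧
    (1 + w₁ + w₂).re ≤ 5 ∧ (1 - z + w₁ + w₃).re ≤ 5 ∧ (1 + z + w₂ + w₄).re ≤ 5 ∧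
      (1 + w₃ + w₄).re ≤ 5 := by
  have hz := abs_le.mp ((Complex.abs_re_le_norm z).trans h.norm_le)
  have h0 : max z.re 0 ≤ 1 / 4 := max_le hz.2 (by norm_num)
  simp only [add_re, sub_re, one_re, h.re₁, h.re₂, h.re₃, h.re₄]
  refine ⟨⟨?_, ?_, ?_, ?_⟩, ?_, ?_, ?_, ?_⟩ <;> linarith [hz.1, hz.2]

theorem norm_firstOrder_le {f : ℂ → ℂ} {z w₁ w₂ w₃ w₄ : ℂ} {δ M : ℝ} (h : OnLines z δ w₁ w₂ w₃ w₄)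
    (hf : ∀ s : ℂ, 1 + δ ≤ s.re → ‖f s‖ ≤ M) : ‖firstOrder f z w₁ w₂ w₃ w₄‖ ≤ 6 * M := by
  obtain ⟨⟨a1, a2, a3, a4⟩, b1, b2, b3, b4⟩ := h.exponents_re_ge
  have h1 : ∀ a b c d : ℂ, ‖a‖ ≤ M → ‖b‖ ≤ M → ‖c‖ ≤ M → ‖d‖ ≤ M → ‖a + b + c + d‖ ≤ 4 * M := by
    intro a b c d ha hb hc hd
    exact (norm_add_le_of_le (norm_add₃_le.trans (add_le_add (add_le_add ha hb) hc)) hd).trans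
      (by linarith)
  rw [firstOrder]
  refine (norm_add_le _ _).trans ?_
  rw [norm_neg, norm_div, Complex.norm_ofNat]
  have := h1 _ _ _ _ (hf _ a1) (hf _ a2) (hf _ a3) (hf _ a4)
  have := h1 _ _ _ _ (hf _ b1) (hf _ b2) (hf _ b3) (hf _ b4)
  linarith

/-- Only an upper bound is needed, so a vanishing local factor does no harm. With y the first-order
term, |1+y| ≤ e^(Re y) + |y|²e^|y| and |y| ≤ 12/p ≤ 6. The additive errors become multiplicative
because e^(Re y) ≥ e^(-6). -/
theorem exists_norm_localSum_le_exp (hq₁ : χ₁.IsQuadratic) (hq₂ : χ₂.IsQuadratic) :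
    ∃ C : ℝ, 0 < C ∧ ∀ (z : ℂ) (δ : ℝ) (w₁ w₂ w₃ w₄ : ℂ), OnLines z δ w₁ w₂ w₃ w₄ →
      ∀ p E : ℕ, p.Prime → 1 ≤ E →
      ‖localSum χ₁ χ₂ z w₁ w₂ w₃ w₄ p E‖ ≤ Real.exp
        ((primeCoeff χ₁ χ₂ p * firstOrder (fun s => (p : ℂ) ^ (-s)) z w₁ w₂ w₃ w₄).re +
        C * (p : ℝ) ^ (-(7 / 4) : ℝ)) := by
  obtain ⟨C, hC, h⟩ := exists_norm_localSum_sub_le hq₁ hq₂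
  refine ⟨Real.exp 6 * (144 * Real.exp 6 + C), by positivity, fun z δ w₁ w₂ w₃ w₄ hw p E hp hE => ?_⟩
  have hloc := h z δ w₁ w₂ w₃ w₄ hw p E hp hE
  set y : ℂ := primeCoeff χ₁ χ₂ p * firstOrder (fun s => (p : ℂ) ^ (-s)) z w₁ w₂ w₃ w₄ with hy
  set u : ℝ := (p : ℝ) ^ (-(7 / 4) : ℝ) with hu
  have hp0 : (0 : ℝ) < p := by exact_mod_cast hp.pos
  have hp2 : (p : ℝ)⁻¹ ≤ 1 / 2 := by
    rw [one_div]; exact inv_anti₀ (by norm_num) (by exact_mod_cast hp.two_le)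
  have hu0 : 0 < u := by positivity
  have hyn : ‖y‖ ≤ 12 * (p : ℝ)⁻¹ := by
    have h1 : ‖firstOrder (fun s => (p : ℂ) ^ (-s)) z w₁ w₂ w₃ w₄‖ ≤ 6 * (p : ℝ)⁻¹ := by
      refine norm_firstOrder_le hw fun s hs => ?_
      simpa using norm_prime_cpow_neg_le hp (n := 1) (s := s) (by have := hw.pos; simp; linarith)
    obtain ⟨c0, c2, -⟩ := primeCoeff_cases hq₁ hq₂ p
    rw [hy, norm_mul, Complex.norm_real, Real.norm_of_nonneg c0]
    calc _ ≤ 2 * (6 * (p : ℝ)⁻¹) := by gcongr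
      _ = _ := by ring
  have hy6 : ‖y‖ ≤ 6 := by linarith
  have hsq : ((p : ℝ)⁻¹) ^ 2 ≤ u := by
    rw [hu, inv_pow, ← Real.rpow_natCast, ← Real.rpow_neg hp0.le]
    exact Real.rpow_le_rpow_of_exponent_le (by exact_mod_cast hp.one_le) (by norm_num)
  have hexp : ‖1 + y‖ ≤ Real.exp y.re + 144 * Real.exp 6 * u := by
    have h1 := Complex.norm_exp_sub_sum_le_norm_mul_exp y 2
    simp only [Finset.sum_range_succ, Finset.range_zero, Finset.sum_empty, pow_zero,
      Nat.factorial, Nat.cast_one, div_one, pow_one, zero_add, mul_one] at h1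
    have h2 : ‖y‖ ^ 2 * Real.exp ‖y‖ ≤ 144 * Real.exp 6 * u := by
      have h3 : ‖y‖ ^ 2 ≤ 144 * u := by
        calc ‖y‖ ^ 2 ≤ (12 * (p : ℝ)⁻¹) ^ 2 := by gcongr
          _ = 144 * ((p : ℝ)⁻¹) ^ 2 := by ring
          _ ≤ _ := by gcongr
      calc _ ≤ (144 * u) * Real.exp 6 := by gcongr
        _ = _ := by ring
    have h4 : ‖1 + y‖ ≤ ‖Complex.exp y‖ + ‖Complex.exp y - (1 + y)‖ := by
      have := norm_sub_le (Complex.exp y) (Complex.exp y - (1 + y))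
      simpa using this
    rw [Complex.norm_exp] at h4
    linarith
  have h5 : ‖localSum χ₁ χ₂ z w₁ w₂ w₃ w₄ p E‖ ≤
      Real.exp y.re + (144 * Real.exp 6 + C) * u := by
    have h6 : ‖localSum χ₁ χ₂ z w₁ w₂ w₃ w₄ p E‖ ≤
        ‖localSum χ₁ χ₂ z w₁ w₂ w₃ w₄ p E - (1 + y)‖ + ‖1 + y‖ := by
      simpa using norm_add_le (localSum χ₁ χ₂ z w₁ w₂ w₃ w₄ p E - (1 + y)) (1 + y)
    linarith
  refine h5.trans ?_
  rw [Real.exp_add]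
  have h7 : 1 ≤ Real.exp y.re * Real.exp 6 := by
    rw [← Real.exp_add, Real.one_le_exp_iff]
    have := (abs_le.mp ((Complex.abs_re_le_norm y).trans hy6)).1
    linarith
  have h8 := Real.add_one_le_exp (Real.exp 6 * (144 * Real.exp 6 + C) * u)
  have h9 : 0 ≤ (144 * Real.exp 6 + C) * u := by positivity
  calc Real.exp y.re + (144 * Real.exp 6 + C) * u
      ≤ Real.exp y.re + Real.exp y.re * Real.exp 6 * ((144 * Real.exp 6 + C) * u) := by
        nlinarith
    _ = Real.exp y.re * (Real.exp 6 * (144 * Real.exp 6 + C) * u + 1) := by ring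
    _ ≤ _ := by gcongr

/-- `firstOrder` is linear in f, so the local exponents add up to `firstOrder` of the prime sum, and
the errors p^(-7/4) are summable. -/
theorem exists_norm_prod_localSum_le (hq₁ : χ₁.IsQuadratic) (hq₂ : χ₂.IsQuadratic) :
    ∃ C : ℝ, 0 < C ∧ ∀ (z : ℂ) (δ : ℝ) (w₁ w₂ w₃ w₄ : ℂ), OnLines z δ w₁ w₂ w₃ w₄ →
      ∀ N E : ℕ, 1 ≤ E →
      ‖∏ p ∈ N.primesBelow, localSum χ₁ χ₂ z w₁ w₂ w₃ w₄ p E‖ ≤ C * Real.exp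
        (firstOrder (fun s => ∑ p ∈ N.primesBelow, (primeCoeff χ₁ χ₂ p : ℂ) * (p : ℂ) ^ (-s))
          z w₁ w₂ w₃ w₄).re := by
  obtain ⟨C, hC, h⟩ := exists_norm_localSum_le_exp hq₁ hq₂
  have hsum : Summable fun p : ℕ => (p : ℝ) ^ (-(7 / 4) : ℝ) :=
    Real.summable_nat_rpow.mpr (by norm_num)
  refine ⟨Real.exp (C * ∑' p : ℕ, (p : ℝ) ^ (-(7 / 4) : ℝ)), Real.exp_pos _,
    fun z δ w₁ w₂ w₃ w₄ hw N E hE => ?_⟩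
  have hlin : firstOrder (fun s => ∑ p ∈ N.primesBelow, (primeCoeff χ₁ χ₂ p : ℂ) * (p : ℂ) ^ (-s))
      z w₁ w₂ w₃ w₄ = ∑ p ∈ N.primesBelow,
        (primeCoeff χ₁ χ₂ p : ℂ) * firstOrder (fun s => (p : ℂ) ^ (-s)) z w₁ w₂ w₃ w₄ := by
    simp only [firstOrder]
    rw [← Finset.sum_add_distrib, ← Finset.sum_add_distrib, ← Finset.sum_add_distrib,
      ← Finset.sum_add_distrib, ← Finset.sum_add_distrib, ← Finset.sum_add_distrib,
      Finset.sum_div, ← Finset.sum_neg_distrib, ← Finset.sum_add_distrib]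
    refine Finset.sum_congr rfl fun p _ => ?_
    ring
  rw [norm_prod, hlin, ← Real.exp_add, Complex.re_sum]
  refine (Finset.prod_le_prod (fun _ _ => norm_nonneg _) fun p hp =>
    h z δ w₁ w₂ w₃ w₄ hw p E (Nat.prime_of_mem_primesBelow hp) hE).trans ?_
  rw [← Real.exp_sum, Real.exp_le_exp, Finset.sum_add_distrib, ← Finset.mul_sum, add_comm]
  gcongr
  exact hsum.sum_le_tsum _ fun _ _ => by positivity

/-- N₀ depends on δ, hence later on X, but the discrepancy is bounded by 1 in all cases, so the
final constant does not depend on X. -/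
theorem exists_primeSum_tail_le {c : ℕ → ℝ} (h0 : ∀ p, 0 ≤ c p) (h2 : ∀ p, c p ≤ 2) {δ : ℝ}
    (hδ : 0 < δ) : ∃ N₀ : ℕ, ∀ N ≥ N₀, ∀ s : ℂ, 1 + δ ≤ s.re →
      ‖(∑ p ∈ N.primesBelow, (c p : ℂ) * (p : ℂ) ^ (-s)) - primeSum c s‖ ≤ 1 := by
  set f : Nat.Primes → ℝ := fun p => 2 * (p : ℝ) ^ (-(1 + δ)) with hf
  have hfs : Summable f := (summable_primes_rpow (by linarith)).mul_left 2
  have htail := tendsto_tsum_compl_atTop_zero f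
  obtain ⟨F, hF⟩ := Filter.eventually_atTop.mp (htail.eventually_lt_const (show (0 : ℝ) < 1 by norm_num))
  refine ⟨F.sup (fun p => (p : ℕ) + 1), fun N hN s hs => ?_⟩
  set G : Finset Nat.Primes := (Finset.range N).subtype Nat.Prime with hG
  have hFG : F ≤ G := by
    intro p hp
    refine Finset.mem_subtype.mpr (Finset.mem_range.mpr ?_)
    have : (p : ℕ) + 1 ≤ F.sup (fun p => (p : ℕ) + 1) :=
      Finset.le_sup (f := fun p : Nat.Primes => (p : ℕ) + 1) hp
    omega
  have hcs := summable_primeSum h0 h2 (s := s) (by linarith)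
  have hsplit := hcs.sum_add_tsum_compl (s := G)
  have hsumG : ∑ p ∈ G, (c p : ℂ) * (p : ℂ) ^ (-s) =
      ∑ p ∈ N.primesBelow, (c p : ℂ) * (p : ℂ) ^ (-s) := by
    rw [hG, Nat.primesBelow]
    exact Finset.sum_subtype_eq_sum_filter (s := Finset.range N) (p := Nat.Prime)
      (fun p : ℕ => (c p : ℂ) * (p : ℂ) ^ (-s))
  rw [← hsumG, primeSum, ← hsplit, sub_add_cancel_left, norm_neg]
  have hb : ∀ p : Nat.Primes, ‖(c p : ℂ) * (p : ℂ) ^ (-s)‖ ≤ f p := fun p => by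
    rw [norm_mul, norm_primes_cpow, Complex.norm_real, Real.norm_of_nonneg (h0 _), hf]
    have : (p : ℝ) ^ (-s.re) ≤ (p : ℝ) ^ (-(1 + δ)) :=
      Real.rpow_le_rpow_of_exponent_le (by exact_mod_cast p.prop.one_le) (by linarith)
    dsimp only
    have := h2 p
    gcongr
  have hfsub : Summable fun p : {p // p ∉ G} => f p := hfs.subtype _
  exact (tsum_of_norm_bounded hfsub.hasSum fun p => hb p).trans (hF G hFG).le

/-- The factor majorising `exp (-Re ∑ c(p) p^{-1-u})`. -/
def lowerFactor (u : ℂ) : ℝ := ‖u‖ * (1 + |u.im|) ^ (-(7 / 8) : ℝ)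

/-- The factor majorising `exp (Re ∑ c(p) p^{-1-u})`. -/
def upperFactor (u : ℂ) : ℝ := (1 + |u.im|) ^ (9 / 8 : ℝ) / ‖u‖

theorem lowerFactor_nonneg (u : ℂ) : 0 ≤ lowerFactor u := by
  have := abs_nonneg u.im
  rw [lowerFactor]; positivity

theorem upperFactor_nonneg (u : ℂ) : 0 ≤ upperFactor u := by
  have := abs_nonneg u.im
  rw [upperFactor]; positivity

/-- Each term -f of `firstOrder` becomes a full inverse factor and each term f/2 a square root. The
inequality √(ab) ≤ a + b then trades the four square roots for two products in each of which every
wᵢ occurs once, so that the fourfold integral will split into planar ones. -/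
theorem exists_norm_prod_localSum_le_factors {D : ℕ} [NeZero D] {χ : DirichletCharacter ℂ D}
    (hχ : χ ≠ 1) (hq₁ : χ₁.IsQuadratic) (hq₂ : χ₂.IsQuadratic)
    (hc : ∀ p : ℕ, p.Prime → ¬ p ∣ D → (primeCoeff χ₁ χ₂ p : ℂ) = 1 + χ p) :
    ∃ C : ℝ, 0 < C ∧ ∀ δ : ℝ, 0 < δ → δ ≤ 1 → ∃ N₀ : ℕ, ∀ N ≥ N₀, ∀ E : ℕ, 1 ≤ E →
      ∀ z w₁ w₂ w₃ w₄ : ℂ, OnLines z δ w₁ w₂ w₃ w₄ →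
      ‖∏ p ∈ N.primesBelow, localSum χ₁ χ₂ z w₁ w₂ w₃ w₄ p E‖ ≤
        C * ((lowerFactor (w₁ - z) * lowerFactor w₂ * lowerFactor (w₃ - z) * lowerFactor w₄) *
          (upperFactor (w₁ + w₂) * upperFactor (w₃ + w₄) +
            upperFactor (w₁ + w₃ - z) * upperFactor (w₂ + w₄ + z))) := by
  have h0 : ∀ p, 0 ≤ primeCoeff χ₁ χ₂ p := fun p => (primeCoeff_cases hq₁ hq₂ p).1
  have h2 : ∀ p, primeCoeff χ₁ χ₂ p ≤ 2 := fun p => (primeCoeff_cases hq₁ hq₂ p).2.1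
  obtain ⟨C, hC, hprod⟩ := exists_norm_prod_localSum_le (χ₁ := χ₁) (χ₂ := χ₂) hq₁ hq₂
  obtain ⟨K, hK, hbd⟩ := exp_primeSum_bounds hχ h0 h2 hc
  refine ⟨C * Real.exp 6 * (K ^ 4 * K ^ 2), by positivity, fun δ hδ hδ1 => ?_⟩
  obtain ⟨N₀, hN₀⟩ := exists_primeSum_tail_le h0 h2 hδ
  refine ⟨N₀, fun N hN E hE z w₁ w₂ w₃ w₄ hw => ?_⟩
  set A := primeSum (primeCoeff χ₁ χ₂) with hA
  set AN : ℂ → ℂ := fun s => ∑ p ∈ N.primesBelow, (primeCoeff χ₁ χ₂ p : ℂ) * (p : ℂ) ^ (-s) with hAN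
  have hcmp : (firstOrder AN z w₁ w₂ w₃ w₄).re ≤ (firstOrder A z w₁ w₂ w₃ w₄).re + 6 := by
    have e : firstOrder AN z w₁ w₂ w₃ w₄ = firstOrder A z w₁ w₂ w₃ w₄ +
        firstOrder (fun s => AN s - A s) z w₁ w₂ w₃ w₄ := by
      simp only [firstOrder]; ring
    have h3 := norm_firstOrder_le (f := fun s => AN s - A s) (M := 1) hw fun s hs => hN₀ N hN s hs
    have h4 := (Complex.re_le_norm _).trans h3
    rw [e, Complex.add_re]; linarith
  have hδ' := hw.pos
  obtain ⟨⟨a1, a2, a3, a4⟩, b1, b2, b3, b4⟩ := hw.exponents_re_ge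
  obtain ⟨⟨a1', a2', a3', a4'⟩, b1', b2', b3', b4'⟩ := hw.exponents_re_le hδ1
  have hL : ∀ s u : ℂ, s = 1 + u → 1 + δ ≤ s.re → s.re ≤ 5 →
      Real.exp (-(A s).re) ≤ K * lowerFactor u ∧ Real.exp (A s).re ≤ K * upperFactor u := by
    rintro s u rfl h1 h5
    obtain ⟨x, y⟩ := hbd (1 + u) (by linarith) h5
    simp only [add_sub_cancel_left, add_im, one_im, zero_add] at x y
    exact ⟨y, x⟩
  have l1 := (hL _ (w₁ - z) (by ring) a1 a1').1
  have l2 := (hL _ w₂ (by ring) a2 a2').1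
  have l3 := (hL _ (w₃ - z) (by ring) a3 a3').1
  have l4 := (hL _ w₄ (by ring) a4 a4').1
  have u1 := (hL _ (w₁ + w₂) (by ring) b1 b1').2
  have u2 := (hL _ (w₁ + w₃ - z) (by ring) b2 b2').2
  have u3 := (hL _ (w₂ + w₄ + z) (by ring) b3 b3').2
  have u4 := (hL _ (w₃ + w₄) (by ring) b4 b4').2
  have nn := lowerFactor_nonneg
  have un := upperFactor_nonneg
  have e : Real.exp (firstOrder A z w₁ w₂ w₃ w₄).re =
      (Real.exp (-(A (1 - z + w₁)).re) * Real.exp (-(A (1 + w₂)).re) *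
        Real.exp (-(A (1 - z + w₃)).re) * Real.exp (-(A (1 + w₄)).re)) *
      Real.exp (((A (1 + w₁ + w₂)).re + (A (1 + w₃ + w₄)).re) / 2 +
        ((A (1 - z + w₁ + w₃)).re + (A (1 + z + w₂ + w₄)).re) / 2) := by
    rw [← Real.exp_add, ← Real.exp_add, ← Real.exp_add, ← Real.exp_add, firstOrder]
    congr 1
    rw [Complex.add_re, Complex.neg_re, Complex.div_ofNat_re]
    simp only [Complex.add_re]
    ring
  have hamgm : ∀ x y : ℝ, Real.exp (x / 2 + y / 2) ≤ Real.exp x + Real.exp y := by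
    intro x y
    rcases le_total x y with h | h
    · have : Real.exp (x / 2 + y / 2) ≤ Real.exp y := Real.exp_le_exp.mpr (by linarith)
      linarith [Real.exp_pos x]
    · have : Real.exp (x / 2 + y / 2) ≤ Real.exp x := Real.exp_le_exp.mpr (by linarith)
      linarith [Real.exp_pos y]
  have hup : Real.exp (((A (1 + w₁ + w₂)).re + (A (1 + w₃ + w₄)).re) / 2 +
        ((A (1 - z + w₁ + w₃)).re + (A (1 + z + w₂ + w₄)).re) / 2) ≤
      K ^ 2 * (upperFactor (w₁ + w₂) * upperFactor (w₃ + w₄) +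
            upperFactor (w₁ + w₃ - z) * upperFactor (w₂ + w₄ + z)) := by
    refine (hamgm _ _).trans ?_
    rw [Real.exp_add, Real.exp_add]
    have x1 := mul_le_mul u1 u4 (Real.exp_pos _).le (mul_nonneg hK.le (un _))
    have x2 := mul_le_mul u2 u3 (Real.exp_pos _).le (mul_nonneg hK.le (un _))
    refine (add_le_add x1 x2).trans (le_of_eq ?_)
    ring
  have hlow : Real.exp (-(A (1 - z + w₁)).re) * Real.exp (-(A (1 + w₂)).re) *
        Real.exp (-(A (1 - z + w₃)).re) * Real.exp (-(A (1 + w₄)).re) ≤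
      K ^ 4 * (lowerFactor (w₁ - z) * lowerFactor w₂ * lowerFactor (w₃ - z) * lowerFactor w₄) := by
    have n1 := mul_nonneg hK.le (nn (w₁ - z))
    have n2 := mul_nonneg hK.le (nn w₂)
    have n3 := mul_nonneg hK.le (nn (w₃ - z))
    calc _ ≤ (K * lowerFactor (w₁ - z)) * (K * lowerFactor w₂) * (K * lowerFactor (w₃ - z)) *
          (K * lowerFactor w₄) := by gcongr
      _ = _ := by ring
  have hnl : 0 ≤ lowerFactor (w₁ - z) * lowerFactor w₂ * lowerFactor (w₃ - z) * lowerFactor w₄ :=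
    mul_nonneg (mul_nonneg (mul_nonneg (nn _) (nn _)) (nn _)) (nn _)
  calc _ ≤ C * Real.exp (firstOrder AN z w₁ w₂ w₃ w₄).re := hprod z δ w₁ w₂ w₃ w₄ hw N E hE
    _ ≤ C * Real.exp ((firstOrder A z w₁ w₂ w₃ w₄).re + 6) := by gcongr
    _ = C * Real.exp 6 * Real.exp (firstOrder A z w₁ w₂ w₃ w₄).re := by rw [Real.exp_add]; ring
    _ ≤ C * Real.exp 6 * ((K ^ 4 * (lowerFactor (w₁ - z) * lowerFactor w₂ * lowerFactor (w₃ - z) *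
          lowerFactor w₄)) * (K ^ 2 * (upperFactor (w₁ + w₂) * upperFactor (w₃ + w₄) +
            upperFactor (w₁ + w₃ - z) * upperFactor (w₂ + w₄ + z)))) := by
        rw [e]
        gcongr
    _ = _ := by ring

end GlobalBound

end SelbergSum

end

noncomputable section

/-! ### Euler factorisation and the fourfold Mellin integral. -/

namespace SelbergSum
open Complex MeasureTheory

section EulerIdentity

theorem factorization_prod_primes_pow {P : Finset ℕ} (hP : ∀ p ∈ P, p.Prime) (h : ℕ → ℕ) (q : ℕ) :
    (∏ p ∈ P, p ^ h p).factorization q = if q ∈ P then h q else 0 := by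
  rw [Nat.factorization_prod fun p hp => pow_ne_zero _ (hP p hp).ne_zero, Finsupp.finsetSum_apply]
  have : ∀ p ∈ P, (p ^ h p).factorization q = if q = p then h q else 0 := by
    intro p hp
    rw [(hP p hp).factorization_pow, Finsupp.single_apply]
    by_cases hpq : p = q
    · simp [hpq]
    · rw [if_neg hpq, if_neg (Ne.symm hpq)]
  rw [Finset.sum_congr rfl this, Finset.sum_ite_eq]

theorem prod_primes_pow_ne_zero {P : Finset ℕ} (hP : ∀ p ∈ P, p.Prime) (h : ℕ → ℕ) :
    ∏ p ∈ P, p ^ h p ≠ 0 :=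
  Finset.prod_ne_zero_iff.mpr fun p hp => pow_ne_zero _ (hP p hp).ne_zero

theorem mem_divisors_prod_primes_pow {P : Finset ℕ} (hP : ∀ p ∈ P, p.Prime) (E ν : ℕ) :
    ν ∈ (∏ p ∈ P, p ^ E).divisors ↔
      ν ≠ 0 ∧ ν.primeFactors ⊆ P ∧ ∀ p ∈ P, ν.factorization p ≤ E := by
  have hM : ∏ p ∈ P, p ^ E ≠ 0 := prod_primes_pow_ne_zero hP fun _ => E
  have hfac := factorization_prod_primes_pow hP fun _ => E
  constructor
  · intro h
    obtain ⟨hd, -⟩ := Nat.mem_divisors.mp h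
    have hν : ν ≠ 0 := ne_zero_of_dvd_ne_zero hM hd
    have hle := (Nat.factorization_le_iff_dvd hν hM).mpr hd
    refine ⟨hν, fun p hp => ?_, fun p hp => ?_⟩
    · have h1 := hle p
      rw [hfac] at h1
      by_contra hpP
      rw [if_neg hpP] at h1
      have : p ∈ ν.factorization.support := by rwa [Nat.support_factorization]
      exact (Finsupp.mem_support_iff.mp this) (Nat.le_zero.mp h1)
    · have h1 := hle p
      rwa [hfac, if_pos hp] at h1
  · rintro ⟨hν, hs, hE⟩
    refine Nat.mem_divisors.mpr ⟨(Nat.factorization_le_iff_dvd hν hM).mp fun p => ?_, hM⟩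
    rw [hfac]
    split_ifs with hp
    · exact hE p hp
    · rw [Finsupp.notMem_support_iff.mp fun h => hp (hs (by rwa [Nat.support_factorization] at h))]

/-- A function with `f 1 = 1` that is multiplicative is the product of its values at prime powers,
over any set of primes containing the prime factors. -/
theorem eq_prod_prime_pow {f : ℕ → ℂ} (hf : ∀ x y : ℕ, x.Coprime y → f (x * y) = f x * f y)
    (h1 : f 1 = 1) {P : Finset ℕ} {ν : ℕ} (hν : ν ≠ 0) (hs : ν.primeFactors ⊆ P) :
    f ν = ∏ p ∈ P, f (p ^ ν.factorization p) := by
  rw [Nat.multiplicative_factorization f hf h1 hν]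
  exact Finsupp.prod_of_support_subset _ (by rwa [Nat.support_factorization]) _ (by simp [h1])

theorem natCast_cpow_eq_prod {P : Finset ℕ} {ν : ℕ} (hν : ν ≠ 0) (hs : ν.primeFactors ⊆ P) (s : ℂ) :
    (ν : ℂ) ^ s = ∏ p ∈ P, (p : ℂ) ^ ((ν.factorization p : ℂ) * s) := by
  rw [eq_prod_prime_pow (f := fun n => (n : ℂ) ^ s) (fun x y _ => by
    push_cast; exact Complex.natCast_mul_natCast_cpow x y s) (by simp) hν hs]
  refine Finset.prod_congr rfl fun p _ => ?_
  push_cast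
  rw [← Complex.natCast_cpow_natCast_mul]

/-- Euler factorisation of a finite sum over quadruples of divisors. -/
theorem sum_divisors_eq_prod_sum {P : Finset ℕ} (hP : ∀ p ∈ P, p.Prime) (E : ℕ)
    (g : ℕ → ℕ × ℕ × ℕ × ℕ → ℂ) :
    ∑ ν ∈ (∏ p ∈ P, p ^ E).divisors ×ˢ (∏ p ∈ P, p ^ E).divisors ×ˢ
        (∏ p ∈ P, p ^ E).divisors ×ˢ (∏ p ∈ P, p ^ E).divisors,
      ∏ p ∈ P, g p (ν.1.factorization p, ν.2.1.factorization p, ν.2.2.1.factorization p,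
        ν.2.2.2.factorization p) =
    ∏ p ∈ P, ∑ k ∈ exponentBox E, g p k := by
  rw [Finset.prod_sum]
  -- Expanding the product of sums indexes the terms by dependent functions on P. A coordinate of
  -- such a function is extended by zero to ℕ, so that it can serve as an exponent function for a
  -- divisor.
  set H : ((a : ℕ) → a ∈ P → ℕ × ℕ × ℕ × ℕ) → (ℕ × ℕ × ℕ × ℕ → ℕ) → ℕ → ℕ :=
    fun e π p => if hp : p ∈ P then π (e p hp) else 0 with hH
  have hH' : ∀ e π p (hp : p ∈ P), H e π p = π (e p hp) := fun e π p hp => by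
    simp only [hH, dif_pos hp]
  have hself : ∀ ν : ℕ, ν ∈ (∏ p ∈ P, p ^ E).divisors → ∏ p ∈ P, p ^ ν.factorization p = ν := by
    intro ν hν
    obtain ⟨h0, hs, -⟩ := (mem_divisors_prod_primes_pow hP E ν).mp hν
    have h1 := Nat.prod_factorization_pow_eq_self h0
    conv_rhs => rw [← h1]
    exact (Finsupp.prod_of_support_subset _ (by rwa [Nat.support_factorization]) _ (by simp)).symm
  have hmem : ∀ (e : (a : ℕ) → a ∈ P → ℕ × ℕ × ℕ × ℕ) (π : ℕ × ℕ × ℕ × ℕ → ℕ),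
      (∀ p hp, π (e p hp) ≤ E) → ∏ p ∈ P, p ^ H e π p ∈ (∏ p ∈ P, p ^ E).divisors := by
    intro e π he
    refine Nat.mem_divisors.mpr ⟨Finset.prod_dvd_prod_of_dvd _ _ fun p hp => pow_dvd_pow _ ?_,
      prod_primes_pow_ne_zero hP fun _ => E⟩
    rw [hH' e π p hp]
    exact he p hp
  have hfac : ∀ (e : (a : ℕ) → a ∈ P → ℕ × ℕ × ℕ × ℕ) (π : ℕ × ℕ × ℕ × ℕ → ℕ) (p : ℕ) (hp : p ∈ P),
      (∏ p ∈ P, p ^ H e π p).factorization p = π (e p hp) := by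
    intro e π p hp
    rw [factorization_prod_primes_pow hP, if_pos hp, hH' e π p hp]
  have hle : ∀ ν : ℕ, ν ∈ (∏ p ∈ P, p ^ E).divisors → ∀ p ∈ P, ν.factorization p ≤ E :=
    fun ν hν => ((mem_divisors_prod_primes_pow hP E ν).mp hν).2.2
  clear_value H
  generalize (∏ p ∈ P, p ^ E).divisors = B at *
  set i : ℕ × ℕ × ℕ × ℕ → (a : ℕ) → a ∈ P → ℕ × ℕ × ℕ × ℕ := fun ν p _ =>
    (ν.1.factorization p, ν.2.1.factorization p, ν.2.2.1.factorization p,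
      ν.2.2.2.factorization p) with hi
  set j : ((a : ℕ) → a ∈ P → ℕ × ℕ × ℕ × ℕ) → ℕ × ℕ × ℕ × ℕ := fun e =>
    (∏ p ∈ P, p ^ H e (fun k => k.1) p, ∏ p ∈ P, p ^ H e (fun k => k.2.1) p,
      ∏ p ∈ P, p ^ H e (fun k => k.2.2.1) p, ∏ p ∈ P, p ^ H e (fun k => k.2.2.2) p) with hj
  have hi_mem : ∀ ν ∈ B ×ˢ B ×ˢ B ×ˢ B, i ν ∈ P.pi fun _ => exponentBox E := by
    intro ν hν
    simp only [Finset.mem_product] at hν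
    refine Finset.mem_pi.mpr fun p hp => ?_
    simp only [hi, exponentBox, Finset.mem_product, Finset.mem_range, Nat.lt_succ_iff]
    exact ⟨hle _ hν.1 p hp, hle _ hν.2.1 p hp, hle _ hν.2.2.1 p hp, hle _ hν.2.2.2 p hp⟩
  have hj_mem : ∀ e ∈ P.pi fun _ => exponentBox E, j e ∈ B ×ˢ B ×ˢ B ×ˢ B := by
    intro e he
    have he' : ∀ p hp, (e p hp).1 ≤ E ∧ (e p hp).2.1 ≤ E ∧ (e p hp).2.2.1 ≤ E ∧
        (e p hp).2.2.2 ≤ E := by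
      intro p hp
      have := Finset.mem_pi.mp he p hp
      simpa only [exponentBox, Finset.mem_product, Finset.mem_range, Nat.lt_succ_iff] using this
    simp only [hj, Finset.mem_product]
    exact ⟨hmem e _ fun p hp => (he' p hp).1, hmem e _ fun p hp => (he' p hp).2.1,
      hmem e _ fun p hp => (he' p hp).2.2.1, hmem e _ fun p hp => (he' p hp).2.2.2⟩
  have hji : ∀ ν ∈ B ×ˢ B ×ˢ B ×ˢ B, j (i ν) = ν := by
    intro ν hν
    simp only [Finset.mem_product] at hν
    have hh : ∀ π : ℕ × ℕ × ℕ × ℕ → ℕ, ∏ p ∈ P, p ^ H (i ν) π p =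
        ∏ p ∈ P, p ^ π (ν.1.factorization p,
        ν.2.1.factorization p, ν.2.2.1.factorization p, ν.2.2.2.factorization p) :=
      fun π => Finset.prod_congr rfl fun p hp => by rw [hH']; exact hp
    refine Prod.ext ?_ (Prod.ext ?_ (Prod.ext ?_ ?_))
    · exact (hh fun k => k.1).trans (hself _ hν.1)
    · exact (hh fun k => k.2.1).trans (hself _ hν.2.1)
    · exact (hh fun k => k.2.2.1).trans (hself _ hν.2.2.1)
    · exact (hh fun k => k.2.2.2).trans (hself _ hν.2.2.2)
  have hij : ∀ e ∈ P.pi fun _ => exponentBox E, i (j e) = e := by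
    intro e _
    funext p hp
    exact Prod.ext (hfac e (fun k => k.1) p hp) (Prod.ext (hfac e (fun k => k.2.1) p hp)
      (Prod.ext (hfac e (fun k => k.2.2.1) p hp) (hfac e (fun k => k.2.2.2) p hp)))
  refine Finset.sum_bij' (fun ν _ => i ν) (fun e _ => j e) hi_mem hj_mem hji hij fun ν _ => ?_
  exact (Finset.prod_attach P (fun p => g p (ν.1.factorization p, ν.2.1.factorization p,
    ν.2.2.1.factorization p, ν.2.2.2.factorization p))).symm

variable {d₁ d₂ : ℕ} {χ₁ : DirichletCharacter ℂ d₁} {χ₂ : DirichletCharacter ℂ d₂}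

theorem isMultiplicative_twist {d : ℕ} (χ : DirichletCharacter ℂ d) :
    (toArithmeticFunction ((fun n : ℕ => χ n) * zetaInvSqrtCoeff)).IsMultiplicative := by
  refine ArithmeticFunction.IsMultiplicative.iff_ne_zero.mpr
    ⟨by simp [toArithmeticFunction, zetaInvSqrtCoeff], ?_⟩
  intro m n hm hn hmn
  simp only [toArithmeticFunction, ArithmeticFunction.coe_mk, hm, hn, mul_eq_zero, or_self, if_false,
    Pi.mul_apply, Nat.cast_mul, map_mul]
  have : zetaInvSqrtCoeff (m * n) = zetaInvSqrtCoeff m * zetaInvSqrtCoeff n := by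
    simp only [zetaInvSqrtCoeff]
    rw [Nat.factorization_mul hm hn]
    exact Finsupp.prod_add_index_of_disjoint (Nat.Coprime.disjoint_primeFactors hmn) _
  rw [this]; ring

theorem alpha_mul_of_coprime {x y : ℕ} (h : x.Coprime y) :
    alpha χ₁ χ₂ (x * y) = alpha χ₁ χ₂ x * alpha χ₁ χ₂ y :=
  ((isMultiplicative_twist χ₁).mul (isMultiplicative_twist χ₂)).map_mul_of_coprime h

/-- Primes of P not dividing m contribute `localK` at exponent 0, which is 1; all factors can thus
be written over one common set of primes. -/
theorem K_eq_prod_localK (hq₁ : χ₁.IsQuadratic) (hq₂ : χ₂.IsQuadratic) {P : Finset ℕ}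
    (hP : ∀ p ∈ P, p.Prime) {m : ℕ} (hs : m.primeFactors ⊆ P) {s : ℂ} (hre : 3 / 4 ≤ s.re) :
    K χ₁ χ₂ m s = ∏ p ∈ P, localK χ₁ χ₂ p s (m.factorization p) := by
  rw [K, ← Finset.prod_mul_distrib]
  refine Finset.prod_subset_one_on_sdiff hs (fun p hp => ?_) fun p _ => rfl
  obtain ⟨hpP, hpm⟩ := Finset.mem_sdiff.mp hp
  rw [Finsupp.notMem_support_iff.mp (by rwa [Nat.support_factorization]),
    localK_zero hq₁ hq₂ (hP p hpP) hre]

variable (χ₁ χ₂) in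
/-- The term of the Selberg sum without the smoothing weights. -/
def unweightedTerm (z : ℂ) (ν : ℕ × ℕ × ℕ × ℕ) : ℂ :=
  alpha χ₁ χ₂ ν.1 * alpha χ₁ χ₂ ν.2.1 * alpha χ₁ χ₂ ν.2.2.1 * alpha χ₁ χ₂ ν.2.2.2 /
    ((ν.2.1 : ℂ) * ν.2.2.2) *
    ((Nat.gcd (ν.1 * ν.2.2.2) (ν.2.1 * ν.2.2.1) : ℂ) / ((ν.1 : ℂ) * ν.2.2.1)) ^ (1 - z) *
    K χ₁ χ₂ (ν.1 * ν.2.2.2 / Nat.gcd (ν.1 * ν.2.2.2) (ν.2.1 * ν.2.2.1)) (1 - z) *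
    K χ₁ χ₂ (ν.2.1 * ν.2.2.1 / Nat.gcd (ν.1 * ν.2.2.2) (ν.2.1 * ν.2.2.1)) (1 - z)

theorem natCast_div_mul_cpow (q a b : ℕ) (s : ℂ) :
    ((q : ℂ) / ((a : ℂ) * b)) ^ s = (q : ℂ) ^ s * (a : ℂ) ^ (-s) * (b : ℂ) ^ (-s) := by
  have h : ((q : ℂ) / ((a : ℂ) * b)) = ((q : ℝ) : ℂ) * (((a * b : ℕ) : ℝ)⁻¹ : ℝ) := by
    push_cast; rw [div_eq_mul_inv]
  rw [h, Complex.mul_cpow_ofReal_nonneg (by positivity) (by positivity), Complex.ofReal_inv,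
    Complex.ofReal_natCast, Complex.ofReal_natCast, Complex.inv_cpow _ _ (by
      rw [Complex.natCast_arg]; exact Real.pi_ne_zero.symm), ← Complex.cpow_neg, Nat.cast_mul,
    Complex.natCast_mul_natCast_cpow, mul_assoc]

/-- Every factor splits over primes: the valuation of the gcd is the minimum of the two valuations,
and the arguments of K have the truncated differences as valuations. -/
theorem unweightedTerm_mul_cpow (hq₁ : χ₁.IsQuadratic) (hq₂ : χ₂.IsQuadratic) {P : Finset ℕ}
    (hP : ∀ p ∈ P, p.Prime) {z : ℂ} (hz : ‖z‖ ≤ 1 / 4) (w₁ w₂ w₃ w₄ : ℂ) {ν : ℕ × ℕ × ℕ × ℕ}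
    (h₁ : ν.1 ≠ 0) (h₂ : ν.2.1 ≠ 0) (h₃ : ν.2.2.1 ≠ 0) (h₄ : ν.2.2.2 ≠ 0)
    (s₁ : ν.1.primeFactors ⊆ P) (s₂ : ν.2.1.primeFactors ⊆ P) (s₃ : ν.2.2.1.primeFactors ⊆ P)
    (s₄ : ν.2.2.2.primeFactors ⊆ P) :
    unweightedTerm χ₁ χ₂ z ν * ((ν.1 : ℂ) ^ (-w₁) * (ν.2.1 : ℂ) ^ (-w₂) *
      ((ν.2.2.1 : ℂ) ^ (-w₃) * (ν.2.2.2 : ℂ) ^ (-w₄))) =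
    ∏ p ∈ P, localTerm χ₁ χ₂ z w₁ w₂ w₃ w₄ p (ν.1.factorization p, ν.2.1.factorization p,
      ν.2.2.1.factorization p, ν.2.2.2.factorization p) := by
  obtain ⟨a, b, c, d⟩ := ν
  dsimp only at *
  have hre : 3 / 4 ≤ (1 - z).re := by
    have := (Complex.abs_re_le_norm z).trans hz
    rw [Complex.sub_re, Complex.one_re]; linarith [(abs_le.mp this).2]
  set q := Nat.gcd (a * d) (b * c) with hq
  have had : a * d ≠ 0 := mul_ne_zero h₁ h₄
  have hbc : b * c ≠ 0 := mul_ne_zero h₂ h₃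
  have hq0 : q ≠ 0 := (Nat.gcd_pos_of_pos_left _ (Nat.pos_of_ne_zero had)).ne'
  have hq1 : q ∣ a * d := Nat.gcd_dvd_left _ _
  have hq2 : q ∣ b * c := Nat.gcd_dvd_right _ _
  have sad : (a * d).primeFactors ⊆ P := by
    rw [Nat.primeFactors_mul h₁ h₄]; exact Finset.union_subset s₁ s₄
  have sbc : (b * c).primeFactors ⊆ P := by
    rw [Nat.primeFactors_mul h₂ h₃]; exact Finset.union_subset s₂ s₃
  have sq : q.primeFactors ⊆ P := (Nat.primeFactors_mono hq1 had).trans sad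
  have sad' : (a * d / q).primeFactors ⊆ P :=
    (Nat.primeFactors_mono (Nat.div_dvd_of_dvd hq1) had).trans sad
  have sbc' : (b * c / q).primeFactors ⊆ P :=
    (Nat.primeFactors_mono (Nat.div_dvd_of_dvd hq2) hbc).trans sbc
  have fq : ∀ p, q.factorization p = min (a.factorization p + d.factorization p)
      (b.factorization p + c.factorization p) := fun p => by
    rw [hq, Nat.factorization_gcd had hbc, Nat.factorization_mul h₁ h₄, Nat.factorization_mul h₂ h₃]
    rfl
  have fad : ∀ p, (a * d / q).factorization p = a.factorization p + d.factorization p -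
      q.factorization p := fun p => by
    rw [Nat.factorization_div hq1, Nat.factorization_mul h₁ h₄]; rfl
  have fbc : ∀ p, (b * c / q).factorization p = b.factorization p + c.factorization p -
      q.factorization p := fun p => by
    rw [Nat.factorization_div hq2, Nat.factorization_mul h₂ h₃]; rfl
  have hα : ∀ n : ℕ, n ≠ 0 → n.primeFactors ⊆ P →
      alpha χ₁ χ₂ n = ∏ p ∈ P, alpha χ₁ χ₂ (p ^ n.factorization p) := fun n h0 hs =>
    eq_prod_prime_pow (fun x y hxy => alpha_mul_of_coprime hxy) (alpha_one χ₁ χ₂) h0 hs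
  have hinv : ((b : ℂ) * d)⁻¹ = (b : ℂ) ^ (-1 : ℂ) * (d : ℂ) ^ (-1 : ℂ) := by
    rw [Complex.cpow_neg_one, Complex.cpow_neg_one, mul_inv]
  rw [unweightedTerm]
  dsimp only
  rw [← hq, natCast_div_mul_cpow, div_eq_mul_inv, hinv, K_eq_prod_localK hq₁ hq₂ hP sad' hre,
    K_eq_prod_localK hq₁ hq₂ hP sbc' hre, hα a h₁ s₁, hα b h₂ s₂, hα c h₃ s₃, hα d h₄ s₄,
    natCast_cpow_eq_prod h₁ s₁, natCast_cpow_eq_prod h₁ s₁, natCast_cpow_eq_prod h₂ s₂,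
    natCast_cpow_eq_prod h₂ s₂, natCast_cpow_eq_prod h₃ s₃, natCast_cpow_eq_prod h₃ s₃,
    natCast_cpow_eq_prod h₄ s₄, natCast_cpow_eq_prod h₄ s₄, natCast_cpow_eq_prod hq0 sq]
  simp only [← Finset.prod_mul_distrib]
  refine Finset.prod_congr rfl fun p hp => ?_
  have hp0 : (p : ℂ) ≠ 0 := by exact_mod_cast (hP p hp).ne_zero
  rw [localTerm, localCoeff, fad, fbc, ← fq]
  dsimp only
  have hexp : (p : ℂ) ^ (-localExponent z w₁ w₂ w₃ w₄ (a.factorization p, b.factorization p,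
      c.factorization p, d.factorization p)) =
      (p : ℂ) ^ ((b.factorization p : ℂ) * -1) * (p : ℂ) ^ ((d.factorization p : ℂ) * -1) *
      ((p : ℂ) ^ ((q.factorization p : ℂ) * (1 - z)) * (p : ℂ) ^ ((a.factorization p : ℂ) * -(1 - z)) *
        (p : ℂ) ^ ((c.factorization p : ℂ) * -(1 - z))) *
      ((p : ℂ) ^ ((a.factorization p : ℂ) * -w₁) * (p : ℂ) ^ ((b.factorization p : ℂ) * -w₂) *
        ((p : ℂ) ^ ((c.factorization p : ℂ) * -w₃) * (p : ℂ) ^ ((d.factorization p : ℂ) * -w₄))) := by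
    simp only [← Complex.cpow_add _ _ hp0]
    congr 1
    rw [localExponent]
    dsimp only
    rw [← fq]
    ring
  rw [hexp]
  ring

theorem weight_eq_zero {X : ℝ} (hX : 3 ≤ X) {ν : ℕ} (h : ⌊X⌋₊ < ν) : weight X ν = 0 := by
  have h1 : X < ν := (Nat.floor_lt (by linarith)).mp h
  have hsq : Real.sqrt X ≤ X := by
    rw [Real.sqrt_le_left (by linarith)]; nlinarith
  rw [weight, if_neg (by linarith), if_neg (by linarith)]

/-- Every positive integer ν ≤ X divides the modulus, since its primes are below N and its
valuations are less than ν. Divisors beyond X have weight zero, so the index set becomes a product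
over primes at no cost. -/
theorem S_eq_sum_divisors (X : ℝ) (hX : 3 ≤ X) (z : ℂ) {N : ℕ} (hN : ⌊X⌋₊ < N) :
    S χ₁ χ₂ X z = ∑ ν ∈ (∏ p ∈ N.primesBelow, p ^ N).divisors ×ˢ
        (∏ p ∈ N.primesBelow, p ^ N).divisors ×ˢ
        (∏ p ∈ N.primesBelow, p ^ N).divisors ×ˢ (∏ p ∈ N.primesBelow, p ^ N).divisors,
      unweightedTerm χ₁ χ₂ z ν * (((weight X ν.1 : ℂ) * (weight X ν.2.1 : ℂ)) *
        ((weight X ν.2.2.1 : ℂ) * (weight X ν.2.2.2 : ℂ))) := by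
  set B := (∏ p ∈ N.primesBelow, p ^ N).divisors with hB
  have hP : ∀ p ∈ N.primesBelow, p.Prime := fun p hp => Nat.prime_of_mem_primesBelow hp
  have hsub : Finset.Icc 1 ⌊X⌋₊ ⊆ B := by
    intro ν hν
    obtain ⟨h1, h2⟩ := Finset.mem_Icc.mp hν
    refine (mem_divisors_prod_primes_pow hP N ν).mpr ⟨by omega, fun p hp => ?_, fun p _ => ?_⟩
    · have := Nat.le_of_mem_primeFactors hp
      exact Nat.mem_primesBelow.mpr ⟨by omega, Nat.prime_of_mem_primeFactors hp⟩
    · have := Nat.factorization_lt p (n := ν) (by omega)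
      omega
  have hS : S χ₁ χ₂ X z = ∑ ν ∈ Finset.Icc 1 ⌊X⌋₊ ×ˢ Finset.Icc 1 ⌊X⌋₊ ×ˢ Finset.Icc 1 ⌊X⌋₊ ×ˢ
      Finset.Icc 1 ⌊X⌋₊, unweightedTerm χ₁ χ₂ z ν * (((weight X ν.1 : ℂ) * (weight X ν.2.1 : ℂ)) *
        ((weight X ν.2.2.1 : ℂ) * (weight X ν.2.2.2 : ℂ))) := by
    simp only [S, Finset.sum_product]
    refine Finset.sum_congr rfl fun a _ => Finset.sum_congr rfl fun b _ =>
      Finset.sum_congr rfl fun c _ => Finset.sum_congr rfl fun d _ => ?_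
    simp only [selbergTerm, unweightedTerm, beta]
    ring
  rw [hS]
  refine Finset.sum_subset ?_ ?_
  · exact Finset.product_subset_product hsub (Finset.product_subset_product hsub
      (Finset.product_subset_product hsub hsub))
  · intro ν hν hν'
    have hpos : ∀ n ∈ B, n ∉ Finset.Icc 1 ⌊X⌋₊ → weight X n = 0 := by
      intro n hn hn'
      refine weight_eq_zero hX ?_
      have := ((mem_divisors_prod_primes_pow hP N n).mp hn).1
      rw [Finset.mem_Icc] at hn'
      omega
    simp only [Finset.mem_product] at hν hν'
    by_cases h1 : ν.1 ∈ Finset.Icc 1 ⌊X⌋₊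
    · by_cases h2 : ν.2.1 ∈ Finset.Icc 1 ⌊X⌋₊
      · by_cases h3 : ν.2.2.1 ∈ Finset.Icc 1 ⌊X⌋₊
        · have h4 : ν.2.2.2 ∉ Finset.Icc 1 ⌊X⌋₊ := fun h4 => hν' ⟨h1, h2, h3, h4⟩
          simp [hpos _ hν.2.2.2 h4]
        · simp [hpos _ hν.2.2.1 h3]
      · simp [hpos _ hν.2.1 h2]
    · simp [hpos _ hν.1 h1]

/-- The Selberg sum as a fourfold Mellin integral. -/
theorem S_eq_integral (hq₁ : χ₁.IsQuadratic) (hq₂ : χ₂.IsQuadratic) {X : ℝ} (hX : 3 ≤ X) {z : ℂ}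
    (hz : ‖z‖ ≤ 1 / 4) {c₁ c₂ c₃ c₄ : ℝ} (hc₁ : 0 < c₁) (hc₂ : 0 < c₂) (hc₃ : 0 < c₃) (hc₄ : 0 < c₄)
    {N : ℕ} (hN : ⌊X⌋₊ < N) :
    S χ₁ χ₂ X z = ∫ t : (ℝ × ℝ) × ℝ × ℝ,
      ((kern X c₁ t.1.1 * kern X c₂ t.1.2) * (kern X c₃ t.2.1 * kern X c₄ t.2.2)) *
      ∏ p ∈ N.primesBelow, localSum χ₁ χ₂ z (c₁ + t.1.1 * I) (c₂ + t.1.2 * I) (c₃ + t.2.1 * I)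
        (c₄ + t.2.2 * I) p N := by
  have hP : ∀ p ∈ N.primesBelow, p.Prime := fun p hp => Nat.prime_of_mem_primesBelow hp
  rw [S_eq_sum_divisors X hX z hN]
  set B := (∏ p ∈ N.primesBelow, p ^ N).divisors with hB
  have hB0 : ∀ n ∈ B, n ≠ 0 ∧ n.primeFactors ⊆ N.primesBelow := fun n hn =>
    ⟨((mem_divisors_prod_primes_pow hP N n).mp hn).1, ((mem_divisors_prod_primes_pow hP N n).mp hn).2.1⟩
  set F : ℝ → ℕ → ℝ → ℂ := fun c n t => kern X c t * (n : ℂ) ^ (-(c + t * I : ℂ)) with hF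
  have hFi : ∀ c : ℝ, 0 < c → ∀ n ∈ B, Integrable (F c n) := fun c hc n hn =>
    integrable_kern_mul_cpow hX hc (Nat.one_le_iff_ne_zero.mpr (hB0 n hn).1)
  have hterm : ∀ ν ∈ B ×ˢ B ×ˢ B ×ˢ B, Integrable (fun t : (ℝ × ℝ) × ℝ × ℝ =>
      unweightedTerm χ₁ χ₂ z ν * ((F c₁ ν.1 t.1.1 * F c₂ ν.2.1 t.1.2) *
        (F c₃ ν.2.2.1 t.2.1 * F c₄ ν.2.2.2 t.2.2))) := by
    intro ν hν
    simp only [Finset.mem_product] at hν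
    exact (((hFi c₁ hc₁ _ hν.1).mul_prod (hFi c₂ hc₂ _ hν.2.1)).mul_prod
      ((hFi c₃ hc₃ _ hν.2.2.1).mul_prod (hFi c₄ hc₄ _ hν.2.2.2))).const_mul _
  have hint : ∀ ν ∈ B ×ˢ B ×ˢ B ×ˢ B,
      unweightedTerm χ₁ χ₂ z ν * (((weight X ν.1 : ℂ) * (weight X ν.2.1 : ℂ)) *
        ((weight X ν.2.2.1 : ℂ) * (weight X ν.2.2.2 : ℂ))) =
      ∫ t : (ℝ × ℝ) × ℝ × ℝ, unweightedTerm χ₁ χ₂ z ν * ((F c₁ ν.1 t.1.1 * F c₂ ν.2.1 t.1.2) *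
        (F c₃ ν.2.2.1 t.2.1 * F c₄ ν.2.2.2 t.2.2)) := by
    intro ν hν
    simp only [Finset.mem_product] at hν
    have hw : ∀ c : ℝ, 0 < c → ∀ n ∈ B, (weight X n : ℂ) = ∫ t, F c n t := fun c hc n hn =>
      weight_eq_integral hX hc (Nat.one_le_iff_ne_zero.mpr (hB0 n hn).1)
    rw [hw c₁ hc₁ _ hν.1, hw c₂ hc₂ _ hν.2.1, hw c₃ hc₃ _ hν.2.2.1, hw c₄ hc₄ _ hν.2.2.2,
      ← integral_prod_mul, ← integral_prod_mul, ← integral_prod_mul, ← integral_const_mul]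
    rfl
  -- The sum is finite, so the interchange needs only integrability of each term and the truncated
  -- Euler product is an exact identity.
  rw [Finset.sum_congr rfl hint, ← integral_finsetSum _ hterm]
  refine integral_congr_ae (Filter.Eventually.of_forall fun t => ?_)
  dsimp only
  have hlocal : ∏ p ∈ N.primesBelow, localSum χ₁ χ₂ z (c₁ + t.1.1 * I) (c₂ + t.1.2 * I)
      (c₃ + t.2.1 * I) (c₄ + t.2.2 * I) p N = _ :=
    (sum_divisors_eq_prod_sum hP N fun p k => localTerm χ₁ χ₂ z (c₁ + t.1.1 * I) (c₂ + t.1.2 * I)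
      (c₃ + t.2.1 * I) (c₄ + t.2.2 * I) p k).symm
  rw [hlocal, Finset.mul_sum]
  refine Finset.sum_congr rfl fun ν hν => ?_
  simp only [Finset.mem_product] at hν
  rw [← unweightedTerm_mul_cpow hq₁ hq₂ hP hz (c₁ + t.1.1 * I) (c₂ + t.1.2 * I)
      (c₃ + t.2.1 * I) (c₄ + t.2.2 * I) (hB0 _ hν.1).1 (hB0 _ hν.2.1).1 (hB0 _ hν.2.2.1).1
      (hB0 _ hν.2.2.2).1 (hB0 _ hν.1).2 (hB0 _ hν.2.1).2 (hB0 _ hν.2.2.1).2 (hB0 _ hν.2.2.2).2]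
  simp only [hF]
  ring

end EulerIdentity

end SelbergSum

end

noncomputable section

/-! ### Planar integrals of the kernels. -/

namespace SelbergSum
open Complex MeasureTheory

section PlanarIntegrals

theorem norm_add_mul_I_ge {δ : ℝ} (hδ : 0 ≤ δ) (t : ℝ) : (δ + |t|) / 2 ≤ ‖(δ + t * I : ℂ)‖ := by
  have h1 := Complex.abs_re_le_norm (δ + t * I : ℂ)
  have h2 := Complex.abs_im_le_norm (δ + t * I : ℂ)
  simp only [add_re, ofReal_re, mul_re, I_re, mul_zero, ofReal_im, I_im, mul_one, sub_self,
    add_zero, add_im, mul_im, zero_add] at h1 h2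
  rw [abs_of_nonneg hδ] at h1
  linarith

/-- A majorant on the line `Re s = δ` for `((1 + |t|) ^ (1 / 4) / ‖δ + i t‖) ^ (3 / 2)`. -/
def lineMajorant (δ t : ℝ) : ℝ := 3 * δ ^ (-(3 / 2) : ℝ) * (1 + ‖t / δ‖) ^ (-(9 / 8) : ℝ)

theorem measurable_lineMajorant (δ : ℝ) : Measurable (lineMajorant δ) := by
  unfold lineMajorant
  fun_prop

/-- With v = 1 + |t|/δ one has δv = δ + |t| ≤ 2|δ+it|, and 1 + |t| ≤ v because δ ≤ 1. The resulting
power is v^((1/4-1)(3/2)) = v^(-9/8), which is integrable. -/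
theorem rpow_le_lineMajorant {δ : ℝ} (hδ : 0 < δ) (hδ1 : δ ≤ 1) (t : ℝ) :
    ((1 + |t|) ^ (1 / 4 : ℝ) / ‖(δ + t * I : ℂ)‖) ^ (3 / 2 : ℝ) ≤ lineMajorant δ t := by
  have h1 := norm_add_mul_I_ge hδ.le t
  have ht := abs_nonneg t
  set v : ℝ := 1 + ‖t / δ‖ with hv
  have hv' : δ * v = δ + |t| := by
    rw [hv, norm_div, Real.norm_eq_abs, Real.norm_eq_abs, abs_of_pos hδ]; field_simp
  have hv0 : 0 < v := by positivity
  have h2 : 1 + |t| ≤ v := by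
    rw [hv, norm_div, Real.norm_eq_abs, Real.norm_eq_abs, abs_of_pos hδ, add_le_add_iff_left,
      le_div_iff₀ hδ]
    nlinarith
  have h3 : (1 + |t|) ^ (1 / 4 : ℝ) / ‖(δ + t * I : ℂ)‖ ≤ 2 * (δ⁻¹ * v ^ (-(3 / 4) : ℝ)) := by
    have e : v ^ (-(3 / 4) : ℝ) = v ^ (1 / 4 : ℝ) * v⁻¹ := by
      rw [← Real.rpow_neg_one, ← Real.rpow_add hv0]; norm_num
    calc (1 + |t|) ^ (1 / 4 : ℝ) / ‖(δ + t * I : ℂ)‖ ≤ v ^ (1 / 4 : ℝ) / (δ * v / 2) := by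
          rw [hv']; gcongr
      _ = _ := by rw [e]; field_simp
  have h4 : (2 : ℝ) ^ (3 / 2 : ℝ) ≤ 3 := by
    have h8 : ((2 : ℝ) ^ (3 / 2 : ℝ)) ^ 2 = 8 := by
      rw [← Real.rpow_natCast, ← Real.rpow_mul (by norm_num)]; norm_num
    have := Real.rpow_nonneg (show (0 : ℝ) ≤ 2 by norm_num) (3 / 2)
    nlinarith
  have e : (2 * (δ⁻¹ * v ^ (-(3 / 4) : ℝ))) ^ (3 / 2 : ℝ) =
      2 ^ (3 / 2 : ℝ) * δ ^ (-(3 / 2) : ℝ) * v ^ (-(9 / 8) : ℝ) := by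
    rw [Real.mul_rpow (by norm_num) (by positivity), Real.mul_rpow (by positivity) (by positivity),
      ← Real.rpow_mul hv0.le, ← Real.rpow_neg_one δ, ← Real.rpow_mul hδ.le]
    norm_num [mul_assoc]
  refine (Real.rpow_le_rpow (by positivity) h3 (by norm_num)).trans ?_
  rw [e, lineMajorant]
  gcongr

/-- The majorant is δ^(-3/2) times a fixed integrable function of t/δ, and rescaling returns one
factor δ. -/
theorem exists_lintegral_lineMajorant_le :
    ∃ J : ℝ, 0 < J ∧ ∀ δ : ℝ, 0 < δ →
      ∫⁻ t, ENNReal.ofReal (lineMajorant δ t) ≤ ENNReal.ofReal (J * δ ^ (-(1 / 2) : ℝ)) := by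
  set h : ℝ → ℝ := fun u => (1 + ‖u‖) ^ (-(9 / 8) : ℝ) with hh
  have hi : Integrable h := integrable_one_add_norm (by simp; norm_num)
  have h0 : 0 ≤ ∫ u, h u := integral_nonneg fun u => by simp only [hh]; positivity
  refine ⟨3 * (∫ u, h u) + 1, by positivity, fun δ hδ => ?_⟩
  have hm : lineMajorant δ = fun t => 3 * δ ^ (-(3 / 2) : ℝ) * h (t / δ) := rfl
  rw [← ofReal_integral_eq_lintegral_ofReal]
  · refine ENNReal.ofReal_le_ofReal ?_
    rw [hm, integral_const_mul, Measure.integral_comp_div, abs_of_pos hδ, smul_eq_mul]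
    have e : δ ^ (-(1 / 2) : ℝ) = δ ^ (-(3 / 2) : ℝ) * δ := by
      nth_rewrite 3 [← Real.rpow_one δ]
      rw [← Real.rpow_add hδ]; norm_num
    rw [e]
    have : 0 ≤ δ ^ (-(3 / 2) : ℝ) * δ := by positivity
    nlinarith
  · rw [hm]
    exact (hi.comp_div hδ.ne').const_mul _
  · exact Filter.Eventually.of_forall fun t => by simp only [lineMajorant, Pi.zero_apply]; positivity

/-- AM-GM applied to √(xy), √(xw), √(yw), whose product is xyw. It replaces three dependent factors
in the plane by products of two factors in independent coordinates. -/
theorem mul_mul_le_rpow {x y w : ℝ} (hx : 0 ≤ x) (hy : 0 ≤ y) (hw : 0 ≤ w) :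
    x * y * w ≤ x ^ (3 / 2 : ℝ) * y ^ (3 / 2 : ℝ) + x ^ (3 / 2 : ℝ) * w ^ (3 / 2 : ℝ) +
      y ^ (3 / 2 : ℝ) * w ^ (3 / 2 : ℝ) := by
  have h : ∀ x : ℝ, 0 ≤ x → x = Real.sqrt x ^ 2 ∧ x ^ (3 / 2 : ℝ) = Real.sqrt x ^ 3 := by
    intro x hx
    refine ⟨(Real.sq_sqrt hx).symm, ?_⟩
    rw [Real.sqrt_eq_rpow, ← Real.rpow_natCast, ← Real.rpow_mul hx]; norm_num
  rw [(h x hx).2, (h y hy).2, (h w hw).2]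
  nth_rewrite 1 [(h x hx).1, (h y hy).1, (h w hw).1]
  have amgm : ∀ a b c : ℝ, 0 ≤ a → 0 ≤ b → 0 ≤ c → a * b * c ≤ a ^ 3 + b ^ 3 + c ^ 3 := by
    intro a b c ha hb hc
    nlinarith [mul_nonneg (add_nonneg (add_nonneg ha hb) hc)
      (add_nonneg (add_nonneg (sq_nonneg (a - b)) (sq_nonneg (b - c))) (sq_nonneg (a - c))),
      mul_nonneg (mul_nonneg ha hb) hc]
  have := amgm (√x * √y) (√x * √w) (√y * √w) (by positivity) (by positivity) (by positivity)
  calc _ = √x * √y * (√x * √w) * (√y * √w) := by ring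
    _ ≤ _ := this
    _ = _ := by ring

/-- The two-variable kernel `a(t) a(s) b(t + s + c)` with `a(t) = (1 + |t|) ^ (1 / 4) / ‖δ + i t‖`
and `b(t) = 1 / ‖δ + i t‖`. -/
def pairKernel (δ c : ℝ) (t : ℝ × ℝ) : ℝ :=
  ((1 + |t.1|) ^ (1 / 4 : ℝ) / ‖(δ + t.1 * I : ℂ)‖) *
    ((1 + |t.2|) ^ (1 / 4 : ℝ) / ‖(δ + t.2 * I : ℂ)‖) *
    ‖(δ + ((t.1 + t.2 + c : ℝ) : ℂ) * I : ℂ)‖⁻¹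

theorem pairKernel_nonneg (δ c : ℝ) (t : ℝ × ℝ) : 0 ≤ pairKernel δ c t := by
  unfold pairKernel; positivity

theorem measurable_pairKernel (δ c : ℝ) : Measurable (pairKernel δ c) := by
  unfold pairKernel
  fun_prop

theorem pairKernel_le {δ : ℝ} (hδ : 0 < δ) (hδ1 : δ ≤ 1) (c : ℝ) (t : ℝ × ℝ) :
    pairKernel δ c t ≤ lineMajorant δ t.1 * lineMajorant δ t.2 +
      lineMajorant δ t.1 * lineMajorant δ (t.1 + t.2 + c) +
      lineMajorant δ t.2 * lineMajorant δ (t.1 + t.2 + c) := by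
  have h1 := rpow_le_lineMajorant hδ hδ1 t.1
  have h2 := rpow_le_lineMajorant hδ hδ1 t.2
  have h3 := rpow_le_lineMajorant hδ hδ1 (t.1 + t.2 + c)
  have h4 : (‖(δ + ((t.1 + t.2 + c : ℝ) : ℂ) * I : ℂ)‖⁻¹) ^ (3 / 2 : ℝ) ≤
      lineMajorant δ (t.1 + t.2 + c) := by
    refine (Real.rpow_le_rpow (by positivity) ?_ (by norm_num)).trans h3
    rw [inv_eq_one_div]
    gcongr
    exact Real.one_le_rpow (by linarith [abs_nonneg (t.1 + t.2 + c)]) (by norm_num)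
  have hm : ∀ u, 0 ≤ lineMajorant δ u := fun u => by unfold lineMajorant; positivity
  refine (mul_mul_le_rpow (by positivity) (by positivity) (by positivity)).trans ?_
  gcongr <;> exact hm _

/-- Any two of t₁, t₂, t₁+t₂+c are coordinates on the plane with unit Jacobian. Each of the three
products thus integrates to the square of a line integral O(δ^(-1/2)), uniformly in c. -/
theorem exists_lintegral_pairKernel_le :
    ∃ C : ℝ, 0 < C ∧ ∀ δ : ℝ, 0 < δ → δ ≤ 1 → ∀ c : ℝ,
      ∫⁻ t, ENNReal.ofReal (pairKernel δ c t) ≤ ENNReal.ofReal (C / δ) := by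
  obtain ⟨J, hJ, h⟩ := exists_lintegral_lineMajorant_le
  refine ⟨3 * J ^ 2, by positivity, fun δ hδ hδ1 c => ?_⟩
  set m : ℝ → ENNReal := fun t => ENNReal.ofReal (lineMajorant δ t) with hm
  have hmm : Measurable m := (measurable_lineMajorant δ).ennreal_ofReal
  have hm0 : ∀ u, 0 ≤ lineMajorant δ u := fun u => by unfold lineMajorant; positivity
  set Q := ∫⁻ t, m t with hQ
  have hQle : Q * Q ≤ ENNReal.ofReal (J ^ 2 / δ) := by
    refine (mul_le_mul' (h δ hδ) (h δ hδ)).trans ?_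
    rw [← ENNReal.ofReal_mul (by positivity)]
    refine ENNReal.ofReal_le_ofReal (le_of_eq ?_)
    have : δ ^ (-(1 / 2) : ℝ) * δ ^ (-(1 / 2) : ℝ) = δ⁻¹ := by
      rw [← Real.rpow_add hδ, ← Real.rpow_neg_one]; norm_num
    calc _ = J ^ 2 * (δ ^ (-(1 / 2) : ℝ) * δ ^ (-(1 / 2) : ℝ)) := by ring
      _ = _ := by rw [this]; rfl
  have e1 : ∫⁻ t : ℝ × ℝ, m t.1 * m t.2 = Q * Q :=
    lintegral_prod_mul hmm.aemeasurable hmm.aemeasurable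
  have e2 : ∫⁻ t : ℝ × ℝ, m t.1 * m (t.1 + t.2 + c) = Q * Q := by
    rw [Measure.volume_eq_prod, lintegral_prod _ (by fun_prop)]
    have : ∀ x, ∫⁻ y, m x * m (x + y + c) = m x * Q := fun x => by
      rw [lintegral_const_mul _ (by fun_prop)]
      have := lintegral_add_left_eq_self (μ := volume) m (x + c)
      rw [hQ, ← this]
      congr 2; ext y; congr 1; ring
    simp only [this]
    rw [lintegral_mul_const _ hmm]
  have e3 : ∫⁻ t : ℝ × ℝ, m t.2 * m (t.1 + t.2 + c) = Q * Q := by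
    rw [Measure.volume_eq_prod, lintegral_prod_symm _ (by fun_prop)]
    have : ∀ y, ∫⁻ x, m y * m (x + y + c) = m y * Q := fun y => by
      rw [lintegral_const_mul _ (by fun_prop)]
      have := lintegral_add_left_eq_self (μ := volume) m (y + c)
      rw [hQ, ← this]
      congr 2; ext x; congr 1; ring
    simp only [this]
    rw [lintegral_mul_const _ hmm]
  have hle : ∀ t : ℝ × ℝ, ENNReal.ofReal (pairKernel δ c t) ≤
      m t.1 * m t.2 + m t.1 * m (t.1 + t.2 + c) + m t.2 * m (t.1 + t.2 + c) := by
    intro t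
    refine (ENNReal.ofReal_le_ofReal (pairKernel_le hδ hδ1 c t)).trans (le_of_eq ?_)
    have := hm0 t.1
    have := hm0 t.2
    have := hm0 (t.1 + t.2 + c)
    rw [ENNReal.ofReal_add (by positivity) (by positivity),
      ENNReal.ofReal_add (by positivity) (by positivity), ENNReal.ofReal_mul (hm0 _),
      ENNReal.ofReal_mul (hm0 _), ENNReal.ofReal_mul (hm0 _)]
  refine (lintegral_mono hle).trans ?_
  rw [lintegral_add_left (by fun_prop), lintegral_add_left (by fun_prop), e1, e2, e3]
  refine (add_le_add (add_le_add hQle hQle) hQle).trans (le_of_eq ?_)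
  rw [← ENNReal.ofReal_add (by positivity) (by positivity),
    ← ENNReal.ofReal_add (by positivity) (by positivity)]
  congr 1; ring

/-- Handles the pairing (t₁,t₃), (t₂,t₄), which cuts across the grouping ((t₁,t₂),(t₃,t₄)) of the
integration space. -/
theorem lintegral_prod_mul_crossed {F G : ℝ × ℝ → ENNReal} (hF : Measurable F) (hG : Measurable G) :
    ∫⁻ t : (ℝ × ℝ) × ℝ × ℝ, F (t.1.1, t.2.1) * G (t.1.2, t.2.2) = (∫⁻ t, F t) * ∫⁻ t, G t := by
  have h1 : ∀ x : ℝ × ℝ, ∫⁻ y : ℝ × ℝ, F (x.1, y.1) * G (x.2, y.2) =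
      (∫⁻ y, F (x.1, y)) * ∫⁻ y, G (x.2, y) := fun x =>
    lintegral_prod_mul (f := fun y => F (x.1, y)) (g := fun y => G (x.2, y))
      (by fun_prop) (by fun_prop)
  rw [Measure.volume_eq_prod, lintegral_prod _ (by fun_prop)]
  simp only [h1]
  rw [Measure.volume_eq_prod ℝ ℝ, lintegral_prod_mul (f := fun x => ∫⁻ y, F (x, y))
    (g := fun x => ∫⁻ y, G (x, y)) hF.lintegral_prod_right'.aemeasurable
    hG.lintegral_prod_right'.aemeasurable, lintegral_prod _ hF.aemeasurable,
    lintegral_prod _ hG.aemeasurable]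

/-- The fourfold integral of both pairings of `pairKernel` is `O(δ⁻²)`. -/
theorem exists_lintegral_pairKernel_mul_le :
    ∃ C : ℝ, 0 < C ∧ ∀ δ : ℝ, 0 < δ → δ ≤ 1 → ∀ y : ℝ,
      ∫⁻ t : (ℝ × ℝ) × ℝ × ℝ, ENNReal.ofReal (pairKernel δ 0 t.1 * pairKernel δ 0 t.2 +
        pairKernel δ (-y) (t.1.1, t.2.1) * pairKernel δ y (t.1.2, t.2.2)) ≤
      ENNReal.ofReal (C / δ ^ 2) := by
  obtain ⟨C, hC, h⟩ := exists_lintegral_pairKernel_le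
  refine ⟨2 * C ^ 2, by positivity, fun δ hδ hδ1 y => ?_⟩
  set P : ℝ → ℝ × ℝ → ENNReal := fun c t => ENNReal.ofReal (pairKernel δ c t) with hP
  have hPm : ∀ c, Measurable (P c) := fun c => (measurable_pairKernel δ c).ennreal_ofReal
  have e : ∀ t : (ℝ × ℝ) × ℝ × ℝ, ENNReal.ofReal (pairKernel δ 0 t.1 * pairKernel δ 0 t.2 +
        pairKernel δ (-y) (t.1.1, t.2.1) * pairKernel δ y (t.1.2, t.2.2)) =
      P 0 t.1 * P 0 t.2 + P (-y) (t.1.1, t.2.1) * P y (t.1.2, t.2.2) := by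
    intro t
    rw [ENNReal.ofReal_add (mul_nonneg (pairKernel_nonneg _ _ _) (pairKernel_nonneg _ _ _))
      (mul_nonneg (pairKernel_nonneg _ _ _) (pairKernel_nonneg _ _ _)),
      ENNReal.ofReal_mul (pairKernel_nonneg _ _ _), ENNReal.ofReal_mul (pairKernel_nonneg _ _ _)]
  have hCC : ENNReal.ofReal (C / δ) * ENNReal.ofReal (C / δ) = ENNReal.ofReal (C ^ 2 / δ ^ 2) := by
    rw [← ENNReal.ofReal_mul (by positivity)]; congr 1; field_simp
  simp only [e]
  have h0 := hPm 0
  rw [lintegral_add_left (by fun_prop), lintegral_prod_mul_crossed (hPm _) (hPm _)]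
  have e1 : ∫⁻ t : (ℝ × ℝ) × ℝ × ℝ, P 0 t.1 * P 0 t.2 = (∫⁻ t, P 0 t) * ∫⁻ t, P 0 t :=
    lintegral_prod_mul h0.aemeasurable h0.aemeasurable
  rw [e1]
  refine (add_le_add (mul_le_mul' (h δ hδ hδ1 0) (h δ hδ hδ1 0))
    (mul_le_mul' (h δ hδ hδ1 (-y)) (h δ hδ hδ1 y))).trans (le_of_eq ?_)
  rw [hCC, ← ENNReal.ofReal_add (by positivity) (by positivity)]
  congr 1; ring

end PlanarIntegrals

end SelbergSum

end

noncomputable section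

/-! ### Pointwise bound for the integrand and the estimate of S. -/

namespace SelbergSum
open Complex MeasureTheory

section PointwiseBound

/-- With d = |z| - max(Re z, 0), the excess of |z| over the abscissa is absorbed by d log X ≤ X^d.
The loss X^d is what turns X^(max(Re z,0)) into X^|z|. -/
theorem norm_le_rpow_mul_max_add {X : ℝ} (hX : 3 ≤ X) (z : ℂ) :
    ‖z‖ ≤ X ^ (‖z‖ - max z.re 0) * (max z.re 0 + 1 / Real.log X) := by
  have hL : 0 < Real.log X := Real.log_pos (by linarith)
  have hσ : 0 ≤ max z.re 0 := le_max_right _ _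
  have hd : 0 ≤ ‖z‖ - max z.re 0 :=
    sub_nonneg.mpr (max_le (Complex.re_le_norm z) (norm_nonneg z))
  set d := ‖z‖ - max z.re 0 with hd'
  have h1 : 1 ≤ X ^ d := Real.one_le_rpow (by linarith) hd
  have h2 : d * Real.log X ≤ X ^ d := by
    rw [Real.rpow_def_of_pos (by linarith)]
    linarith [Real.add_one_le_exp (Real.log X * d)]
  have h3 : d ≤ X ^ d * (1 / Real.log X) := by
    rw [mul_one_div, le_div_iff₀ hL]; exact h2
  have h4 : ‖z‖ = d + max z.re 0 := by rw [hd']; ring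
  rw [h4, mul_add]
  nlinarith

theorem one_add_abs_sub_rpow_le {y : ℝ} (hy : |y| ≤ 1 / 4) (t : ℝ) :
    (1 + |t - y|) ^ (-(7 / 8) : ℝ) ≤ 2 * (1 + |t|) ^ (-(7 / 8) : ℝ) := by
  have h1 : (1 + |t|) / 2 ≤ 1 + |t - y| := by
    have := abs_sub_abs_le_abs_sub t y
    have := abs_nonneg t
    linarith [abs_nonneg (t - y)]
  refine (Real.rpow_le_rpow_of_nonpos (by positivity) h1 (by norm_num)).trans ?_
  rw [Real.div_rpow (by positivity) (by norm_num), Real.rpow_neg (by norm_num : (0 : ℝ) ≤ 2),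
    div_inv_eq_mul, mul_comm]
  gcongr
  calc (2 : ℝ) ^ (7 / 8 : ℝ) ≤ 2 ^ (1 : ℝ) :=
        Real.rpow_le_rpow_of_exponent_le (by norm_num) (by norm_num)
    _ = 2 := Real.rpow_one 2

theorem rpow_one_div_log {X : ℝ} (hX : 3 ≤ X) : X ^ (1 / Real.log X) = Real.exp 1 := by
  have hL : 0 < Real.log X := Real.log_pos (by linarith)
  rw [Real.rpow_def_of_pos (by linarith), mul_one_div_cancel hL.ne']

theorem norm_add_mul_I_mono {a b : ℝ} (ha : 0 ≤ a) (hab : a ≤ b) (t : ℝ) :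
    ‖(a + t * I : ℂ)‖ ≤ ‖(b + t * I : ℂ)‖ := by
  rw [Complex.norm_add_mul_I, Complex.norm_add_mul_I]
  gcongr

/-- On this line |w - z| ≤ 2X^d|w| with d = |z| - max(Re z, 0), which cancels one power of |w| in
the kernel, and X^c·X^d = e·X^|z|. -/
theorem norm_kern_mul_lowerFactor_le {X : ℝ} (hX : 3 ≤ X) {z : ℂ} (hz : ‖z‖ ≤ 1 / 4) {c : ℝ}
    (hc : c = max z.re 0 + 1 / Real.log X) (t : ℝ) :
    ‖kern X c t‖ * lowerFactor (c + t * I - z) ≤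
      4 * Real.exp 1 * X ^ ‖z‖ / Real.log X *
        ((1 + |t|) ^ (-(7 / 8) : ℝ) / ‖((1 / Real.log X : ℝ) + t * I : ℂ)‖) := by
  have hX0 : 0 < X := by linarith
  have hL : 0 < Real.log X := Real.log_pos (by linarith)
  have hσ : 0 ≤ max z.re 0 := le_max_right _ _
  have hδ : 0 < 1 / Real.log X := by positivity
  have hc0 : 0 < c := by rw [hc]; positivity
  set d := ‖z‖ - max z.re 0 with hd
  have hd0 : 0 ≤ d := sub_nonneg.mpr (max_le (Complex.re_le_norm z) (norm_nonneg z))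
  have hXd : 1 ≤ X ^ d := Real.one_le_rpow (by linarith) hd0
  set w : ℂ := c + t * I with hw
  have hwc : c ≤ ‖w‖ := by
    have := Complex.re_le_norm w
    simpa [hw] using this
  have hw0 : 0 < ‖w‖ := hc0.trans_le hwc
  have h1 : ‖w - z‖ ≤ 2 * X ^ d * ‖w‖ := by
    have h2 := norm_sub_le w z
    have h3 := norm_le_rpow_mul_max_add hX z
    rw [← hc, ← hd] at h3
    nlinarith
  have hy : |z.im| ≤ 1 / 4 := (Complex.abs_im_le_norm z).trans hz
  have him : (w - z).im = t - z.im := by simp [hw]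
  have hlow : lowerFactor (w - z) ≤ 2 * X ^ d * ‖w‖ * (2 * (1 + |t|) ^ (-(7 / 8) : ℝ)) := by
    rw [lowerFactor, him]
    exact mul_le_mul h1 (one_add_abs_sub_rpow_le hy t) (by positivity) (by positivity)
  have hpow : X ^ c * X ^ d = Real.exp 1 * X ^ ‖z‖ := by
    rw [← rpow_one_div_log hX, ← Real.rpow_add hX0, ← Real.rpow_add hX0]
    congr 1; rw [hc, hd]; ring
  have hδ' : 0 < ‖((1 / Real.log X : ℝ) + t * I : ℂ)‖ := by
    have := Complex.re_le_norm ((1 / Real.log X : ℝ) + t * I : ℂ)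
    simp only [add_re, ofReal_re, mul_re, I_re, mul_zero, ofReal_im, I_im, mul_one, sub_self,
      add_zero] at this
    exact hδ.trans_le this
  have hδw : ‖((1 / Real.log X : ℝ) + t * I : ℂ)‖ ≤ ‖w‖ :=
    norm_add_mul_I_mono hδ.le (by rw [hc]; linarith) t
  calc ‖kern X c t‖ * lowerFactor (w - z) ≤ (X ^ c / Real.log X * ‖w‖⁻¹ ^ 2) *
        (2 * X ^ d * ‖w‖ * (2 * (1 + |t|) ^ (-(7 / 8) : ℝ))) :=
        mul_le_mul (norm_kern_le hX hc0 t) hlow (lowerFactor_nonneg _) (by positivity)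
    _ = 4 * (X ^ c * X ^ d) / Real.log X * ((1 + |t|) ^ (-(7 / 8) : ℝ) / ‖w‖) := by
        field_simp; ring
    _ = 4 * Real.exp 1 * X ^ ‖z‖ / Real.log X * ((1 + |t|) ^ (-(7 / 8) : ℝ) / ‖w‖) := by
        rw [hpow]; ring
    _ ≤ _ := by gcongr

/-- The height factor separates through 1 + |a+b+c| ≤ (5/4)(1+|a|)(1+|b|); only the reciprocal norm
still couples the two variables. -/
theorem upperFactor_le {δ : ℝ} (hδ : 0 < δ) {u : ℂ} (hu : δ ≤ u.re) {a b c : ℝ} (hc : |c| ≤ 1 / 4)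
    (him : u.im = a + b + c) :
    upperFactor u ≤ 2 * ((1 + |a|) ^ (9 / 8 : ℝ) * (1 + |b|) ^ (9 / 8 : ℝ)) *
      ‖(δ + ((a + b + c : ℝ) : ℂ) * I : ℂ)‖⁻¹ := by
  have h1 : ‖(δ + ((a + b + c : ℝ) : ℂ) * I : ℂ)‖ ≤ ‖u‖ := by
    rw [← him]
    refine (norm_add_mul_I_mono hδ.le hu u.im).trans_eq ?_
    rw [Complex.re_add_im]
  have h0 : 0 < ‖(δ + ((a + b + c : ℝ) : ℂ) * I : ℂ)‖ := by
    have := Complex.re_le_norm (δ + ((a + b + c : ℝ) : ℂ) * I : ℂ)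
    simp only [add_re, ofReal_re, mul_re, I_re, mul_zero, ofReal_im, I_im, mul_one, sub_self,
      add_zero] at this
    exact hδ.trans_le this
  have h2 : 1 + |u.im| ≤ 5 / 4 * ((1 + |a|) * (1 + |b|)) := by
    rw [him]
    have := abs_add_three a b c
    have := mul_nonneg (abs_nonneg a) (abs_nonneg b)
    nlinarith [abs_nonneg a, abs_nonneg b]
  have h3 : (1 + |u.im|) ^ (9 / 8 : ℝ) ≤
      2 * ((1 + |a|) ^ (9 / 8 : ℝ) * (1 + |b|) ^ (9 / 8 : ℝ)) := by
    refine (Real.rpow_le_rpow (by positivity) h2 (by norm_num)).trans ?_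
    rw [Real.mul_rpow (by norm_num) (by positivity), Real.mul_rpow (by positivity) (by positivity)]
    gcongr
    calc (5 / 4 : ℝ) ^ (9 / 8 : ℝ) ≤ (5 / 4) ^ (2 : ℝ) :=
          Real.rpow_le_rpow_of_exponent_le (by norm_num) (by norm_num)
      _ ≤ 2 := by norm_num
  rw [upperFactor, div_eq_mul_inv]
  gcongr

/-- The exponent 1/4 of `pairKernel` is 9/8 - 7/8, the net power of the height in each variable. -/
theorem rpow_mul_upper_eq_pairKernel (δ c a b : ℝ) :
    ((1 + |a|) ^ (-(7 / 8) : ℝ) / ‖(δ + a * I : ℂ)‖) *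
      ((1 + |b|) ^ (-(7 / 8) : ℝ) / ‖(δ + b * I : ℂ)‖) *
      (((1 + |a|) ^ (9 / 8 : ℝ) * (1 + |b|) ^ (9 / 8 : ℝ)) *
        ‖(δ + ((a + b + c : ℝ) : ℂ) * I : ℂ)‖⁻¹) = pairKernel δ c (a, b) := by
  have h : ∀ x : ℝ, (1 + |x|) ^ (1 / 4 : ℝ) = (1 + |x|) ^ (-(7 / 8) : ℝ) * (1 + |x|) ^ (9 / 8 : ℝ) :=
    fun x => by rw [← Real.rpow_add (by positivity)]; norm_num
  simp only [pairKernel, h]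
  ring

variable {d₁ d₂ : ℕ} {χ₁ : DirichletCharacter ℂ d₁} {χ₂ : DirichletCharacter ℂ d₂}

/-- Bound for the Selberg sum, given a prime-sum expansion governed by a nontrivial character. -/
theorem exists_norm_S_le {D : ℕ} [NeZero D] {χ : DirichletCharacter ℂ D}
    (hχ : χ ≠ 1) (hq₁ : χ₁.IsQuadratic) (hq₂ : χ₂.IsQuadratic)
    (hc : ∀ p : ℕ, p.Prime → ¬ p ∣ D → (primeCoeff χ₁ χ₂ p : ℂ) = 1 + χ p) :
    ∃ A : ℝ, 0 < A ∧ ∀ X : ℝ, 3 ≤ X → ∀ z : ℂ, ‖z‖ ≤ 1 / 4 → -1 / Real.log X ≤ z.re →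
      ‖S χ₁ χ₂ X z‖ ≤ A * (X ^ (2 * ‖z‖) / Real.log X ^ 2) := by
  obtain ⟨C, hC, hprod⟩ := exists_norm_prod_localSum_le_factors hχ hq₁ hq₂ hc
  obtain ⟨C', hC', hint⟩ := exists_lintegral_pairKernel_mul_le
  -- The factor 4 comes from the two upper factors in each pairing, and (4e)⁴ from the four kernels.
  refine ⟨4 * C * (4 * Real.exp 1) ^ 4 * C', by positivity, fun X hX z hz hzre => ?_⟩
  have hX0 : 0 < X := by linarith
  have hL1 : 1 ≤ Real.log X := by
    rw [Real.le_log_iff_exp_le hX0]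
    linarith [Real.exp_one_lt_d9]
  have hL : 0 < Real.log X := by linarith
  set δ : ℝ := 1 / Real.log X with hδ
  have hδ0 : 0 < δ := by positivity
  have hδ1 : δ ≤ 1 := by rw [hδ, div_le_one hL]; exact hL1
  obtain ⟨N₀, hN₀⟩ := hprod δ hδ0 hδ1
  set N := max N₀ (⌊X⌋₊ + 1) with hN
  set c : ℝ := max z.re 0 + δ with hcd
  have hc0 : 0 < c := by have := le_max_right z.re 0; positivity
  have hy : |z.im| ≤ 1 / 4 := (Complex.abs_im_le_norm z).trans hz
  rw [S_eq_integral hq₁ hq₂ hX hz hc0 hδ0 hc0 hδ0 (N := N) (by omega)]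
  set M : ℝ := 4 * C * (4 * Real.exp 1) ^ 4 * (X ^ (2 * ‖z‖) / Real.log X ^ 4) with hM
  have hM0 : 0 ≤ M := by positivity
  have hpt : ∀ t : (ℝ × ℝ) × ℝ × ℝ,
      ‖((kern X c t.1.1 * kern X δ t.1.2) * (kern X c t.2.1 * kern X δ t.2.2)) *
        ∏ p ∈ N.primesBelow, localSum χ₁ χ₂ z (c + t.1.1 * I) (δ + t.1.2 * I) (c + t.2.1 * I)
        (δ + t.2.2 * I) p N‖ ≤ M * (pairKernel δ 0 t.1 * pairKernel δ 0 t.2 +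
        pairKernel δ (-z.im) (t.1.1, t.2.1) * pairKernel δ z.im (t.1.2, t.2.2)) := by
    rintro ⟨⟨t₁, t₂⟩, t₃, t₄⟩
    dsimp only
    have hw : OnLines z δ (c + t₁ * I) (δ + t₂ * I) (c + t₃ * I) (δ + t₄ * I) :=
      ⟨hz, hδ0, by rw [hδ, ← neg_div]; exact hzre, by simp [hcd], by simp, by simp [hcd], by simp⟩
    have hb := hN₀ N (le_max_left _ _) N (by omega) z _ _ _ _ hw
    obtain ⟨-, e12, e13, e24, e34⟩ := hw.exponents_re_ge
    have u12 := upperFactor_le (u := (c + t₁ * I) + (δ + t₂ * I)) (a := t₁) (b := t₂) (c := 0) hδ0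
      (by simp only [add_re, one_re] at e12 ⊢; linarith) (by norm_num) (by simp)
    have u34 := upperFactor_le (u := (c + t₃ * I) + (δ + t₄ * I)) (a := t₃) (b := t₄) (c := 0) hδ0
      (by simp only [add_re, one_re] at e34 ⊢; linarith) (by norm_num) (by simp)
    have u13 := upperFactor_le (u := (c + t₁ * I) + (c + t₃ * I) - z) (a := t₁) (b := t₃)
      (c := -z.im) hδ0 (by simp only [add_re, sub_re, one_re] at e13 ⊢; linarith)
      (by rwa [abs_neg]) (by simp [sub_eq_add_neg])
    have u24 := upperFactor_le (u := (δ + t₂ * I) + (δ + t₄ * I) + z) (a := t₂) (b := t₄)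
      (c := z.im) hδ0 (by simp only [add_re, one_re] at e24 ⊢; linarith) hy (by simp)
    have k1 := norm_kern_mul_lowerFactor_le hX hz hcd t₁
    have k3 := norm_kern_mul_lowerFactor_le hX hz hcd t₃
    -- For w₂ and w₄ the bound is taken at z = 0, so the powers of X come from w₁ and w₃ alone.
    have k2 := norm_kern_mul_lowerFactor_le hX (z := 0) (by simp) (c := δ) (by simp [hδ]) t₂
    have k4 := norm_kern_mul_lowerFactor_le hX (z := 0) (by simp) (c := δ) (by simp [hδ]) t₄
    rw [norm_zero, Real.rpow_zero, mul_one, sub_zero] at k2 k4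
    rw [← hδ] at k1 k2 k3 k4
    set ρ : ℝ → ℝ := fun t => (1 + |t|) ^ (-(7 / 8) : ℝ) / ‖(δ + t * I : ℂ)‖ with hρ
    have hρ0 : ∀ t, 0 ≤ ρ t := fun t => by simp only [hρ]; positivity
    have hk : (‖kern X c t₁‖ * lowerFactor (c + t₁ * I - z)) *
        (‖kern X δ t₂‖ * lowerFactor (δ + t₂ * I)) *
        ((‖kern X c t₃‖ * lowerFactor (c + t₃ * I - z)) *
        (‖kern X δ t₄‖ * lowerFactor (δ + t₄ * I))) ≤
        (4 * Real.exp 1 * X ^ ‖z‖ / Real.log X * ρ t₁) * (4 * Real.exp 1 / Real.log X * ρ t₂) *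
        ((4 * Real.exp 1 * X ^ ‖z‖ / Real.log X * ρ t₃) * (4 * Real.exp 1 / Real.log X * ρ t₄)) := by
      have l1 := lowerFactor_nonneg (c + t₁ * I - z)
      have l2 := lowerFactor_nonneg (δ + t₂ * I)
      have l3 := lowerFactor_nonneg (c + t₃ * I - z)
      have l4 := lowerFactor_nonneg (δ + t₄ * I)
      have := hρ0 t₁
      have := hρ0 t₂
      have := hρ0 t₃
      have := hρ0 t₄
      exact mul_le_mul (mul_le_mul k1 k2 (by positivity) (by positivity))
        (mul_le_mul k3 k4 (by positivity) (by positivity)) (by positivity) (by positivity)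
    have hup : upperFactor ((c + t₁ * I) + (δ + t₂ * I)) * upperFactor ((c + t₃ * I) + (δ + t₄ * I)) +
        upperFactor ((c + t₁ * I) + (c + t₃ * I) - z) *
          upperFactor ((δ + t₂ * I) + (δ + t₄ * I) + z) ≤ _ :=
      add_le_add (mul_le_mul u12 u34 (upperFactor_nonneg _) (by positivity))
        (mul_le_mul u13 u24 (upperFactor_nonneg _) (by positivity))
    have hup0 : 0 ≤ upperFactor ((c + t₁ * I) + (δ + t₂ * I)) *
        upperFactor ((c + t₃ * I) + (δ + t₄ * I)) +
        upperFactor ((c + t₁ * I) + (c + t₃ * I) - z) *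
          upperFactor ((δ + t₂ * I) + (δ + t₄ * I) + z) :=
      add_nonneg (mul_nonneg (upperFactor_nonneg _) (upperFactor_nonneg _))
        (mul_nonneg (upperFactor_nonneg _) (upperFactor_nonneg _))
    rw [norm_mul]
    refine (mul_le_mul_of_nonneg_left hb (norm_nonneg _)).trans ?_
    have hX2 : X ^ (2 * ‖z‖) = X ^ ‖z‖ * X ^ ‖z‖ := by rw [← Real.rpow_add hX0]; congr 1; ring
    rw [norm_mul, norm_mul, norm_mul]
    refine (le_of_eq_of_le ?_ (mul_le_mul_of_nonneg_left (mul_le_mul hk hup hup0 ?_) hC.le)).trans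
      (le_of_eq ?_)
    · ring
    · have := hρ0 t₁
      have := hρ0 t₂
      have := hρ0 t₃
      have := hρ0 t₄
      positivity
    · rw [← rpow_mul_upper_eq_pairKernel,
        ← rpow_mul_upper_eq_pairKernel, ← rpow_mul_upper_eq_pairKernel,
        ← rpow_mul_upper_eq_pairKernel, hM, hX2]
      simp only [hρ]
      ring
  -- Working with the lower integral of the norm makes integrability of the full integrand
  -- unnecessary.
  refine (norm_integral_le_lintegral_norm _).trans
    (ENNReal.toReal_le_of_le_ofReal (by positivity) ?_)
  refine (lintegral_mono fun t => ENNReal.ofReal_le_ofReal (hpt t)).trans ?_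
  simp only [ENNReal.ofReal_mul hM0]
  rw [lintegral_const_mul' _ _ ENNReal.ofReal_ne_top]
  refine (mul_le_mul_right (hint δ hδ0 hδ1 z.im) _).trans (le_of_eq ?_)
  rw [← ENNReal.ofReal_mul hM0]
  congr 1
  -- Here (log X)^(-4) from M meets δ^(-2) = (log X)² from the kernel integral.
  rw [hM, hδ]
  field_simp

end PointwiseBound

end SelbergSum

end

noncomputable section

/-! ### The product character and its nontriviality. -/

namespace SelbergSum
open Complex

section ProductCharacter

variable {d₁ d₂ : ℕ} (χ₁ : DirichletCharacter ℂ d₁) (χ₂ : DirichletCharacter ℂ d₂)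

/-- The product of two characters, as a character modulo the product of the moduli. -/
def productCharacter : DirichletCharacter ℂ (d₁ * d₂) :=
  DirichletCharacter.changeLevel (dvd_mul_right d₁ d₂) χ₁ *
    DirichletCharacter.changeLevel (dvd_mul_left d₂ d₁) χ₂

variable {χ₁ χ₂}

theorem productCharacter_natCast {n : ℕ} (hn : n.Coprime (d₁ * d₂)) :
    productCharacter χ₁ χ₂ n = χ₁ n * χ₂ n := by
  have h : IsCoprime (n : ℤ) ((d₁ * d₂ : ℕ) : ℤ) := Nat.isCoprime_iff_coprime.mpr hn
  have h1 := DirichletCharacter.changeLevel_eq_cast_of_dvd' χ₁ (dvd_mul_right d₁ d₂) h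
  have h2 := DirichletCharacter.changeLevel_eq_cast_of_dvd' χ₂ (dvd_mul_left d₂ d₁) h
  simp only [Int.cast_natCast] at h1 h2
  rw [productCharacter, MulChar.mul_apply, h1, h2]

/-- By the Chinese remainder theorem a unit a modulo d₁ lifts to some n that is 1 modulo d₂, and the
product character at n is χ₁(a). -/
theorem eq_one_of_productCharacter_eq_one [NeZero d₁] (h : d₁.Coprime d₂)
    (hχ : productCharacter χ₁ χ₂ = 1) : χ₁ = 1 := by
  refine MulChar.ext fun a => ?_
  rw [MulChar.one_apply_coe]
  obtain ⟨n, hn₁, hn₂⟩ := Nat.chineseRemainder h (a : ZMod d₁).val 1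
  have e₁ : (n : ZMod d₁) = a := by
    rw [(ZMod.natCast_eq_natCast_iff _ _ _).mpr hn₁, ZMod.natCast_zmod_val]
  have e₂ : (n : ZMod d₂) = 1 := by
    simpa using (ZMod.natCast_eq_natCast_iff _ _ _).mpr hn₂
  have c₁ : n.Coprime d₁ := (ZMod.isUnit_iff_coprime n d₁).mp (e₁ ▸ a.isUnit)
  have c₂ : n.Coprime d₂ := (ZMod.isUnit_iff_coprime n d₂).mp (e₂ ▸ isUnit_one)
  have hc := c₁.mul_right c₂
  have key := productCharacter_natCast (χ₁ := χ₁) (χ₂ := χ₂) hc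
  rw [hχ, MulChar.one_apply ((ZMod.isUnit_iff_coprime n _).mpr hc), e₁, e₂, map_one, mul_one] at key
  exact key.symm

theorem level_eq_one_of_isPrimitive {d : ℕ} [NeZero d] {χ : DirichletCharacter ℂ d}
    (hp : χ.IsPrimitive) (h : χ = 1) : d = 1 := by
  rw [DirichletCharacter.isPrimitive_def, h, DirichletCharacter.conductor_one] at hp
  exact hp.symm

/-- Otherwise both characters would be trivial, and a trivial primitive character has modulus 1. -/
theorem productCharacter_ne_one [NeZero d₁] [NeZero d₂] (h : d₁.Coprime d₂) (h₁ : χ₁.IsPrimitive)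
    (h₂ : χ₂.IsPrimitive) (hd : d₁ * d₂ ≠ 1) : productCharacter χ₁ χ₂ ≠ 1 := by
  intro hχ
  have e₁ := eq_one_of_productCharacter_eq_one h hχ
  have e₂ : χ₂ = 1 := by
    rw [productCharacter, e₁, DirichletCharacter.changeLevel_one, one_mul] at hχ
    exact (DirichletCharacter.changeLevel_eq_one_iff _).mp hχ
  exact hd (by rw [level_eq_one_of_isPrimitive h₁ e₁, level_eq_one_of_isPrimitive h₂ e₂])

/-- Away from the modulus both squares χᵢ(p)² equal 1, so (χ₁ + χ₂)²/2 = 1 + χ₁χ₂ at p. -/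
theorem primeCoeff_eq_one_add (hq₁ : χ₁.IsQuadratic) (hq₂ : χ₂.IsQuadratic) {p : ℕ} (hp : p.Prime)
    (hpd : ¬ p ∣ d₁ * d₂) : (primeCoeff χ₁ χ₂ p : ℂ) = 1 + productCharacter χ₁ χ₂ p := by
  have hc : p.Coprime (d₁ * d₂) := hp.coprime_iff_not_dvd.mpr hpd
  have hne : ∀ {d : ℕ} {χ : DirichletCharacter ℂ d}, χ.IsQuadratic → p.Coprime d → χ p ^ 2 = 1 := by
    intro d χ hq hd
    have hu : χ p ≠ 0 := (((ZMod.isUnit_iff_coprime p d).mpr hd).map χ).ne_zero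
    rcases hq p with h | h | h
    · exact absurd h hu
    · rw [h]; norm_num
    · rw [h]; norm_num
  rw [(primeCoeff_cases hq₁ hq₂ p).2.2, productCharacter_natCast hc]
  linear_combination (hne hq₁ (hc.coprime_dvd_right (dvd_mul_right d₁ d₂))) / 2 +
    (hne hq₂ (hc.coprime_dvd_right (dvd_mul_left d₂ d₁))) / 2

theorem IsFundamentalDiscriminant.ne_zero_and_ne_one {D : ℕ}
    (h : IsFundamentalDiscriminant (-(D : ℤ))) : D ≠ 0 ∧ D ≠ 1 := by
  constructor <;> rintro rfl <;> rcases h with ⟨-, h, -⟩ | ⟨h, -, h'⟩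
  · norm_num at h
  · norm_num at h'
  · norm_num at h
  · norm_num at h

end ProductCharacter

end SelbergSum

end

theorem lemma9 :
    ∃ C : ℝ, 1 ≤ C ∧
      ∀ (D d₁ d₂ : ℕ) (χ₁ : DirichletCharacter ℂ d₁) (χ₂ : DirichletCharacter ℂ d₂),
        SelbergSum.IsFundamentalDiscriminant (-(D : ℤ)) →
        d₁.Coprime d₂ → d₁ * d₂ = D →
        χ₁.IsPrimitive → χ₁.IsQuadratic →
        χ₂.IsPrimitive → χ₂.IsQuadratic →
        (∀ n : ℕ, 0 < n → χ₁ n * χ₂ n = SelbergSum.kroneckerSymbol (-(D : ℤ)) n) →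
        ∃ A : ℝ, 0 < A ∧ ∀ X : ℝ, 3 ≤ X → ∀ z : ℂ,
          ‖z‖ ≤ C⁻¹ → -1 / Real.log X ≤ z.re →
          ‖SelbergSum.S χ₁ χ₂ X z‖ ≤ A * (X ^ (2 * ‖z‖) / Real.log X ^ 2) := by
  -- C = 4 means |z| ≤ 1/4, hence Re(1 - z) ≥ 3/4, the range in which the local series are
  -- controlled.
  refine ⟨4, by norm_num, fun D d₁ d₂ χ₁ χ₂ hD hcop hmul hp₁ hq₁ hp₂ hq₂ _ => ?_⟩
  subst hmul
  obtain ⟨h0, h1⟩ := hD.ne_zero_and_ne_one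
  have : NeZero d₁ := ⟨left_ne_zero_of_mul h0⟩
  have : NeZero d₂ := ⟨right_ne_zero_of_mul h0⟩
  obtain ⟨A, hA, h⟩ := SelbergSum.exists_norm_S_le
    (SelbergSum.productCharacter_ne_one hcop hp₁ hp₂ h1) hq₁ hq₂
    fun p hp hpd => SelbergSum.primeCoeff_eq_one_add hq₁ hq₂ hp hpd
  exact ⟨A, hA, fun X hX z hz hzre => h X hX z (by rwa [one_div]) hzre⟩
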